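/- For integers $d\ge 1$ and $l\ge 1$ let $\varphi^{(l)}_{\mathbf m}(\mathbf r)=\prod_{i=1}^d\max\{0,\,1-|2^l r_i-m_i|\}$, $\mathbf m\in\{1,\dots,2^l-1\}^d$, be the nodal (multilinear hat) basis functions of mesh size $2^{-l}$ on $[0,1]^d$, and for $l\le l'$ let $I^d_{l\to l'}\in\mathbb R^{(2^{l'}-1)^d\times(2^l-1)^d}$ be the interpolation operator, i.e. the matrix that sends the coefficient vector of a function $\sum_{\mathbf m}u_{\mathbf m}\varphi^{(l)}_{\mathbf m}$ to the coefficient vector of the same function in the basis $(\varphi^{(l')}_{\mathbf m})_{\mathbf m}$ (indices are ordered lexicographically). Put $N=\sum_{l=1}^L(2^l-1)^d$, and let $\hat I^d_{l\to L}\in\mathbb R^{N\times N}$ be the $L\times L$ block matrix with blocks of sizes $(2^s-1)^d\times(2^{s'}-1)^d$, $s,s'\in\{1,\dots,L\}$, whose block in row $L$ and column $l$ is $I^d_{l\to L}$ and whose other blocks vanish. The modified BPX preconditioner, zero-padded to a square matrix, is $$\hat F^d_L=\sum_{l=1}^L 2^{-l(2-d)/2}\,\hat I^d_{l\to L}\in\mathbb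 R^{N\times N}.$$ Embed it as the top left corner of a matrix of size $2^{s}\times 2^{s}$ with $s=d(L+1)$ that is zero elsewhere; this is an operator on $s$ qubits, again denoted by $\hat F^d_L$. A unitary $U$ on $q+s$ qubits is an $(\alpha,q,\varepsilon)$-block encoding of an $s$-qubit operator $A$ if $\|A-\alpha(\langle 0|^{\otimes q}\otimes I)U(|0\rangle^{\otimes q}\otimes I)\|\le\varepsilon$ in the spectral norm. A circuit of (arbitrary) one- and two-qubit gates implements $U$ with $w$ work qubits if it maps $|0\rangle^{\otimes w}\otimes|\psi\rangle$ to $|0\rangle^{\otimes w}\otimes U|\psi\rangle$ for every $|\psi\rangle$. **Theorem.** There are polynomials $p$ and $P$ with natural-number coefficients such that for all integers $d\ge1$ and $L\ge1$ there are $q\le p(L)$, a number $w$ of work qubits with $q+w\le P(dL)$, and an $(L\,2^{dL/2},\,q,\,0)$-block encoding $U$ of $\hat F^d_L$ that is implemented, with $w$ work qubits, by a circuit of at most $P(dL)$ one- and two-qubit gates. -/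

import Mathlib

noncomputable section

namespace BPX

/-! ## Nodal basis and interpolation operators -/

/-- The one-dimensional nodal (hat) function of the node `m h`, with mesh size `h = 2 ^ (-l)`. -/
def hat (l m : ℕ) (r : ℝ) : ℝ :=
  let h : ℝ := 1 / 2 ^ l
  if ((m : ℝ) - 1) * h ≤ r ∧ r ≤ (m : ℝ) * h then (r - ((m : ℝ) - 1) * h) / h
  else if (m : ℝ) * h ≤ r ∧ r ≤ ((m : ℝ) + 1) * h then (((m : ℝ) + 1) * h - r) / h
  else 0

/-- The interior nodes of the `d`-dimensional mesh of level `l`, of which there are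
`(2 ^ l - 1) ^ d`. The coordinate `i : Fin (2 ^ l - 1)` stands for the node number `i + 1`. -/
abbrev Node (d l : ℕ) : Type := Fin d → Fin (2 ^ l - 1)

/-- The `d`-dimensional nodal basis function on `[0, 1] ^ d` of the node `m` of level `l`. -/
def nodal (d l : ℕ) (m : Node d l) (r : Fin d → unitInterval) : ℝ :=
  ∏ i, hat l ((m i : ℕ) + 1) (r i : ℝ)

/-- `A` sends the coefficient vector of a finite element function in the nodal basis of level `l`
to the coefficient vector of the same function in the nodal basis of level `l'`. -/
def IsInterpolation (d l l' : ℕ) (A : Matrix (Node d l') (Node d l) ℝ) : Prop :=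
  ∀ u : Node d l → ℝ, ∀ r : Fin d → unitInterval,
    ∑ p, (A.mulVec u) p * nodal d l' p r = ∑ m, u m * nodal d l m r

theorem hat_eq (l m : ℕ) (r : ℝ) : hat l m r = max 0 (1 - |r * 2 ^ l - m|) := by
  have h2 : (0 : ℝ) < 2 ^ l := by positivity
  unfold hat
  simp only [mul_one_div, div_le_iff₀ h2, le_div_iff₀ h2]
  split_ifs with h1 h3
  · rw [abs_of_nonpos (by linarith [h1.2]), max_eq_right (by linarith [h1.1])]
    field_simp
    ring
  · rw [abs_of_nonneg (by linarith [h3.1]), max_eq_right (by linarith [h3.2])]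
    field_simp
    ring
  · symm
    apply max_eq_left
    by_contra hc
    have hc' : |r * 2 ^ l - m| < 1 := by linarith
    rw [abs_lt] at hc'
    rcases le_total (r * 2 ^ l) m with h | h
    · exact h1 ⟨by linarith [hc'.1], h⟩
    · exact h3 ⟨h, by linarith [hc'.2]⟩

theorem hat_refine (l m : ℕ) (hm : 1 ≤ m) (r : ℝ) :
    hat l m r = 1 / 2 * hat (l + 1) (2 * m - 1) r + hat (l + 1) (2 * m) r
      + 1 / 2 * hat (l + 1) (2 * m + 1) r := by
  simp only [hat_eq, pow_succ]
  rw [Nat.cast_sub (by omega)]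
  push_cast
  set z : ℝ := r * 2 ^ l - m with hz
  have e1 : r * (2 ^ l * 2) - (2 * (m : ℝ) - 1) = 2 * z + 1 := by rw [hz]; ring
  have e2 : r * (2 ^ l * 2) - 2 * (m : ℝ) = 2 * z := by rw [hz]; ring
  have e3 : r * (2 ^ l * 2) - (2 * (m : ℝ) + 1) = 2 * z - 1 := by rw [hz]; ring
  rw [e1, e2, e3]
  have f0 : ∀ t : ℝ, t ≤ -1 → max 0 (1 - |t|) = 0 := fun t h => by
    rw [abs_of_nonpos (by linarith)]; exact max_eq_left (by linarith)
  have f1 : ∀ t : ℝ, -1 ≤ t → t ≤ 0 → max 0 (1 - |t|) = 1 + t := fun t h h' => by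
    rw [abs_of_nonpos h', max_eq_right (by linarith)]; ring
  have f2 : ∀ t : ℝ, 0 ≤ t → t ≤ 1 → max 0 (1 - |t|) = 1 - t := fun t h h' => by
    rw [abs_of_nonneg h, max_eq_right (by linarith)]
  have f3 : ∀ t : ℝ, 1 ≤ t → max 0 (1 - |t|) = 0 := fun t h => by
    rw [abs_of_nonneg (by linarith)]; exact max_eq_left (by linarith)
  rcases le_total z 0 with h | h
  · rw [f0 (2 * z - 1) (by linarith)]
    rcases le_total z (-1) with k | k
    · rw [f0 z k, f0 (2 * z) (by linarith), f0 (2 * z + 1) (by linarith)]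
      ring
    · rw [f1 z k h]
      rcases le_total z (-(1 / 2)) with k' | k'
      · rw [f0 (2 * z) (by linarith), f1 (2 * z + 1) (by linarith) (by linarith)]
        ring
      · rw [f1 (2 * z) (by linarith) (by linarith), f2 (2 * z + 1) (by linarith) (by linarith)]
        ring
  · rw [f3 (2 * z + 1) (by linarith)]
    rcases le_total z 1 with k | k
    · rw [f2 z h k]
      rcases le_total z (1 / 2) with k' | k'
      · rw [f2 (2 * z) (by linarith) (by linarith), f1 (2 * z - 1) (by linarith) (by linarith)]
        ring
      · rw [f3 (2 * z) (by linarith), f2 (2 * z - 1) (by linarith) (by linarith)]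
        ring
    · rw [f3 z k, f3 (2 * z) (by linarith), f3 (2 * z - 1) (by linarith)]
      ring

theorem exists_refine_one (l l' : ℕ) (h : l ≤ l') :
    ∃ c : Fin (2 ^ l' - 1) → Fin (2 ^ l - 1) → ℝ, ∀ (m : Fin (2 ^ l - 1)) (r : ℝ),
      hat l ((m : ℕ) + 1) r = ∑ p, c p m * hat l' ((p : ℕ) + 1) r := by
  induction l', h using Nat.le_induction with
  | base => exact ⟨fun p m => if p = m then 1 else 0, fun m r => by simp⟩
  | succ k hk ih =>
    obtain ⟨c, hc⟩ := ih
    have step : ∀ m : Fin (2 ^ k - 1), ∃ e : Fin (2 ^ (k + 1) - 1) → ℝ, ∀ r : ℝ,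
        hat k ((m : ℕ) + 1) r = ∑ p, e p * hat (k + 1) ((p : ℕ) + 1) r := by
      intro m
      have hm := m.2
      have hp : 2 ^ (k + 1) = 2 * 2 ^ k := by ring
      let p1 : Fin (2 ^ (k + 1) - 1) := ⟨2 * m, by omega⟩
      let p2 : Fin (2 ^ (k + 1) - 1) := ⟨2 * m + 1, by omega⟩
      let p3 : Fin (2 ^ (k + 1) - 1) := ⟨2 * m + 2, by omega⟩
      refine ⟨fun p => (if p = p1 then 1 / 2 else 0) + (if p = p2 then 1 else 0)
        + (if p = p3 then 1 / 2 else 0), fun r => ?_⟩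
      rw [hat_refine k _ (by omega)]
      simp only [add_mul, ite_mul, zero_mul, Finset.sum_add_distrib, Finset.sum_ite_eq',
        Finset.mem_univ, if_true, one_mul, p1, p2, p3]
      rfl
    choose e he using step
    refine ⟨fun p m => ∑ q, c q m * e q p, fun m r => ?_⟩
    rw [hc m r]
    simp only [he, Finset.mul_sum, Finset.sum_mul]
    rw [Finset.sum_comm]
    simp only [mul_assoc]

theorem nodal_node (d l : ℕ) (p q : Node d l) :
    nodal d l p (fun i => ⟨((q i : ℕ) + 1 : ℝ) / 2 ^ l, by positivity, by
      rw [div_le_one (by positivity)]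
      have h := (q i).2
      exact_mod_cast (by omega : (q i : ℕ) + 1 ≤ 2 ^ l)⟩) = if p = q then 1 else 0 := by
  have key : ∀ a b : ℕ, hat l (a + 1) (((b : ℝ) + 1) / 2 ^ l) = if a = b then 1 else 0 := by
    intro a b
    rw [hat_eq, div_mul_cancel₀ _ (by positivity)]
    push_cast
    split_ifs with hab
    · simp [hab]
    · apply max_eq_left
      have h1 : (1 : ℤ) ≤ |(b : ℤ) - a| := Int.one_le_abs (by omega)
      have h2 : (1 : ℝ) ≤ |(b : ℝ) - a| := by exact_mod_cast h1
      rw [add_sub_add_right_eq_sub]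
      linarith
  unfold nodal
  simp only [key]
  by_cases hpq : p = q
  · simp [hpq]
  · rw [if_neg hpq]
    obtain ⟨i, hi⟩ := Function.ne_iff.mp hpq
    exact Finset.prod_eq_zero (Finset.mem_univ i) (if_neg (fun h => hi (Fin.ext h)))

/-- The interpolation operator exists and is unique, because the meshes are nested and the nodal
functions are linearly independent. -/
theorem existsUnique_interpolation (d l l' : ℕ) (h : l ≤ l') :
    ∃! A : Matrix (Node d l') (Node d l) ℝ, IsInterpolation d l l' A := by
  obtain ⟨c, hc⟩ := exists_refine_one l l' h
  have hC : IsInterpolation d l l' (fun p m => ∏ i, c (p i) (m i)) := by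
    intro u r
    have e : ∀ m, nodal d l m r = ∑ p : Node d l', (∏ i, c (p i) (m i)) * nodal d l' p r := by
      intro m
      unfold nodal
      simp only [hc, ← Finset.prod_mul_distrib]
      rw [Finset.prod_univ_sum, Fintype.piFinset_univ]
    simp only [e, Matrix.mulVec, dotProduct, Finset.sum_mul, Finset.mul_sum]
    rw [Finset.sum_comm]
    exact Finset.sum_congr rfl fun m _ => Finset.sum_congr rfl fun p _ => by ring
  have val : ∀ B : Matrix (Node d l') (Node d l) ℝ, IsInterpolation d l l' B →
      ∀ q m, B q m = nodal d l m (fun i => ⟨((q i : ℕ) + 1 : ℝ) / 2 ^ l', by positivity, by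
        rw [div_le_one (by positivity)]
        have h := (q i).2
        exact_mod_cast (by omega : (q i : ℕ) + 1 ≤ 2 ^ l')⟩) := by
    intro B hB q m
    have := hB (Pi.single m 1) (fun i => ⟨((q i : ℕ) + 1 : ℝ) / 2 ^ l', by positivity, by
        rw [div_le_one (by positivity)]
        have h := (q i).2
        exact_mod_cast (by omega : (q i : ℕ) + 1 ≤ 2 ^ l')⟩)
    simp only [nodal_node] at this
    simpa [Pi.single_apply] using this
  refine ⟨_, hC, fun A hA => ?_⟩
  ext q m
  rw [val A hA, val _ hC]

/-- The interpolation operator from level `l` to level `l'` in `d` dimensions. -/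
def interp (d l l' : ℕ) (h : l ≤ l') : Matrix (Node d l') (Node d l) ℝ :=
  (existsUnique_interpolation d l l' h).choose

/-! ## The preconditioner -/

/-- The grid points of the levels `1, …, L`; the number `l : Fin L` stands for the level `l + 1`. -/
abbrev GridPoint (d L : ℕ) : Type := Σ l : Fin L, Node d ((l : ℕ) + 1)

/-- The total number of grid points of the levels `1, …, L`. -/
abbrev numGridPoints (d L : ℕ) : ℕ := ∑ l : Fin L, (2 ^ ((l : ℕ) + 1) - 1) ^ d

/-- The enumeration of the grid points: level by level, and lexicographically (first coordinate
most significant, as for Kronecker products) within a level. -/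
def gridIndex (d L : ℕ) : GridPoint d L ≃ Fin (numGridPoints d L) :=
  (Equiv.sigmaCongrRight fun l : Fin L =>
    (Equiv.arrowCongr Fin.revPerm (Equiv.refl (Fin (2 ^ ((l : ℕ) + 1) - 1)))).trans
      finFunctionFinEquiv).trans finSigmaFinEquiv

/-- The `L × L` block matrix whose block in row `l'` and column `l` is the interpolation operator
from level `l` to level `l'` and whose other blocks vanish. -/
def interpHat (d L l l' : ℕ) (h : l ≤ l') : Matrix (GridPoint d L) (GridPoint d L) ℝ :=
  fun p q =>
    if hpq : (q.1 : ℕ) + 1 = l ∧ (p.1 : ℕ) + 1 = l' then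
      interp d ((q.1 : ℕ) + 1) ((p.1 : ℕ) + 1) (hpq.1.trans_le (h.trans_eq hpq.2.symm)) p.2 q.2
    else 0

/-- The modified BPX preconditioner, as a square matrix that is zero outside the rows of the
finest level. -/
def precond (d L : ℕ) : Matrix (Fin (numGridPoints d L)) (Fin (numGridPoints d L)) ℝ :=
  Matrix.reindex (gridIndex d L) (gridIndex d L)
    (∑ l : Fin L, (2 : ℝ) ^ (-(((l : ℕ) : ℝ) + 1) * (2 - (d : ℝ)) / 2) •
      interpHat d L ((l : ℕ) + 1) L l.2)

/-- The matrix of size `M` with `A` in its top left corner and zeros elsewhere. -/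
def zeroPad {N : ℕ} (M : ℕ) (A : Matrix (Fin N) (Fin N) ℝ) : Matrix (Fin M) (Fin M) ℂ :=
  fun i j => if h : (i : ℕ) < N ∧ (j : ℕ) < N then (A ⟨i, h.1⟩ ⟨j, h.2⟩ : ℂ) else 0

/-- The preconditioner fits into `d (L + 1)` qubits, so that `zeroPad` does not truncate it. -/
theorem numGridPoints_le (d L : ℕ) (hd : 1 ≤ d) : numGridPoints d L ≤ 2 ^ (d * (L + 1)) := by
  unfold numGridPoints
  rw [Fin.sum_univ_eq_sum_range (fun l => (2 ^ (l + 1) - 1) ^ d)]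
  induction L with
  | zero => simp
  | succ k ih =>
    rw [Finset.sum_range_succ]
    have h1 : (2 ^ (k + 1) - 1) ^ d ≤ 2 ^ (d * (k + 1)) := by
      rw [mul_comm, pow_mul]
      exact Nat.pow_le_pow_left (Nat.sub_le _ _) d
    have h2 : 2 * 2 ^ (d * (k + 1)) ≤ 2 ^ (d * (k + 1 + 1)) := by
      rw [← pow_succ']
      exact Nat.pow_le_pow_right (by norm_num) (by nlinarith)
    omega

/-! ## Quantum circuits -/

/-- Operators on qubits that are labelled by `ι`, in the computational basis. -/
abbrev QubitOp (ι : Type) : Type := Matrix (ι → Fin 2) (ι → Fin 2) ℂ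

/-- A one- or two-qubit gate: an arbitrary unitary on one qubit or on two distinct qubits. -/
inductive Gate (ι : Type) : Type
  | one (i : ι) (u : Matrix.unitaryGroup (Fin 2) ℂ) : Gate ι
  | two (i j : ι) (hij : i ≠ j) (u : Matrix.unitaryGroup (Fin 2 × Fin 2) ℂ) : Gate ι

/-- The operator of a gate on the whole register. -/
def Gate.toOp {ι : Type} [Fintype ι] [DecidableEq ι] : Gate ι → QubitOp ι
  | .one i u => fun x y => if ∀ k, k ≠ i → x k = y k then u.1 (x i) (y i) else 0
  | .two i j _ u => fun x y =>
      if ∀ k, k ≠ i → k ≠ j → x k = y k then u.1 (x i, x j) (y i, y j) else 0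

/-- A circuit is the list of its gates; the head of the list is applied first. The number of gates
is the length of the list. -/
abbrev Circuit (ι : Type) : Type := List (Gate ι)

/-- The operator of a circuit. -/
def Circuit.toOp {ι : Type} [Fintype ι] [DecidableEq ι] : Circuit ι → QubitOp ι
  | [] => 1
  | g :: c => Circuit.toOp c * g.toOp

/-- The circuit `c` implements `U` with the help of `w` work qubits: started with the work qubits
in the zero state, it applies `U` to the other qubits and returns the work qubits to the
zero state. -/
def Circuit.Implements {w : ℕ} {κ : Type} [Fintype κ] [DecidableEq κ] (c : Circuit (Fin w ⊕ κ))
    (U : QubitOp κ) : Prop :=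
  ∀ (a : Fin w → Fin 2) (x y : κ → Fin 2),
    Circuit.toOp c (Sum.elim a x) (Sum.elim 0 y) = if a = 0 then U x y else 0

/-! ## Block encodings -/

/-- The block of `U` in which the first `q` qubits start and end in the zero state. -/
def zeroBlock {q s : ℕ} (U : QubitOp (Fin q ⊕ Fin s)) : QubitOp (Fin s) :=
  fun x y => U (Sum.elim 0 x) (Sum.elim 0 y)

/-- `U` is an `(α, q, ε)`-block encoding of the operator `A` on `s` qubits, with respect to the
spectral norm. -/
structure IsBlockEncoding {s : ℕ} (α : ℝ) (q : ℕ) (ε : ℝ) (U : QubitOp (Fin q ⊕ Fin s))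
    (A : QubitOp (Fin s)) : Prop where
  unitary : U ∈ Matrix.unitaryGroup (Fin q ⊕ Fin s → Fin 2) ℂ
  norm_sub_le : ‖Matrix.toEuclideanCLM (𝕜 := ℂ) (A - (α : ℂ) • zeroBlock U)‖ ≤ ε

/-- A matrix of size `2 ^ s` as an operator on `s` qubits, through binary expansion. -/
def toQubits {s : ℕ} (A : Matrix (Fin (2 ^ s)) (Fin (2 ^ s)) ℂ) : QubitOp (Fin s) :=
  A.submatrix finFunctionFinEquiv finFunctionFinEquiv

end BPX

end

/-! The preconditioner is realised exactly, because arbitrary one- and two-qubit gates give all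
amplitudes that are needed. Three mechanisms carry the proof.

Interpolation. A hat function is the convolution of two boxes. Put K = 2^(L-l) and store a
coordinate of a node of level l, counted from 0, as the integer mK. Hadamard gates on its L-l low
bits spread it uniformly over mK + [0, K). An adder register, spread uniformly over [0, K), is added
and then projected back to zero by Hadamard gates. The fine node N is reached with amplitude
2^(-3(L-l)/2) times the number of pairs j, k < K with N = mK + j + k (`digitOp_apply`). That number
is K times a value of the hat function (`cast_hatCount`), so the amplitude is 2^(-(L-l)/2) times the
one-dimensional interpolation entry. Applying this to all coordinates gives the product
(`interpOp_apply`, `interp_apply`).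

Sum over levels. The level is held in a one-hot label. Reflections on the label qubits and on one
scalar qubit return them to zero with amplitude exactly 2^(-l)/L (`combineOp_apply`). Together with
the factor L 2^(dL/2) the exponent of 2 is dL/2 - l - d(L-l)/2 = -l(2-d)/2 (`amplitude_eq`).

Numbering. Within a level, grid points are numbered in base 2^l - 1, which is not a power of two, so
matrix indices must be converted to blocks of binary digits. Encoding is a weighted sum of bits. On
valid codes the weights dominate the partial sums below them, so a greedy expansion inverts it
(`decode_encode`). Numbers and labelled codes are exchanged by an involution
(`swapCode_involutive`). An involution that is computed by n NAND steps has a circuit of size linear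
in n and in the number of qubits, by computing, swapping registers and computing again
(`Impl.permOp_of_reach`); for this reason every classical step is designed as an involution.

Zero entries of the padded matrix come from flags: an invalid row or column leaves some ancilla in a
wrong state (`totalOp_eq_zero_of_row`, `totalOp_eq_zero_of_column`). A nonzero adder register shows
up in a spare bit of the block just treated. The entries are compared in `totalOp_eq_zeroPad`. -/

noncomputable section

namespace BPX

open Function

/-! ## Multiplexed one-qubit gates, basis permutations and circuits -/

section Mux

variable {ι : Type} [Fintype ι] [DecidableEq ι]

/-- The operator that applies to the qubit `t` a one-qubit operator depending on the basis state. -/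
def mux (t : ι) (M : (ι → Fin 2) → Matrix (Fin 2) (Fin 2) ℂ) : QubitOp ι :=
  fun x y => if ∀ k, k ≠ t → x k = y k then M x (x t) (y t) else 0

theorem mux_mul_apply {α : Type*} (t : ι) (M : (ι → Fin 2) → Matrix (Fin 2) (Fin 2) ℂ)
    (A : Matrix (ι → Fin 2) α ℂ) (x : ι → Fin 2) (y : α) :
    (mux t M * A) x y = ∑ e, M x (x t) e * A (update x t e) y := by
  rw [Matrix.mul_apply]
  symm
  refine Fintype.sum_of_injective (fun e => update x t e) (update_injective x t) _ _ ?_ ?_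
  · intro z hz
    rw [mux, if_neg, zero_mul]
    intro h
    exact hz ⟨z t, update_eq_iff.2 ⟨rfl, h⟩⟩
  · intro e
    rw [mux, if_pos]
    · simp
    · intro k hk
      simp [hk]

/-- Since `M'` ignores the bit `t`, both factors select their matrices at the same state and
multiply branch by branch. -/
theorem mux_mul (t : ι) (M M' : (ι → Fin 2) → Matrix (Fin 2) (Fin 2) ℂ)
    (hM' : ∀ x e, M' (update x t e) = M' x) :
    mux t M * mux t M' = mux t fun x => M x * M' x := by
  ext x y
  rw [mux_mul_apply]
  have h : ∀ e, (∀ k, k ≠ t → update x t e k = y k) ↔ ∀ k, k ≠ t → x k = y k := fun e =>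
    forall_congr' fun k => forall_congr' fun hk => by rw [update_of_ne hk]
  simp only [mux, h, hM', update_self]
  split_ifs
  · rw [Matrix.mul_apply]
  · simp

theorem mux_one (t : ι) : mux t (fun _ => 1) = (1 : QubitOp ι) := by
  ext x y
  rw [mux, Matrix.one_apply, Matrix.one_apply]
  by_cases h : x = y
  · simp [h]
  · rw [if_neg h]
    split_ifs with h1 h2
    · exact absurd (funext fun k => if hk : k = t then hk ▸ h2 else h1 k hk) h
    · rfl
    · rfl

theorem mux_mem_unitaryGroup (t : ι) (M : (ι → Fin 2) → Matrix (Fin 2) (Fin 2) ℂ)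
    (hM : ∀ x e, M (update x t e) = M x) (hu : ∀ x, M x ∈ Matrix.unitaryGroup (Fin 2) ℂ) :
    mux t M ∈ Matrix.unitaryGroup (ι → Fin 2) ℂ := by
  have hs : star (mux t M) = mux t fun x => star (M x) := by
    ext x y
    rw [Matrix.star_apply, mux, mux]
    by_cases h : ∀ k, k ≠ t → x k = y k
    · have e : y = update x t (y t) := eq_update_iff.2 ⟨rfl, fun k hk => (h k hk).symm⟩
      rw [if_pos h, if_pos fun k hk => (h k hk).symm, Matrix.star_apply]
      conv_lhs => rw [e, hM]
      simp
    · rw [if_neg h, if_neg fun h' => h fun k hk => (h' k hk).symm, star_zero]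
  rw [Matrix.mem_unitaryGroup_iff, hs, mux_mul _ _ _ fun x e => by rw [hM]]
  simp only [fun x => Matrix.mem_unitaryGroup_iff.1 (hu x), mux_one]

end Mux

/-! ### Matrices of involutions of basis states -/

section PermOp

variable {α : Type*} [Fintype α] [DecidableEq α]

/-- The matrix of a map between basis states. -/
def permOp (σ : α → α) : Matrix α α ℂ := fun x y => if x = σ y then 1 else 0

theorem mul_permOp_apply {β : Type*} (σ : α → α) (A : Matrix β α ℂ) (x : β) (y : α) :
    (A * permOp σ) x y = A x (σ y) := by
  simp [Matrix.mul_apply, permOp]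

theorem permOp_mul_apply {β : Type*} {σ : α → α} (h : Involutive σ) (A : Matrix α β ℂ)
    (x : α) (y : β) : (permOp σ * A) x y = A (σ x) y := by
  have e : ∀ z, x = σ z ↔ z = σ x := fun z => ⟨fun hz => by rw [hz, h], fun hz => by rw [hz, h]⟩
  simp [Matrix.mul_apply, permOp, e]

theorem permOp_mem_unitaryGroup {σ : α → α} (h : Involutive σ) :
    permOp σ ∈ Matrix.unitaryGroup α ℂ := by
  have hs : star (permOp σ) = permOp σ := by
    ext x y
    have e : y = σ x ↔ x = σ y := ⟨fun hz => by rw [hz, h], fun hz => by rw [hz, h]⟩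
    simp [Matrix.star_apply, permOp, e, apply_ite]
  rw [Matrix.mem_unitaryGroup_iff, hs]
  ext x y
  rw [permOp_mul_apply h, permOp, Matrix.one_apply]
  simp [h.injective.eq_iff]

end PermOp

/-! ### Circuits and controlled gates -/

section Circuits

variable {ι : Type} [Fintype ι] [DecidableEq ι]

theorem Circuit.toOp_append (c c' : Circuit ι) :
    Circuit.toOp (c ++ c') = Circuit.toOp c' * Circuit.toOp c := by
  induction c with
  | nil => simp [Circuit.toOp]
  | cons g c ih => simp only [List.cons_append, Circuit.toOp, ih, Matrix.mul_assoc]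

theorem Gate.toOp_one (i : ι) (u : Matrix.unitaryGroup (Fin 2) ℂ) :
    (Gate.one i u).toOp = mux i fun _ => u.1 := rfl

/-- The matrix of a controlled one-qubit operator. -/
def ctrlMatrix (G : Matrix (Fin 2) (Fin 2) ℂ) : Matrix (Fin 2 × Fin 2) (Fin 2 × Fin 2) ℂ :=
  fun p q => if p.1 = q.1 then (if p.1 = 1 then G else 1) p.2 q.2 else 0

theorem ctrlMatrix_mem {G : Matrix (Fin 2) (Fin 2) ℂ} (hG : G ∈ Matrix.unitaryGroup (Fin 2) ℂ) :
    ctrlMatrix G ∈ Matrix.unitaryGroup (Fin 2 × Fin 2) ℂ := by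
  rw [Matrix.mem_unitaryGroup_iff] at hG ⊢
  have h := fun i j => congrFun (congrFun hG i) j
  ext ⟨a, b⟩ ⟨a', b'⟩
  have hb := h b b'
  simp only [Matrix.mul_apply, Matrix.star_apply, Fin.sum_univ_two, Matrix.one_apply] at hb
  simp only [Matrix.mul_apply, Matrix.star_apply, ctrlMatrix, Fintype.sum_prod_type,
    Fin.sum_univ_two]
  fin_cases a <;> fin_cases a' <;> fin_cases b <;> fin_cases b' <;>
    simp_all [Matrix.one_apply]

/-- The controlled gate with control `c` and target `t`. -/
def ctrlGate (c t : ι) (hct : c ≠ t) {G : Matrix (Fin 2) (Fin 2) ℂ}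
    (hG : G ∈ Matrix.unitaryGroup (Fin 2) ℂ) : Gate ι :=
  Gate.two c t hct ⟨ctrlMatrix G, ctrlMatrix_mem hG⟩

theorem ctrlGate_toOp (c t : ι) (hct : c ≠ t) {G : Matrix (Fin 2) (Fin 2) ℂ}
    (hG : G ∈ Matrix.unitaryGroup (Fin 2) ℂ) :
    (ctrlGate c t hct hG).toOp = mux t fun x => if x c = 1 then G else 1 := by
  ext x y
  simp only [ctrlGate, Gate.toOp, mux, ctrlMatrix]
  by_cases h : ∀ k, k ≠ t → x k = y k
  · rw [if_pos h, if_pos fun k _ hk => h k hk, if_pos (h c hct)]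
  · rw [if_neg h]
    split_ifs with h1 h2 h3
    · exact absurd (fun k hk => if hkc : k = c then hkc ▸ h2 else h1 k hkc hk) h
    all_goals first | rfl | exact absurd (fun k hk => if hkc : k = c then hkc ▸ h2 else h1 k hkc hk) h

/-- The circuit sends the basis state `y` to the basis state `y'`. -/
def Maps (c : Circuit ι) (y y' : ι → Fin 2) : Prop :=
  ∀ x, Circuit.toOp c x y = if x = y' then 1 else 0

theorem Maps.nil (y : ι → Fin 2) : Maps [] y y := fun x => by
  rw [Circuit.toOp, Matrix.one_apply]

theorem Maps.append {c c' : Circuit ι} {y y' y'' : ι → Fin 2} (h : Maps c y y')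
    (h' : Maps c' y' y'') : Maps (c ++ c') y y'' := fun x => by
  rw [Circuit.toOp_append, Matrix.mul_apply]
  simp only [h _, mul_ite, mul_one, mul_zero, Finset.sum_ite_eq', Finset.mem_univ, if_true]
  exact h' x

theorem Maps.of_eq_permOp {c : Circuit ι} {σ : (ι → Fin 2) → (ι → Fin 2)}
    (h : Circuit.toOp c = permOp σ) (y : ι → Fin 2) : Maps c y (σ y) := fun x => by
  rw [h, permOp]

/-! ### Classical gates -/

/-- The Pauli matrix `X`. -/
def pauliX : Matrix (Fin 2) (Fin 2) ℂ := !![0, 1; 1, 0]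

theorem pauliX_mem : pauliX ∈ Matrix.unitaryGroup (Fin 2) ℂ := by
  rw [Matrix.mem_unitaryGroup_iff]
  ext i j
  fin_cases i <;> fin_cases j <;> simp [pauliX, Matrix.mul_apply, Matrix.star_apply]

/-- A square root of the Pauli matrix `X`. -/
def sqrtX : Matrix (Fin 2) (Fin 2) ℂ :=
  !![(1 + Complex.I) / 2, (1 - Complex.I) / 2; (1 - Complex.I) / 2, (1 + Complex.I) / 2]

theorem sqrtX_mul_self : sqrtX * sqrtX = pauliX := by
  have h := Complex.I_mul_I
  ext i j
  fin_cases i <;> fin_cases j <;> simp [sqrtX, pauliX, Matrix.mul_apply] <;> grind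

theorem sqrtX_mem : sqrtX ∈ Matrix.unitaryGroup (Fin 2) ℂ := by
  have h := Complex.I_mul_I
  rw [Matrix.mem_unitaryGroup_iff]
  ext i j
  fin_cases i <;> fin_cases j <;> simp [sqrtX, Matrix.mul_apply, Matrix.star_apply, map_ofNat] <;> grind

/-- The permutation of the basis states which adds `f` to the bit `t`. -/
def addBit (t : ι) (f : (ι → Fin 2) → Fin 2) (y : ι → Fin 2) : ι → Fin 2 :=
  update y t (y t + f y)

theorem mux_pauliX (t : ι) (f : (ι → Fin 2) → Fin 2) (hf : ∀ x e, f (update x t e) = f x) :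
    mux t (fun x => if f x = 1 then pauliX else 1) = permOp (addBit t f) := by
  ext x y
  rw [mux, permOp, addBit]
  simp only [eq_update_iff]
  by_cases h : ∀ k, k ≠ t → x k = y k
  · have e : y = update x t (y t) := eq_update_iff.2 ⟨rfl, fun k hk => (h k hk).symm⟩
    have e' : f y = f x := by rw [e, hf]
    simp only [e']
    generalize x t = a, y t = b, f x = c
    fin_cases a <;> fin_cases b <;> fin_cases c <;> simp [pauliX]
  · rw [if_neg h, if_neg fun h' => h h'.2]

theorem addBit_involutive (t : ι) (f : (ι → Fin 2) → Fin 2)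
    (hf : ∀ x e, f (update x t e) = f x) : Involutive (addBit t f) := by
  intro y
  have h2 : ∀ a b : Fin 2, a + b + b = a := by decide
  simp [addBit, hf, h2]

/-- The controlled NOT gate. -/
def cnot (c t : ι) (hct : c ≠ t) : Gate ι := ctrlGate c t hct pauliX_mem

theorem cnot_toOp (c t : ι) (hct : c ≠ t) :
    (cnot c t hct).toOp = permOp (addBit t fun y => y c) := by
  rw [cnot, ctrlGate_toOp]
  exact mux_pauliX t (fun x => x c) fun x e => update_of_ne hct _ _

/-- Conjugation by the CNOT from `a` to `b` makes the multiplexer read the sum of both bits in place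
of `b`. This yields the middle factor of the Toffoli gate. -/
theorem cnot_conj_mux (a b t : ι) (hab : a ≠ b) (hat : a ≠ t) (hbt : b ≠ t)
    (M : (ι → Fin 2) → Matrix (Fin 2) (Fin 2) ℂ) :
    permOp (addBit b fun y => y a) * mux t M * permOp (addBit b fun y => y a)
      = mux t fun x => M (addBit b (fun y => y a) x) := by
  ext x y
  have hi : Involutive (addBit b fun y : ι → Fin 2 => y a) :=
    addBit_involutive b _ fun x e => update_of_ne hab _ _
  rw [mul_permOp_apply, permOp_mul_apply hi, mux, mux]
  have ht : ∀ z : ι → Fin 2, addBit b (fun y => y a) z t = z t := fun z =>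
    update_of_ne hbt.symm _ _
  have hagree : ∀ x y : ι → Fin 2, (∀ k, k ≠ t → x k = y k) → ∀ k, k ≠ t →
      addBit b (fun y => y a) x k = addBit b (fun y => y a) y k := by
    intro x y h k hk
    by_cases hkb : k = b
    · subst hkb
      simp [addBit, h _ hk, h _ hat]
    · simp [addBit, hkb, h _ hk]
  rw [ht, ht]
  refine if_congr ⟨fun h => ?_, hagree x y⟩ rfl rfl
  simpa only [hi _] using hagree _ _ h

/-- The Toffoli gate with controls `a`, `b` and target `t`. -/
def toffoli (a b t : ι) (hab : a ≠ b) (hat : a ≠ t) (hbt : b ≠ t) : Circuit ι :=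
  [ctrlGate a t hat sqrtX_mem, cnot a b hab, ctrlGate b t hbt (Unitary.star_mem sqrtX_mem), cnot a b hab,
    ctrlGate b t hbt sqrtX_mem]

/-- With V the square root of X and controls p, q, the target undergoes V^p V^(-(p xor q)) V^q =
V^(2pq) = X^(pq), because p + q - (p xor q) = 2pq. -/
theorem toffoli_toOp (a b t : ι) (hab : a ≠ b) (hat : a ≠ t) (hbt : b ≠ t) :
    Circuit.toOp (toffoli a b t hab hat hbt) = permOp (addBit t fun y => y a * y b) := by
  simp only [toffoli, Circuit.toOp, ctrlGate_toOp, cnot_toOp, Matrix.one_mul]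
  rw [Matrix.mul_assoc (_ * _) (mux _ _), Matrix.mul_assoc (mux _ _), ← Matrix.mul_assoc (permOp _),
    cnot_conj_mux a b t hab hat hbt, mux_mul, mux_mul, ← mux_pauliX]
  · congr 1
    funext x
    have h1 := Matrix.mem_unitaryGroup_iff.1 sqrtX_mem
    have h2 := Matrix.mem_unitaryGroup_iff'.1 sqrtX_mem
    simp only [addBit, update_self]
    generalize x a = p, x b = q
    fin_cases p <;> fin_cases q <;> simp [h1, h2, sqrtX_mul_self]
  · intro x e
    simp [hat, hbt]
  · intro x e
    simp [hat]
  · intro x e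
    simp [addBit, update_of_ne, hat, hbt]

/-- The circuit that adds the NAND of the bits `a` and `b` to the bit `t`. -/
theorem exists_nand_circuit (a b t : ι) (hat : a ≠ t) (hbt : b ≠ t) :
    ∃ c : Circuit ι, c.length ≤ 6 ∧ ∀ y, Maps c y (update y t (y t + (1 + y a * y b))) := by
  have hX : Circuit.toOp [Gate.one t ⟨pauliX, pauliX_mem⟩] = permOp (addBit t fun _ => 1) := by
    rw [← mux_pauliX t _ fun _ _ => rfl]
    simp [Circuit.toOp, Gate.toOp_one]
  have comb : ∀ (c : Circuit ι) (f : (ι → Fin 2) → Fin 2), (∀ x e, f (update x t e) = f x) →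
      Circuit.toOp c = permOp (addBit t f) → ∀ y,
      Maps (c ++ [Gate.one t ⟨pauliX, pauliX_mem⟩]) y (update y t (y t + (1 + f y))) := by
    intro c f hf hc y
    convert (Maps.of_eq_permOp hc y).append (Maps.of_eq_permOp hX _) using 1
    simp [addBit, add_assoc, add_comm (f y)]
  -- A program step may use one bit twice, and the Toffoli gate needs distinct controls. In that
  -- case the product is the bit itself and a CNOT suffices.
  by_cases hab : a = b
  · subst hab
    refine ⟨[cnot a t hat] ++ [Gate.one t ⟨pauliX, pauliX_mem⟩], by simp, fun y => ?_⟩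
    · convert comb [cnot a t hat] (fun y => y a) (fun x e => update_of_ne hat _ _) ?_ y using 4
      · generalize y a = p
        fin_cases p <;> rfl
      · rw [Circuit.toOp, Circuit.toOp, Matrix.one_mul, cnot_toOp]
  · refine ⟨_, ?_, comb (toffoli a b t hab hat hbt) (fun y => y a * y b) ?_
      (toffoli_toOp a b t hab hat hbt)⟩
    · simp [toffoli]
    · intro x e
      simp [hat, hbt]

/-- Bitwise addition of source bits to distinct target bits. -/
theorem exists_xor_circuit {β : Type} (S : Finset β) (src tgt : β → ι) (ht : Injective tgt)
    (hst : ∀ i j, src i ≠ tgt j) :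
    ∃ c : Circuit ι, c.length ≤ S.card ∧ ∀ y y', (∀ i ∈ S, y' (tgt i) = y (tgt i) + y (src i)) →
      (∀ z, (∀ i ∈ S, z ≠ tgt i) → y' z = y z) → Maps c y y' := by
  classical
  induction S using Finset.induction_on with
  | empty =>
    refine ⟨[], by simp, fun y y' _ h => ?_⟩
    rw [show y' = y from funext fun z => h z (by simp)]
    exact Maps.nil y
  | insert j S hj ih =>
    obtain ⟨c, hc, h⟩ := ih
    refine ⟨c ++ [cnot (src j) (tgt j) (hst j j)], ?_, fun y y' h1 h2 => ?_⟩
    · simpa [Finset.card_insert_of_notMem hj] using hc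
    -- The intermediate state is `y'` with the last target still holding its old content.
    · have h3 := h y (update y' (tgt j) (y (tgt j))) (fun i hi => ?_) (fun z hz => ?_)
      · refine h3.append ?_
        convert Maps.of_eq_permOp (c := [cnot (src j) (tgt j) (hst j j)]) (by
          rw [Circuit.toOp, Circuit.toOp, Matrix.one_mul, cnot_toOp]) _ using 1
        simp only [addBit, update_self, update_of_ne (hst j j), update_idem]
        rw [eq_comm, update_eq_self_iff, h1 j (Finset.mem_insert_self j S),
          h2 (src j) fun i _ => hst j i]
      · have hij : i ≠ j := fun e => hj (e ▸ hi)
        rw [update_of_ne (ht.ne hij), h1 i (Finset.mem_insert_of_mem hi)]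
      · by_cases hzj : z = tgt j
        · subst hzj
          simp
        · rw [update_of_ne hzj, h2 z]
          intro i hi
          rcases Finset.mem_insert.1 hi with rfl | hi
          · exact hzj
          · exact hz i hi

end Circuits

/-! ### Implementation with clean work qubits -/

section Impl

variable {Ω κ : Type} [Fintype Ω] [DecidableEq Ω] [Fintype κ] [DecidableEq κ]

/-- `U` is unitary and is implemented by a circuit with at most `n` gates, whose work qubits are
labelled by `Ω`. -/
def Impl (Ω : Type) {κ : Type} [Fintype Ω] [DecidableEq Ω] [Fintype κ] [DecidableEq κ] (n : ℕ)
    (U : QubitOp κ) : Prop :=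
  U ∈ Matrix.unitaryGroup (κ → Fin 2) ℂ ∧ ∃ c : Circuit (Ω ⊕ κ), c.length ≤ n ∧
    ∀ (a : Ω → Fin 2) (x y : κ → Fin 2),
      Circuit.toOp c (Sum.elim a x) (Sum.elim 0 y) = if a = 0 then U x y else 0

theorem Impl.mono {n m : ℕ} {U : QubitOp κ} (h : Impl Ω n U) (hnm : n ≤ m) : Impl Ω m U := by
  obtain ⟨hU, c, hc, h⟩ := h
  exact ⟨hU, c, hc.trans hnm, h⟩

theorem sumElim_eq_iff {a a' : Ω → Fin 2} {x x' : κ → Fin 2} :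
    Sum.elim a x = Sum.elim a' x' ↔ a = a' ∧ x = x' := by
  refine ⟨fun h => ⟨funext fun i => ?_, funext fun i => ?_⟩, fun h => by rw [h.1, h.2]⟩
  · exact congrFun h (Sum.inl i)
  · exact congrFun h (Sum.inr i)

theorem Impl.one : Impl Ω 0 (1 : QubitOp κ) := by
  refine ⟨one_mem _, [], by simp, fun a x y => ?_⟩
  rw [Circuit.toOp, Matrix.one_apply, Matrix.one_apply]
  simp only [sumElim_eq_iff, ite_and]

/-- The first circuit returns the work qubits to zero, so only intermediate states with clean work
qubits contribute, and all factors can share them. -/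
theorem Impl.mul {n m : ℕ} {U V : QubitOp κ} (hU : Impl Ω n U) (hV : Impl Ω m V) :
    Impl Ω (n + m) (U * V) := by
  obtain ⟨hU, c, hc, h⟩ := hU
  obtain ⟨hV, c', hc', h'⟩ := hV
  refine ⟨mul_mem hU hV, c' ++ c, by rw [List.length_append]; omega, fun a x y => ?_⟩
  rw [Circuit.toOp_append, Matrix.mul_apply,
    ← (Equiv.sumArrowEquivProdArrow Ω κ (Fin 2)).symm.sum_comp, Fintype.sum_prod_type]
  rw [Finset.sum_eq_single (0 : Ω → Fin 2)]
  · simp only [Equiv.sumArrowEquivProdArrow, Equiv.coe_fn_symm_mk, h, h', if_true]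
    split_ifs
    · rw [Matrix.mul_apply]
    · simp
  · intro b _ hb
    refine Finset.sum_eq_zero fun z _ => ?_
    simp only [Equiv.sumArrowEquivProdArrow, Equiv.coe_fn_symm_mk, h', if_neg hb, mul_zero]
  · simp

theorem Impl.list_prod {n : ℕ} (l : List (QubitOp κ)) (h : ∀ U ∈ l, Impl Ω n U) :
    Impl Ω (l.length * n) l.prod := by
  induction l with
  | nil => simpa using Impl.one
  | cons U l ih =>
    rw [List.prod_cons]
    refine ((h U (by simp)).mul (ih fun V hV => h V (by simp [hV]))).mono ?_
    rw [List.length_cons, Nat.succ_mul, Nat.add_comm]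

/-- The gate targets a main qubit and its matrix does not depend on the work qubits, so these stay
zero. -/
theorem Impl.of_gate (t : κ) (M : (κ → Fin 2) → Matrix (Fin 2) (Fin 2) ℂ)
    (M' : (Ω ⊕ κ → Fin 2) → Matrix (Fin 2) (Fin 2) ℂ) (g : Gate (Ω ⊕ κ))
    (hg : g.toOp = mux (Sum.inr t) M') (hM' : ∀ a x, M' (Sum.elim a x) = M x)
    (hM : ∀ x e, M (update x t e) = M x) (hu : ∀ x, M x ∈ Matrix.unitaryGroup (Fin 2) ℂ) :
    Impl Ω 1 (mux t M) := by
  refine ⟨mux_mem_unitaryGroup t M hM hu, [g], le_rfl, fun a x y => ?_⟩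
  rw [Circuit.toOp, Circuit.toOp, Matrix.one_mul, hg, mux, hM', mux, ← ite_and]
  refine if_congr ⟨fun h => ⟨funext fun k => ?_, fun k hk => ?_⟩, ?_⟩ rfl rfl
  · exact h (Sum.inl k) (by simp)
  · exact h (Sum.inr k) (by simpa using hk)
  · rintro ⟨rfl, h⟩ (k | k) hk
    · rfl
    · exact h k (by simpa using hk)

theorem Impl.mux_const (t : κ) {G : Matrix (Fin 2) (Fin 2) ℂ}
    (hG : G ∈ Matrix.unitaryGroup (Fin 2) ℂ) : Impl Ω 1 (mux t fun _ => G) :=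
  Impl.of_gate t _ (fun _ => G) (Gate.one (Sum.inr t) ⟨G, hG⟩) (Gate.toOp_one _ _)
    (fun _ _ => rfl) (fun _ _ => rfl) fun _ => hG

theorem Impl.mux_ctrl (c t : κ) (hct : c ≠ t) {G : Matrix (Fin 2) (Fin 2) ℂ}
    (hG : G ∈ Matrix.unitaryGroup (Fin 2) ℂ) :
    Impl Ω 1 (mux t fun x => if x c = 1 then G else 1) := by
  refine Impl.of_gate t _ (fun x => if x (Sum.inr c) = 1 then G else 1)
    (ctrlGate (Sum.inr c) (Sum.inr t) (by simpa using hct) hG) (ctrlGate_toOp _ _ _ _)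
    (fun _ _ => rfl) (fun x e => by rw [update_of_ne hct]) fun x => ?_
  split_ifs
  · exact hG
  · exact one_mem _

/-- The operator applied when the parity of some control bits is odd. -/
theorem Impl.mux_sum (t : κ) (C : Finset κ) (htC : t ∉ C) {G : Matrix (Fin 2) (Fin 2) ℂ}
    (hG : G ∈ Matrix.unitaryGroup (Fin 2) ℂ) (hGG : G * G = 1) :
    Impl Ω C.card (mux t fun x => if ∑ c ∈ C, x c = 1 then G else 1) := by
  induction C using Finset.induction_on with
  | empty => simpa [mux_one] using Impl.one
  | insert j C hj ih =>
    have htj : j ≠ t := fun e => htC (by simp [e])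
    have htC' : t ∉ C := fun h => htC (by simp [h])
    rw [Finset.card_insert_of_notMem hj]
    convert (ih htC').mul (Impl.mux_ctrl (Ω := Ω) j t htj hG) using 1
    rw [mux_mul _ _ _ fun x e => by rw [update_of_ne htj]]
    congr 1
    funext x
    rw [Finset.sum_insert hj]
    generalize x j = p, ∑ c ∈ C, x c = q
    -- Two activations cancel because `G * G = 1`, so only the parity of the controls matters.
    fin_cases p <;> fin_cases q <;> simp [hGG]

/-- The tensor product of one-qubit operators on the qubits in `T`, which may depend on the
other qubits. -/
def muxAll (T : Finset κ) (M : κ → (κ → Fin 2) → Matrix (Fin 2) (Fin 2) ℂ) : QubitOp κ :=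
  fun x y => if ∀ k, k ∉ T → x k = y k then ∏ k ∈ T, M k x (x k) (y k) else 0

/-- No factor is controlled by a qubit of `T`, so applying the factors one after another leaves all
their matrices as they were, and the product is a tensor product. -/
theorem Impl.muxAll {n : ℕ} (T : Finset κ) (M : κ → (κ → Fin 2) → Matrix (Fin 2) (Fin 2) ℂ)
    (h : ∀ k ∈ T, Impl Ω n (mux k (M k)))
    (hM : ∀ k ∈ T, ∀ j ∈ T, ∀ x e, M k (update x j e) = M k x) :
    Impl Ω (T.card * n) (muxAll T M) := by
  induction T using Finset.induction_on with
  | empty =>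
    convert Impl.one (Ω := Ω) (κ := κ) using 1
    · simp
    · ext x y
      simp [BPX.muxAll, Matrix.one_apply, funext_iff]
  | insert t T ht ih =>
    rw [Finset.card_insert_of_notMem ht]
    convert (h t (by simp)).mul (ih (fun k hk => h k (by simp [hk]))
      fun k hk j hj => hM k (by simp [hk]) j (by simp [hj])) using 1
    · ring
    · ext x y
      rw [mux_mul_apply]
      simp only [BPX.muxAll]
      by_cases hxy : ∀ k, k ∉ insert t T → x k = y k
      · rw [if_pos hxy, Finset.prod_insert ht, Finset.sum_eq_single (y t)]
        · rw [if_pos]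
          · congr 1
            refine Finset.prod_congr rfl fun k hk => ?_
            have hkt : k ≠ t := fun e => ht (e ▸ hk)
            rw [hM k (by simp [hk]) t (by simp), update_of_ne hkt]
          · intro k hk
            by_cases hkt : k = t
            · subst hkt
              simp
            · rw [update_of_ne hkt]
              exact hxy k (by simp [hk, hkt])
        · intro e _ he
          rw [if_neg, mul_zero]
          intro h'
          exact he (by simpa using h' t ht)
        · simp
      · rw [if_neg hxy, eq_comm]
        refine Finset.sum_eq_zero fun e _ => ?_
        rw [if_neg, mul_zero]
        intro h'
        refine hxy fun k hk => ?_
        rw [Finset.mem_insert, not_or] at hk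
        simpa [hk.1] using h' k hk.2

end Impl

/-! ## Straight-line programs -/

section SLP

/-- Boolean functions of the bits labelled by `κ`. -/
abbrev BoolFun (κ : Type) : Type := (κ → Fin 2) → Fin 2

variable {κ : Type}

/-- A function that is an input bit or is listed in `ws`. -/
def Avail (ws : List (BoolFun κ)) (f : BoolFun κ) : Prop := f ∈ ws ∨ ∃ i, f = fun x => x i

/-- Lists of functions (latest first), each of which is the NAND of two functions that are input
bits or occur before. -/
inductive SLP : List (BoolFun κ) → Prop
  | nil : SLP []
  | nand {ws : List (BoolFun κ)} {f g : BoolFun κ} (h : SLP ws) (hf : Avail ws f)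
      (hg : Avail ws g) : SLP ((fun x => 1 + f x * g x) :: ws)

/-- Every straight-line program that computes the functions in `S` can be extended by at most `n`
steps so as to compute those in `T`. -/
def Reach (n : ℕ) (S T : Set (BoolFun κ)) : Prop :=
  ∀ ws, SLP ws → (∀ f ∈ S, Avail ws f) → ∃ ws', SLP ws' ∧ ws'.length ≤ ws.length + n ∧
    (∀ f, Avail ws f → Avail ws' f) ∧ ∀ f ∈ T, Avail ws' f

variable {n m : ℕ} {S S' T R : Set (BoolFun κ)} {f g h : BoolFun κ}

theorem Reach.of_subset (hTS : T ⊆ S) : Reach 0 S T := fun ws hws hS =>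
  ⟨ws, hws, le_rfl, fun _ h => h, fun f hf => hS f (hTS hf)⟩

theorem Reach.input (i : κ) : Reach 0 S {fun x => x i} := fun ws hws _ =>
  ⟨ws, hws, le_rfl, fun _ h => h, fun _ hf => Or.inr ⟨i, hf⟩⟩

theorem Reach.mono (H : Reach n S T) (hnm : n ≤ m) : Reach m S T := fun ws hws hS => by
  obtain ⟨ws', h1, h2, h3⟩ := H ws hws hS
  exact ⟨ws', h1, by omega, h3⟩

theorem Reach.mono_left (H : Reach n S T) (hS : S ⊆ S') : Reach n S' T := fun ws hws hS' =>
  H ws hws fun f hf => hS' f (hS hf)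

theorem Reach.mono_right (H : Reach n S T) (hR : R ⊆ T) : Reach n S R := fun ws hws hS => by
  obtain ⟨ws', h1, h2, h3, h4⟩ := H ws hws hS
  exact ⟨ws', h1, h2, h3, fun f hf => h4 f (hR hf)⟩

/-- Programs are extended, never recomputed: earlier results stay available, so costs add even when
a value is used repeatedly. -/
theorem Reach.trans (H : Reach n S T) (H' : Reach m (S ∪ T) R) : Reach (n + m) S (T ∪ R) := by
  intro ws hws hS
  obtain ⟨ws', h1, h2, h3, h4⟩ := H ws hws hS
  obtain ⟨ws'', h5, h6, h7, h8⟩ := H' ws' h1 fun f hf => hf.elim (fun hf => h3 f (hS f hf)) (h4 f)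
  exact ⟨ws'', h5, by omega, fun f hf => h7 f (h3 f hf),
    fun f hf => hf.elim (fun hf => h7 f (h4 f hf)) (h8 f)⟩

theorem Reach.seq (H : Reach n S T) (H' : Reach m (S ∪ T) R) : Reach (n + m) S R :=
  (H.trans H').mono_right Set.subset_union_right

theorem Reach.union (H : Reach n S T) (H' : Reach m S R) : Reach (n + m) S (T ∪ R) :=
  H.trans (H'.mono_left Set.subset_union_left)

theorem Reach.nand (H : Reach n S {f}) (H' : Reach m S {g}) :
    Reach (n + m + 1) S {fun x => 1 + f x * g x} := by
  refine (H.union H').seq fun ws hws hS => ⟨_, SLP.nand hws (hS f (by simp)) (hS g (by simp)),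
    by simp, fun _ h => ?_, fun _ h => Or.inl ?_⟩
  · exact h.imp (List.mem_cons_of_mem _) id
  · rw [Set.mem_singleton_iff.1 h]
    exact List.mem_cons_self

theorem Reach.congr (H : Reach n S {f}) (hfg : ∀ x, f x = g x) : Reach n S {g} :=
  (funext hfg : f = g) ▸ H

theorem Reach.not (H : Reach n S {f}) : Reach (n + 1) S {fun x => 1 + f x} :=
  H.seq <| ((Reach.of_subset (by simp)).nand (f := f) (g := f) (Reach.of_subset (by simp))).congr
    fun x => by
      generalize f x = a
      revert a
      decide

theorem Reach.mul (H : Reach n S {f}) (H' : Reach m S {g}) :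
    Reach (n + m + 2) S {fun x => f x * g x} :=
  (H.nand H').not.congr fun x => by
    generalize f x = a, g x = b
    revert a b
    decide

/-- Exclusive or takes four NANDs: with h = NAND(f, g) it equals NAND(NAND(f, h), NAND(g, h)). -/
theorem Reach.add (H : Reach n S {f}) (H' : Reach m S {g}) :
    Reach (n + m + 4) S {fun x => f x + g x} := by
  refine (((H.union H').seq (m := 4) ?_).mono (by omega))
  have hf : Reach 0 (S ∪ ({f} ∪ {g})) {f} := Reach.of_subset (by simp)
  have hg : Reach 0 (S ∪ ({f} ∪ {g})) {g} := Reach.of_subset (by simp)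
  refine (hf.nand hg).seq (m := 3) ?_
  have hf' := hf.mono_left (S' := S ∪ ({f} ∪ {g}) ∪ {fun x => 1 + f x * g x})
    Set.subset_union_left
  have hg' := hg.mono_left (S' := S ∪ ({f} ∪ {g}) ∪ {fun x => 1 + f x * g x})
    Set.subset_union_left
  have hh : Reach 0 (S ∪ ({f} ∪ {g}) ∪ {fun x => 1 + f x * g x}) {fun x => 1 + f x * g x} :=
    Reach.of_subset (by simp)
  refine ((hf'.nand hh).nand (hg'.nand hh)).congr fun x => ?_
  generalize f x = a, g x = b
  revert a b
  decide

/-- The NAND of a bit and its negation is 1; hence the need for at least one input. -/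
theorem Reach.const [Nonempty κ] (c : Fin 2) : Reach 3 S {fun _ => c} := by
  obtain ⟨i⟩ := ‹Nonempty κ›
  have h1 : Reach 2 S {fun _ => (1 : Fin 2)} :=
    ((Reach.input i).nand (Reach.input i).not).congr fun x => by
      generalize x i = a
      revert a
      decide
  fin_cases c
  · exact h1.not
  · exact h1.mono (by norm_num)

theorem Reach.biUnion {β : Type*} (A : Finset β) (F : β → Set (BoolFun κ))
    (H : ∀ i ∈ A, Reach n S (F i)) : Reach (A.card * n) S {f | ∃ i ∈ A, f ∈ F i} := by
  classical
  induction A using Finset.induction_on with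
  | empty => simpa using Reach.of_subset (S := S) (Set.empty_subset S)
  | insert j A hj ih =>
    rw [Finset.card_insert_of_notMem hj]
    refine (((H j (by simp)).union (ih fun i hi => H i (by simp [hi]))).mono
      (by rw [Nat.succ_mul, Nat.add_comm])).mono_right ?_
    rintro f ⟨i, hi, hf⟩
    rcases Finset.mem_insert.1 hi with rfl | hi
    · exact Or.inl hf
    · exact Or.inr ⟨i, hi, hf⟩

theorem Reach.prod [Nonempty κ] {β : Type*} (A : Finset β) (F : β → BoolFun κ)
    (H : ∀ i ∈ A, Reach n S {F i}) : Reach (A.card * (n + 2) + 3) S {fun x => ∏ i ∈ A, F i x} := by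
  classical
  induction A using Finset.induction_on with
  | empty => simpa using Reach.const 1
  | insert j A hj ih =>
    rw [Finset.card_insert_of_notMem hj]
    refine (((H j (by simp)).mul (ih fun i hi => H i (by simp [hi]))).mono (by lia)).congr
      fun x => ?_
    rw [Finset.prod_insert hj]

theorem Reach.sum [Nonempty κ] {β : Type*} (A : Finset β) (F : β → BoolFun κ)
    (H : ∀ i ∈ A, Reach n S {F i}) : Reach (A.card * (n + 4) + 3) S {fun x => ∑ i ∈ A, F i x} := by
  classical
  induction A using Finset.induction_on with
  | empty => simpa using Reach.const 0
  | insert j A hj ih =>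
    rw [Finset.card_insert_of_notMem hj]
    refine (((H j (by simp)).add (ih fun i hi => H i (by simp [hi]))).mono (by lia)).congr
      fun x => ?_
    rw [Finset.sum_insert hj]

end SLP

/-! ## Reversible evaluation -/

section Compile

variable {κ : Type} [Fintype κ] [DecidableEq κ]

/-- The basis state with given contents of the work qubits, of the copy register and of the main
register. -/
def tri {w : ℕ} (a : Fin w → Fin 2) (v x : κ → Fin 2) : (Fin w ⊕ κ) ⊕ κ → Fin 2 :=
  Sum.elim (Sum.elim a v) x

/-- The position of a work qubit or of a qubit of the main register. -/
def triPos {w : ℕ} : Fin w ⊕ κ → (Fin w ⊕ κ) ⊕ κ :=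
  Sum.elim (fun i => Sum.inl (Sum.inl i)) Sum.inr

theorem tri_triPos {w : ℕ} (a : Fin w → Fin 2) (v x : κ → Fin 2) (p : Fin w ⊕ κ) :
    tri a v x (triPos p) = Sum.elim a x p := by
  cases p <;> rfl

/-- Each step adds its NAND to a fresh work qubit whose number is the position of the step. The
circuit `c'` repeats the gates in reverse order of steps, since adding the same bit twice cancels.
The bound on the positions of available functions keeps operands apart from the next target. -/
theorem SLP.exists_circuit {ws : List (BoolFun κ)} (hws : SLP ws) {w : ℕ} (hw : ws.length ≤ w) :
    ∃ (c c' : Circuit ((Fin w ⊕ κ) ⊕ κ)) (A : (κ → Fin 2) → Fin w → Fin 2),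
      c.length ≤ 6 * ws.length ∧ c'.length ≤ 6 * ws.length ∧
      (∀ v x, Maps c (tri 0 v x) (tri (A x) v x)) ∧
      (∀ v x, Maps c' (tri (A x) v x) (tri 0 v x)) ∧
      (∀ (x : κ → Fin 2) (i : Fin w), ws.length ≤ (i : ℕ) → A x i = 0) ∧
      ∀ f, Avail ws f → ∃ p : Fin w ⊕ κ, (∀ x, f x = Sum.elim (A x) x p) ∧
        ∀ i : Fin w, p = Sum.inl i → (i : ℕ) < ws.length := by
  induction hws with
  | nil =>
    refine ⟨[], [], fun _ => 0, by simp, by simp, fun v x => Maps.nil _, fun v x => Maps.nil _,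
      fun _ _ _ => rfl, fun f hf => ?_⟩
    rcases hf with hf | ⟨i, rfl⟩
    · simp at hf
    · exact ⟨Sum.inr i, fun x => rfl, by simp⟩
  | @nand ws f g _ hf hg ih =>
    rw [List.length_cons] at hw
    obtain ⟨c, c', A, hc, hc', h, h', hA, hp⟩ := ih (by omega)
    obtain ⟨p, hfp, hp1⟩ := hp f hf
    obtain ⟨q, hgq, hq1⟩ := hp g hg
    obtain ⟨t, ht⟩ : ∃ t : Fin w, (t : ℕ) = ws.length := ⟨⟨ws.length, hw⟩, rfl⟩
    have hne : ∀ p : Fin w ⊕ κ, (∀ i : Fin w, p = Sum.inl i → (i : ℕ) < ws.length) →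
        triPos p ≠ (Sum.inl (Sum.inl t) : (Fin w ⊕ κ) ⊕ κ) := by
      rintro (i | i) hi he
      · have := hi i rfl
        simp only [triPos, Sum.elim_inl, Sum.inl.injEq] at he
        rw [he, ht] at this
        exact lt_irrefl _ this
      · simp [triPos] at he
    obtain ⟨c₀, hc₀, hm⟩ := exists_nand_circuit (triPos p) (triPos q) (Sum.inl (Sum.inl t))
      (hne p hp1) (hne q hq1)
    let A' : (κ → Fin 2) → Fin w → Fin 2 := fun x => update (A x) t (1 + f x * g x)
    have hAt : ∀ x, A x t = 0 := fun x => hA x t ht.ge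
    have hupd : ∀ (b : Fin w → Fin 2) (v x : κ → Fin 2) (e : Fin 2),
        update (tri b v x) (Sum.inl (Sum.inl t)) e = tri (update b t e) v x := by
      intro b v x e
      rw [tri, Sum.update_elim_inl, Sum.update_elim_inl, tri]
    -- Writing the fresh qubit does not disturb the operands, so the same NAND circuit also undoes
    -- the step.
    have key : ∀ (x : κ → Fin 2) (p : Fin w ⊕ κ), (∀ i : Fin w, p = Sum.inl i → (i : ℕ) < ws.length) →
        Sum.elim (A' x) x p = Sum.elim (A x) x p := by
      rintro x (i | i) hi
      · have hit : i ≠ t := fun e => by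
          have := hi i rfl
          rw [e, ht] at this
          exact lt_irrefl _ this
        simp [A', update_of_ne hit]
      · rfl
    refine ⟨c ++ c₀, c₀ ++ c', A', ?_, ?_, fun v x => (h v x).append ?_,
      fun v x => Maps.append ?_ (h' v x), fun x i hi => ?_, ?_⟩
    · rw [List.length_append, List.length_cons]; omega
    · rw [List.length_append, List.length_cons]; omega
    · convert hm _ using 1
      rw [tri_triPos, tri_triPos, ← hfp, ← hgq, hupd]
      simp only [tri, hAt, A', Sum.elim_inl, zero_add]
    · convert hm _ using 1
      rw [tri_triPos, tri_triPos, key x p hp1, key x q hq1, ← hfp, ← hgq, hupd]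
      have h2 : ∀ a : Fin 2, a + a = 0 := by decide
      simp only [tri, A', h2, Sum.elim_inl, update_self, update_idem]
      rw [eq_comm, ← hAt x, update_eq_self]
    · rw [List.length_cons] at hi
      have hit : i ≠ t := fun e => by
        rw [e, ht] at hi
        exact absurd hi (Nat.not_succ_le_self _)
      simp only [A', update_of_ne hit]
      exact hA x i (by omega)
    · rintro f' (hf' | ⟨i, rfl⟩)
      · rcases List.mem_cons.1 hf' with rfl | hf'
        · refine ⟨Sum.inl t, fun x => by simp [A'], fun i hi => ?_⟩
          rw [← Sum.inl_injective hi, ht]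
          simp
        · obtain ⟨r, hr, hr1⟩ := hp f' (Or.inl hf')
          refine ⟨r, fun x => by rw [hr, key x r hr1], fun i hi => ?_⟩
          have := hr1 i hi
          rw [List.length_cons]
          omega
      · exact ⟨Sum.inr i, fun x => rfl, by simp⟩

/-- An involution of the basis states is implemented by a circuit whose size is linear in the
number of steps that compute the involution. -/
theorem Impl.permOp_of_reach {σ : (κ → Fin 2) → κ → Fin 2} (hσ : Involutive σ) {n w : ℕ}
    (h : Reach n ∅ {f | ∃ i, f = fun x => σ x i}) (hw : n ≤ w) :
    Impl (Fin w ⊕ κ) (24 * n + 5 * Fintype.card κ) (permOp σ) := by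
  obtain ⟨ws, hws, hlen, -, hout⟩ := h [] SLP.nil (by simp)
  rw [List.length_nil, Nat.zero_add] at hlen
  obtain ⟨c, c', A, hc, hc', hA, hA', -, hp⟩ := hws.exists_circuit (w := w) (hlen.trans hw)
  choose p hp _ using fun i => hp _ (hout _ ⟨i, rfl⟩)
  have hne : ∀ i j, triPos (p i) ≠ (Sum.inl (Sum.inr j) : (Fin w ⊕ κ) ⊕ κ) := fun i j => by
    rcases p i with k | k <;> simp [triPos]
  obtain ⟨cc, hcc, hcopy⟩ := exists_xor_circuit Finset.univ (fun i => triPos (p i))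
    (fun j => (Sum.inl (Sum.inr j) : (Fin w ⊕ κ) ⊕ κ)) (fun i j hij => by simpa using hij) hne
  obtain ⟨c1, hc1, hx1⟩ := exists_xor_circuit Finset.univ
    (fun i => (Sum.inl (Sum.inr i) : (Fin w ⊕ κ) ⊕ κ)) (fun j => Sum.inr j)
    (fun i j hij => by simpa using hij) (by simp)
  obtain ⟨c2, hc2, hx2⟩ := exists_xor_circuit Finset.univ
    (fun i => (Sum.inr i : (Fin w ⊕ κ) ⊕ κ)) (fun j => Sum.inl (Sum.inr j))
    (fun i j hij => by simpa using hij) (by simp)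
  have hcopy' : ∀ a v x, (∀ i, σ x i = Sum.elim a x (p i)) →
      Maps cc (tri a v x) (tri a (v + σ x) x) := by
    intro a v x ha
    refine hcopy _ _ (fun i _ => ?_) ?_
    · rw [tri_triPos, ← ha]
      rfl
    · rintro ((i | i) | i) hi
      · rfl
      · exact absurd rfl (hi i (Finset.mem_univ i))
      · rfl
  have hx1' : ∀ a v x, Maps c1 (tri a v x) (tri a v (x + v)) := by
    intro a v x
    refine hx1 _ _ (fun i _ => rfl) ?_
    rintro ((i | i) | i) hi
    · rfl
    · rfl
    · exact absurd rfl (hi i (Finset.mem_univ i))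
  have hx2' : ∀ a v x, Maps c2 (tri a v x) (tri a (v + x) x) := by
    intro a v x
    refine hx2 _ _ (fun i _ => rfl) ?_
    rintro ((i | i) | i) hi
    · rfl
    · exact absurd rfl (hi i (Finset.mem_univ i))
    · rfl
  have h2 : ∀ v x : κ → Fin 2, v + (x + v) = x := fun v x => funext fun i => by
    have : ∀ a b : Fin 2, a + (b + a) = b := by decide
    exact this _ _
  have h3 : ∀ v x : κ → Fin 2, x + v + x = v := fun v x => by rw [add_assoc, h2]
  have h4 : ∀ x : κ → Fin 2, x + x = 0 := fun x => by simpa using h2 x 0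
  -- Compute, copy, uncompute: `σ x` is added to the copy register and the work qubits are clean
  -- again.
  have comp : ∀ v x, Maps (c ++ cc ++ c') (tri 0 v x) (tri 0 (v + σ x) x) := fun v x =>
    ((hA v x).append (hcopy' _ _ _ fun i => hp i x)).append (hA' _ x)
  -- Three bitwise additions exchange the two registers.
  have swap : ∀ v x, Maps (c1 ++ c2 ++ c1) (tri 0 v x : (Fin w ⊕ κ) ⊕ κ → Fin 2) (tri 0 x v) := by
    intro v x
    refine ((hx1' _ _ _).append (hx2' _ _ _)).append ?_
    rw [h2]
    convert hx1' _ _ _ using 2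
    rw [h3]
  -- Two computations of at most 12n + |κ| gates each, and one swap of 3|κ| gates.
  refine ⟨permOp_mem_unitaryGroup hσ, (c ++ cc ++ c') ++ (c1 ++ c2 ++ c1) ++ (c ++ cc ++ c'), ?_,
    fun a x y => ?_⟩
  · simp only [List.length_append]
    rw [Finset.card_univ] at hcc hc1 hc2
    omega
  · have e : (Sum.elim 0 y : (Fin w ⊕ κ) ⊕ κ → Fin 2) = tri 0 0 y := by
      rw [tri, sumElim_eq_iff]
      refine ⟨funext ?_, rfl⟩
      rintro (i | i) <;> rfl
    have e' : (tri 0 0 (σ y) : (Fin w ⊕ κ) ⊕ κ → Fin 2) = Sum.elim (0 : Fin w ⊕ κ → Fin 2) (σ y) := by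
      rw [tri, sumElim_eq_iff]
      refine ⟨funext ?_, rfl⟩
      rintro (i | i) <;> rfl
    -- After the swap the copy register holds `y`. As `σ` is its own inverse, computing again adds
    -- `σ (σ y) = y` and clears it.
    have key := ((comp 0 y).append (swap _ _)).append (comp _ _)
    rw [zero_add, hσ, h4, e'] at key
    rw [e, key]
    simp only [sumElim_eq_iff, permOp, ← ite_and]

end Compile

/-! ## Arithmetic by straight-line programs -/

/-- The binary digit of `n` of weight `2 ^ k`. -/
def bit (n k : ℕ) : Fin 2 := ⟨n / 2 ^ k % 2, Nat.mod_lt _ two_pos⟩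

/-- The carry into position `k` in the addition of `u` and `v`. -/
def carry (u v k : ℕ) : Fin 2 := if 2 ^ k ≤ u % 2 ^ k + v % 2 ^ k then 1 else 0

theorem bit_add (u v k : ℕ) : bit (u + v) k = bit u k + bit v k + carry u v k := by
  apply Fin.ext
  simp only [bit, carry, Nat.add_div (Nat.two_pow_pos k), Fin.val_add]
  split_ifs <;> simp [Nat.add_mod]

/-- The new carry is the majority of the two bits and the old carry, written as a polynomial over
the field with two elements. -/
theorem carry_succ (u v k : ℕ) :
    carry u v (k + 1) = bit u k * bit v k + carry u v k * (bit u k + bit v k) := by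
  have hb : ∀ n, bit n k = if n / 2 ^ k % 2 = 1 then 1 else 0 := fun n => by
    apply Fin.ext
    rcases Nat.mod_two_eq_zero_or_one (n / 2 ^ k) with h | h <;> simp [bit, h]
  simp only [carry, Nat.mod_pow_succ, hb]
  have hu := Nat.mod_lt u (Nat.two_pow_pos k)
  have hv := Nat.mod_lt v (Nat.two_pow_pos k)
  rw [pow_succ]
  generalize u % 2 ^ k = a at *
  generalize v % 2 ^ k = b at *
  generalize 2 ^ k = K at *
  rcases Nat.mod_two_eq_zero_or_one (u / K) with h | h <;>
  rcases Nat.mod_two_eq_zero_or_one (v / K) with h' | h' <;>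
  by_cases hc : K ≤ a + b <;> simp only [h, h', hc, mul_zero, mul_one, if_true, if_false] <;>
  first
    | (rw [if_pos (by omega)]; rfl)
    | (rw [if_neg (by omega)]; rfl)

theorem bit_of_lt {n k : ℕ} (h : n < 2 ^ k) : bit n k = 0 := by
  apply Fin.ext
  simp [bit, Nat.div_eq_of_lt h]

theorem bit_eq_ite_le {n k : ℕ} (h : n < 2 ^ (k + 1)) : bit n k = if 2 ^ k ≤ n then 1 else 0 := by
  apply Fin.ext
  rw [pow_succ] at h
  split_ifs with h1
  · have : n / 2 ^ k = 1 := Nat.div_eq_of_lt_le (by simpa using h1) (by lia)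
    simp [bit, this]
  · have : n / 2 ^ k = 0 := Nat.div_eq_of_lt (by lia)
    simp [bit, this]

theorem bit_mod {n k j : ℕ} (h : k < j) : bit (n % 2 ^ j) k = bit n k := by
  apply Fin.ext
  obtain ⟨i, rfl⟩ := Nat.exists_eq_add_of_lt h
  simp only [bit]
  rw [show k + i + 1 = k + (i + 1) by ring, pow_add, Nat.mod_mul_right_div_self, pow_succ',
    Nat.mod_mul_right_mod]

section Arithmetic

variable {κ : Type} {S : Set (BoolFun κ)}

/-- The `n` lowest binary digits of a number that depends on the input bits. -/
def numBits (n : ℕ) (v : (κ → Fin 2) → ℕ) : Set (BoolFun κ) :=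
  {f | ∃ k < n, f = fun x => bit (v x) k}

theorem Reach.family {n m : ℕ} (F : ℕ → BoolFun κ) (H : ∀ k < n, Reach m S {F k}) :
    Reach (n * m) S {f | ∃ k < n, f = F k} := by
  have := Reach.biUnion (Finset.range n) (fun k => {F k}) fun k hk => H k (Finset.mem_range.1 hk)
  rw [Finset.card_range] at this
  exact this.mono_right fun f ⟨k, hk, hf⟩ => ⟨k, Finset.mem_range.2 hk, hf⟩

/-- Ripple-carry addition: given the previous carry, the next one costs 2 steps for the product of
the bits, 6 for the carry times their sum and 4 for the final addition. -/
theorem Reach.carry [Nonempty κ] {n : ℕ} {u v : (κ → Fin 2) → ℕ} (hu : numBits n u ⊆ S)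
    (hv : numBits n v ⊆ S) :
    Reach (12 * n + 3) S {f | ∃ k ≤ n, f = fun x => BPX.carry (u x) (v x) k} := by
  have main : ∀ m ≤ n,
      Reach (12 * m + 3) S {f | ∃ k ≤ m, f = fun x => BPX.carry (u x) (v x) k} := by
    intro m hm
    induction m with
    | zero =>
      refine ((Reach.const 0).mono_right ?_)
      rintro f ⟨k, hk, rfl⟩
      rw [Nat.le_zero.1 hk]
      simp [BPX.carry, Nat.mod_one]
    | succ m ih =>
      specialize ih (by omega)
      have step : Reach 12 (S ∪ {f | ∃ k ≤ m, f = fun x => BPX.carry (u x) (v x) k})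
          {fun x => BPX.carry (u x) (v x) (m + 1)} := by
        have h1 : Reach 0 (S ∪ {f | ∃ k ≤ m, f = fun x => BPX.carry (u x) (v x) k})
            {fun x => bit (u x) m} :=
          Reach.of_subset (Set.singleton_subset_iff.2 (Or.inl (hu ⟨m, hm, rfl⟩)))
        have h2 : Reach 0 (S ∪ {f | ∃ k ≤ m, f = fun x => BPX.carry (u x) (v x) k})
            {fun x => bit (v x) m} :=
          Reach.of_subset (Set.singleton_subset_iff.2 (Or.inl (hv ⟨m, hm, rfl⟩)))
        have h3 : Reach 0 (S ∪ {f | ∃ k ≤ m, f = fun x => BPX.carry (u x) (v x) k})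
            {fun x => BPX.carry (u x) (v x) m} :=
          Reach.of_subset (Set.singleton_subset_iff.2 (Or.inr ⟨m, le_rfl, rfl⟩))
        exact ((h1.mul h2).add (h3.mul (h1.add h2))).congr fun x => (carry_succ _ _ _).symm
      refine ((ih.trans step).mono (by omega)).mono_right ?_
      rintro f ⟨k, hk, rfl⟩
      rcases Nat.of_le_succ hk with hk | rfl
      · exact Or.inl ⟨k, hk, rfl⟩
      · exact Or.inr rfl
  exact main n le_rfl

theorem Reach.numAdd [Nonempty κ] {n : ℕ} {u v : (κ → Fin 2) → ℕ} (hu : numBits n u ⊆ S)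
    (hv : numBits n v ⊆ S) : Reach (20 * n + 3) S (numBits n fun x => u x + v x) := by
  refine ((Reach.carry hu hv).seq (m := n * 8) (Reach.family _ fun k hk => ?_)).mono (by omega)
  have h1 : Reach 0 (S ∪ {f | ∃ k ≤ n, f = fun x => BPX.carry (u x) (v x) k})
      {fun x => bit (u x) k} :=
    Reach.of_subset (Set.singleton_subset_iff.2 (Or.inl (hu ⟨k, hk, rfl⟩)))
  have h2 : Reach 0 (S ∪ {f | ∃ k ≤ n, f = fun x => BPX.carry (u x) (v x) k})
      {fun x => bit (v x) k} :=
    Reach.of_subset (Set.singleton_subset_iff.2 (Or.inl (hv ⟨k, hk, rfl⟩)))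
  have h3 : Reach 0 (S ∪ {f | ∃ k ≤ n, f = fun x => BPX.carry (u x) (v x) k})
      {fun x => BPX.carry (u x) (v x) k} :=
    Reach.of_subset (Set.singleton_subset_iff.2 (Or.inr ⟨k, hk.le, rfl⟩))
  exact ((h1.add h2).add h3).congr fun x => (bit_add _ _ _).symm

theorem Reach.numConst [Nonempty κ] (n c : ℕ) : Reach (n * 3) S (numBits n fun _ => c) :=
  Reach.family _ fun _ _ => Reach.const _

/-- The bits of `c` are known when the program is written: each output bit is the constant 0 or `g`
itself, so nothing has to be multiplied. -/
theorem Reach.numMulConst [Nonempty κ] (n c : ℕ) {g : BoolFun κ} (hg : g ∈ S) :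
    Reach (n * 3) S (numBits n fun x => (g x : ℕ) * c) := by
  refine Reach.family _ fun k _ => ?_
  rcases (by decide : ∀ a : Fin 2, a = 0 ∨ a = 1) (bit c k) with h | h
  · refine (Reach.const 0).congr fun x => ?_
    rcases (by decide : ∀ a : Fin 2, a = 0 ∨ a = 1) (g x) with h' | h'
    · simp [h', bit]
    · simp [h', h]
  · refine ((Reach.of_subset (Set.singleton_subset_iff.2 hg)).mono (by norm_num)).congr fun x => ?_
    rcases (by decide : ∀ a : Fin 2, a = 0 ∨ a = 1) (g x) with h' | h'
    · simp [h', bit]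
    · simp [h', h]

theorem Reach.numWeightedSum [Nonempty κ] (n m a : ℕ) (c : ℕ → ℕ) (b : ℕ → BoolFun κ)
    (hb : ∀ e < m, b e ∈ S) :
    Reach ((m + 1) * (23 * n + 3)) S
      (numBits n fun x => a + ∑ e ∈ Finset.range m, (b e x : ℕ) * c e) := by
  induction m with
  | zero => simpa using (Reach.numConst (S := S) n a).mono (by omega)
  | succ m ih =>
    have h := (ih fun e he => hb e (by omega)).seq
      ((Reach.numMulConst (S := S ∪ numBits n fun x => a + ∑ e ∈ Finset.range m, (b e x : ℕ) * c e)
        n (c m) (g := b m) (Or.inl (hb m (by omega)))).seq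
        (Reach.numAdd (n := n) (u := fun x => a + ∑ e ∈ Finset.range m, (b e x : ℕ) * c e)
          (v := fun x => (b m x : ℕ) * c m) (fun f hf => Or.inl (Or.inr hf))
          fun f hf => Or.inr hf))
    simp only [Finset.sum_range_succ, ← add_assoc]
    exact h.mono (by lia)

/-- The greedy expansion of `r` in terms of the weights `c (n - 1), …, c 0`. -/
def greedy (c : ℕ → ℕ) : ℕ → ℕ → ℕ → Fin 2
  | 0, _ => fun _ => 0
  | n + 1, r => update (greedy c n (if c n ≤ r then r - c n else r)) n (if c n ≤ r then 1 else 0)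

/-- If each weight exceeds the total of the terms below it, comparison with the highest weight
reveals its bit, and subtraction leaves the same problem for the rest. The condition concerns the
given bits only, as it can fail for words that are not codes. -/
theorem greedy_sum (c : ℕ → ℕ) (b : ℕ → Fin 2) (n : ℕ)
    (h : ∀ e < n, ∑ j ∈ Finset.range e, (b j : ℕ) * c j < c e) (e : ℕ) (he : e < n) :
    greedy c n (∑ j ∈ Finset.range n, (b j : ℕ) * c j) e = b e := by
  induction n with
  | zero => omega
  | succ n ih =>
    have hn := h n (by omega)
    rw [Finset.sum_range_succ, greedy]
    have key : (if c n ≤ ∑ j ∈ Finset.range n, (b j : ℕ) * c j + (b n : ℕ) * c n then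
        ∑ j ∈ Finset.range n, (b j : ℕ) * c j + (b n : ℕ) * c n - c n else
        ∑ j ∈ Finset.range n, (b j : ℕ) * c j + (b n : ℕ) * c n)
          = ∑ j ∈ Finset.range n, (b j : ℕ) * c j ∧
        (if c n ≤ ∑ j ∈ Finset.range n, (b j : ℕ) * c j + (b n : ℕ) * c n then 1 else 0) = b n := by
      rcases (by decide : ∀ a : Fin 2, a = 0 ∨ a = 1) (b n) with h' | h'
      · simp [h', hn]
      · simp [h']
    rw [key.1, key.2]
    by_cases hen : e = n
    · subst hen
      simp
    · rw [update_of_ne hen]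
      exact ih (fun e he => h e (by omega)) (by omega)

/-- One addition both compares and subtracts: adding 2^n - c to r sets bit n exactly when c ≤ r, and
in that case the n low bits are those of r - c. -/
theorem Reach.condSub [Nonempty κ] {n : ℕ} {r : (κ → Fin 2) → ℕ} (hr : numBits n r ⊆ S)
    (hrn : ∀ x, r x < 2 ^ n) {c : ℕ} (hc : c ≤ 2 ^ n) :
    Reach (40 * (n + 1)) S
      ({fun x => if c ≤ r x then 1 else 0} ∪ numBits n fun x => if c ≤ r x then r x - c else r x) := by
  have h1 : Reach 3 S (numBits (n + 1) r) := by
    refine ((Reach.of_subset hr).union (Reach.const 0)).mono_right ?_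
    rintro f ⟨k, hk, rfl⟩
    rcases Nat.lt_succ_iff_lt_or_eq.1 hk with hk | rfl
    · exact Or.inl ⟨k, hk, rfl⟩
    · refine Or.inr ?_
      simp only [bit_of_lt (hrn _)]
      rfl
  have h2 := (h1.union (Reach.numConst (n + 1) (2 ^ n - c))).seq
    (Reach.numAdd (n := n + 1) (u := r) (v := fun _ => 2 ^ n - c) (fun f hf => Or.inr (Or.inl hf))
      fun f hf => Or.inr (Or.inr hf))
  have hb : ∀ x, bit (r x + (2 ^ n - c)) n = if c ≤ r x then 1 else 0 := fun x => by
    rw [bit_eq_ite_le]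
    · exact if_congr (by omega) rfl rfl
    · have := hrn x
      rw [pow_succ]
      omega
  have hmem : (fun x => if c ≤ r x then 1 else 0) ∈ numBits (n + 1) fun x => r x + (2 ^ n - c) :=
    ⟨n, by omega, funext fun x => (hb x).symm⟩
  refine (h2.seq (m := n * 10)
    ((Reach.of_subset (T := {fun x => if c ≤ r x then 1 else 0}) ?_).union
      (Reach.family (m := 10) _ fun k hk => ?_) |>.mono (by omega))).mono (by omega)
  · exact Set.singleton_subset_iff.2 (Or.inr hmem)
  · have g1 : Reach 0 (S ∪ numBits (n + 1) fun x => r x + (2 ^ n - c)) {fun x => bit (r x) k} :=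
      Reach.of_subset (Set.singleton_subset_iff.2 (Or.inl (hr ⟨k, hk, rfl⟩)))
    have g2 : Reach 0 (S ∪ numBits (n + 1) fun x => r x + (2 ^ n - c))
        {fun x => bit (r x + (2 ^ n - c)) k} :=
      Reach.of_subset (Set.singleton_subset_iff.2 (Or.inr ⟨k, by omega, rfl⟩))
    have g3 : Reach 0 (S ∪ numBits (n + 1) fun x => r x + (2 ^ n - c))
        {fun x => if c ≤ r x then 1 else 0} :=
      Reach.of_subset (Set.singleton_subset_iff.2 (Or.inr hmem))
    -- Over two elements, a + s(a + b) selects b if s = 1 and a otherwise.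
    refine (g1.add (g3.mul (g1.add g2))).congr fun x => ?_
    have e : c ≤ r x → bit (r x + (2 ^ n - c)) k = bit (r x - c) k := fun h => by
      rw [← bit_mod hk, show r x + (2 ^ n - c) = r x - c + 2 ^ n by omega, Nat.add_mod_right,
        bit_mod hk]
    by_cases h : c ≤ r x
    · simp only [if_pos h]
      rw [e h]
      generalize bit (r x) k = p, bit (r x - c) k = q
      revert p q
      decide
    · simp [h]

theorem Reach.greedy [Nonempty κ] {n : ℕ} (c : ℕ → ℕ) (m : ℕ) (hc : ∀ e < m, c e ≤ 2 ^ n)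
    {S : Set (BoolFun κ)} {r : (κ → Fin 2) → ℕ} (hr : numBits n r ⊆ S) (hrn : ∀ x, r x < 2 ^ n) :
    Reach (m * (40 * (n + 1))) S {f | ∃ e < m, f = fun x => BPX.greedy c m (r x) e} := by
  induction m generalizing S r with
  | zero =>
    refine (Reach.of_subset (Set.empty_subset S)).mono_right ?_ |>.mono (by simp)
    rintro f ⟨e, he, -⟩
    omega
  | succ m ih =>
    have h1 := Reach.condSub hr hrn (hc m (by omega))
    have h2 := ih (fun e he => hc e (by omega))
      (S := S ∪ ({fun x => if c m ≤ r x then 1 else 0} ∪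
        numBits n fun x => if c m ≤ r x then r x - c m else r x))
      (r := fun x => if c m ≤ r x then r x - c m else r x)
      (fun f hf => Or.inr (Or.inr hf)) (fun x => by
        have := hrn x
        split_ifs <;> omega)
    refine ((h1.trans h2).mono (by lia)).mono_right ?_
    rintro f ⟨e, he, rfl⟩
    by_cases hem : e = m
    · subst hem
      refine Or.inl (Or.inl (funext fun x => ?_))
      simp [BPX.greedy]
    · refine Or.inr ⟨e, by omega, funext fun x => ?_⟩
      simp [BPX.greedy, hem]

end Arithmetic

/-! ## Encoding of the grid points -/

/-- The contents of the system register: `d` blocks of `L + 1` bits. -/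
abbrev Word (d L : ℕ) : Type := Fin d × Fin (L + 1) → Fin 2

theorem bit_finFunctionFinEquiv {n : ℕ} (f : Fin n → Fin 2) (k : Fin n) :
    bit (finFunctionFinEquiv f) k = f k := by
  conv_rhs => rw [← finFunctionFinEquiv.symm_apply_apply f]
  exact Fin.ext (finFunctionFinEquiv_symm_apply_val _ _).symm

theorem finFunctionFinEquiv_bit {n a : ℕ} (h : a < 2 ^ n) :
    (finFunctionFinEquiv (fun k : Fin n => bit a k) : ℕ) = a := by
  have : (fun k : Fin n => bit a k) = finFunctionFinEquiv.symm ⟨a, h⟩ := by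
    funext k
    exact Fin.ext (finFunctionFinEquiv_symm_apply_val ⟨a, h⟩ k).symm
  rw [this, Equiv.apply_symm_apply]

theorem sum_bit (n l : ℕ) : ∑ k ∈ Finset.range l, (bit n k : ℕ) * 2 ^ k = n % 2 ^ l := by
  induction l with
  | zero => simp [Nat.mod_one]
  | succ l ih =>
    rw [Finset.sum_range_succ, ih, Nat.mod_pow_succ, bit, mul_comm]

theorem sum_digits_lt (b : ℕ → Fin 2) (t : ℕ) :
    ∑ k ∈ Finset.range t, (b k : ℕ) * 2 ^ k + 1 ≤ 2 ^ t := by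
  induction t with
  | zero => simp
  | succ t ih =>
    rw [Finset.sum_range_succ, pow_succ]
    have : (b t : ℕ) * 2 ^ t ≤ 1 * 2 ^ t := Nat.mul_le_mul_right _ (by omega)
    omega

/-- Setting the missing bit strictly increases the value, which still stays below 2^t. A block with
some zero bit thus holds at most 2^t - 2, a legal digit in base 2^t - 1. -/
theorem sum_digits_lt_of_eq_zero (b : ℕ → Fin 2) (t k : ℕ) (hk : k < t) (hb : b k = 0) :
    ∑ k ∈ Finset.range t, (b k : ℕ) * 2 ^ k + 1 ≤ 2 ^ t - 1 := by
  have h := sum_digits_lt (update b k 1) t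
  have : ∑ k ∈ Finset.range t, (b k : ℕ) * 2 ^ k <
      ∑ j ∈ Finset.range t, (update b k 1 j : ℕ) * 2 ^ j := by
    refine Finset.sum_lt_sum (fun j _ => ?_) ⟨k, Finset.mem_range.2 hk, by simp [hb]⟩
    by_cases hj : j = k
    · subst hj
      simp [hb]
    · rw [update_of_ne hj]
  omega

/-! ### Mixed-radix codes of grid points -/

section Word

variable {d L : ℕ}

/-- The number whose binary digits are the bits of `w`. -/
def wval (w : Word d L) : ℕ := finFunctionFinEquiv (w ∘ finProdFinEquiv.symm)

/-- The binary digits of a number. -/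
def wbits (d L n : ℕ) : Word d L := fun p => bit n (finProdFinEquiv p)

theorem wval_lt (w : Word d L) : wval w < 2 ^ (d * (L + 1)) := Fin.isLt _

theorem bit_wval (w : Word d L) (p : Fin d × Fin (L + 1)) :
    bit (wval w) (finProdFinEquiv p) = w p := by
  rw [wval, bit_finFunctionFinEquiv]
  simp

theorem wbits_wval (w : Word d L) : wbits d L (wval w) = w := funext (bit_wval w)

theorem wval_wbits {n : ℕ} (h : n < 2 ^ (d * (L + 1))) : wval (wbits d L n) = n := by
  have e : wbits d L n ∘ finProdFinEquiv.symm =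
      fun k : Fin (d * (L + 1)) => bit n k := by
    funext k
    change bit n (finProdFinEquiv (finProdFinEquiv.symm k)) = _
    rw [Equiv.apply_symm_apply]
  rw [wval, e, finFunctionFinEquiv_bit h]

/-- The bit `k` of block `j`. -/
def wget (w : Word d L) (j k : ℕ) : Fin 2 :=
  if h : j < d ∧ k < L + 1 then w (⟨j, h.1⟩, ⟨k, h.2⟩) else 0

/-- The weight of a bit of a grid point of level `l`: the numbers in base `2 ^ l - 1` have
digits that are written in binary. -/
def weight (l e : ℕ) : ℕ := 2 ^ (e % l) * (2 ^ l - 1) ^ (e / l)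

/-- The bits of a word that carry the grid point of level `l`. -/
def codeBit (l : ℕ) (w : Word d L) (e : ℕ) : Fin 2 := wget w (e / l) (e % l + (L - l))

/-- The number of a grid point of level `l`, where `a` is the number of the first one. -/
def encode (l a : ℕ) (w : Word d L) : ℕ :=
  a + ∑ e ∈ Finset.range (d * l), (codeBit l w e : ℕ) * weight l e

/-- The grid point of level `l` with a given number. -/
def decode (l a : ℕ) (w : Word d L) : Word d L := fun p =>
  if L - l ≤ p.2 ∧ (p.2 : ℕ) < L then
    greedy (weight l) (d * l) ((wval w + (2 ^ (d * (L + 1)) - a)) % 2 ^ (d * (L + 1)))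
      (p.1 * l + (p.2 - (L - l)))
  else 0

/-- The word encodes a grid point of level `l`. -/
def IsCode (l : ℕ) (w : Word d L) : Prop :=
  ∀ j, (∀ k : Fin (L + 1), ¬(L - l ≤ k ∧ (k : ℕ) < L) → w (j, k) = 0) ∧
    ∃ k : Fin (L + 1), (L - l ≤ k ∧ (k : ℕ) < L) ∧ w (j, k) = 0

theorem mul_add_mod_div {l j k : ℕ} (hk : k < l) : (j * l + k) % l = k ∧ (j * l + k) / l = j := by
  constructor
  · rw [mul_comm, Nat.mul_add_mod, Nat.mod_eq_of_lt hk]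
  · rw [mul_comm, Nat.mul_add_div (by omega), Nat.div_eq_of_lt hk, Nat.add_zero]

theorem weight_eq {l j k : ℕ} (hk : k < l) : weight l (j * l + k) = 2 ^ k * (2 ^ l - 1) ^ j := by
  rw [weight, (mul_add_mod_div hk).1, (mul_add_mod_div hk).2]

theorem codeBit_eq {l j k : ℕ} (hk : k < l) (w : Word d L) :
    codeBit l w (j * l + k) = wget w j (k + (L - l)) := by
  rw [codeBit, (mul_add_mod_div hk).1, (mul_add_mod_div hk).2]

theorem sum_block (l j t : ℕ) (ht : t ≤ l) (b : ℕ → Fin 2) :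
    ∑ e ∈ Finset.range (j * l + t), (b e : ℕ) * weight l e =
      ∑ e ∈ Finset.range (j * l), (b e : ℕ) * weight l e +
        (∑ k ∈ Finset.range t, (b (j * l + k) : ℕ) * 2 ^ k) * (2 ^ l - 1) ^ j := by
  rw [Finset.sum_range_add, Finset.sum_mul]
  congr 1
  refine Finset.sum_congr rfl fun k hk => ?_
  rw [weight_eq (by have := Finset.mem_range.1 hk; omega), mul_assoc]

theorem sum_blocks (l n : ℕ) (b : ℕ → Fin 2) :
    ∑ e ∈ Finset.range (n * l), (b e : ℕ) * weight l e =
      ∑ j ∈ Finset.range n,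
        (∑ k ∈ Finset.range l, (b (j * l + k) : ℕ) * 2 ^ k) * (2 ^ l - 1) ^ j := by
  induction n with
  | zero => simp
  | succ n ih => rw [Nat.succ_mul, sum_block l n l le_rfl, ih, Finset.sum_range_succ]

theorem IsCode.digit_lt {l : ℕ} {w : Word d L} (h : IsCode l w) (hl : l ≤ L) {j : ℕ} (hj : j < d) :
    ∑ k ∈ Finset.range l, (codeBit l w (j * l + k) : ℕ) * 2 ^ k + 1 ≤ 2 ^ l - 1 := by
  obtain ⟨k, hk, hk0⟩ := (h ⟨j, hj⟩).2
  have hlt : (k : ℕ) - (L - l) < l := by omega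
  refine sum_digits_lt_of_eq_zero (fun k => codeBit l w (j * l + k)) l (k - (L - l)) hlt ?_
  rw [codeBit_eq hlt, wget, dif_pos ⟨hj, by omega⟩]
  convert hk0 using 3
  exact Fin.ext (by simp; omega)

theorem IsCode.sum_lt {l : ℕ} {w : Word d L} (h : IsCode l w) (hl : l ≤ L) {n : ℕ} (hn : n ≤ d) :
    ∑ e ∈ Finset.range (n * l), (codeBit l w e : ℕ) * weight l e + 1 ≤ (2 ^ l - 1) ^ n := by
  induction n with
  | zero => simp
  | succ n ih =>
    rw [Nat.succ_mul, sum_block l n l le_rfl]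
    have h1 := ih (by omega)
    have h2 := Nat.mul_le_mul_right ((2 ^ l - 1) ^ n) (h.digit_lt hl (j := n) (by omega))
    rw [pow_succ]
    lia

/-- For the bit k of block j, the lower blocks contribute less than (2^l - 1)^j and the lower bits
of the same block at most (2^k - 1)(2^l - 1)^j. This is the domination needed in `greedy_sum`. -/
theorem IsCode.sum_lt_weight {l : ℕ} {w : Word d L} (h : IsCode l w) (h1 : 1 ≤ l) (hl : l ≤ L)
    {e : ℕ} (he : e < d * l) :
    ∑ j ∈ Finset.range e, (codeBit l w j : ℕ) * weight l j < weight l e := by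
  have hlt := Nat.mod_lt e h1
  have hdiv : e / l < d := (Nat.div_lt_iff_lt_mul h1).2 he
  have hee : e / l * l + e % l = e := by rw [mul_comm]; exact Nat.div_add_mod e l
  generalize e / l = j at *
  generalize e % l = k at *
  subst hee
  rw [sum_block l j k hlt.le, weight_eq hlt]
  have h2 := h.sum_lt hl hdiv.le
  have h3 := Nat.mul_le_mul_right ((2 ^ l - 1) ^ j)
    (sum_digits_lt (fun k => codeBit l w (j * l + k)) k)
  lia

theorem IsCode.encode_lt {l : ℕ} {w : Word d L} (h : IsCode l w) (hl : l ≤ L) (a : ℕ) :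
    encode l a w < a + (2 ^ l - 1) ^ d := by
  have := h.sum_lt hl le_rfl
  rw [encode]
  omega

theorem decode_encode {l a : ℕ} {w : Word d L} (h : IsCode l w) (h1 : 1 ≤ l) (hl : l ≤ L)
    (ha : a + (2 ^ l - 1) ^ d ≤ 2 ^ (d * (L + 1))) :
    decode l a (wbits d L (encode l a w)) = w := by
  funext p
  have h2 := h.encode_lt hl a
  have h3 := h.sum_lt hl le_rfl
  rw [decode, wval_wbits (by omega)]
  -- Adding 2^n - a modulo 2^n, with n = d(L + 1), removes the offset `a`.
  have e : (encode l a w + (2 ^ (d * (L + 1)) - a)) % 2 ^ (d * (L + 1)) =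
      ∑ e ∈ Finset.range (d * l), (codeBit l w e : ℕ) * weight l e := by
    rw [encode, show ∀ s : ℕ, a + s + (2 ^ (d * (L + 1)) - a) = s + 2 ^ (d * (L + 1)) by omega,
      Nat.add_mod_right, Nat.mod_eq_of_lt (by omega)]
  rw [e]
  split_ifs with hp
  · have hlt : (p.2 : ℕ) - (L - l) < l := by omega
    rw [greedy_sum _ _ _ fun e he => h.sum_lt_weight h1 hl he]
    · rw [codeBit_eq hlt, wget, dif_pos ⟨p.1.2, by omega⟩]
      congr 1
      exact Prod.ext rfl (Fin.ext (by simp; omega))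
    · calc p.1 * l + (p.2 - (L - l)) < p.1 * l + l := by omega
        _ = (p.1 + 1) * l := by ring
        _ ≤ d * l := Nat.mul_le_mul_right _ p.1.2
  · exact ((h p.1).1 p.2 hp).symm

theorem weight_le {l e : ℕ} (hl : l ≤ L) (he : e < d * l) :
    weight l e ≤ 2 ^ (d * (L + 1)) := by
  calc weight l e ≤ 2 ^ (e % l) * (2 ^ l) ^ (e / l) :=
        Nat.mul_le_mul_left _ (Nat.pow_le_pow_left (Nat.sub_le _ _) _)
    _ = 2 ^ e := by rw [← pow_mul, ← pow_add, Nat.mod_add_div]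
    _ ≤ 2 ^ (d * (L + 1)) :=
        Nat.pow_le_pow_right two_pos (he.le.trans (Nat.mul_le_mul_left _ (by omega)))

/-! ### Costs -/

/-- The indicator function of the code words. -/
def codeInd (l : ℕ) (w : Word d L) : Fin 2 :=
  ∏ j, (∏ k : Fin (L + 1), if L - l ≤ k ∧ (k : ℕ) < L then 1 else 1 + w (j, k)) *
    (1 + ∏ k : Fin (L + 1), if L - l ≤ k ∧ (k : ℕ) < L then w (j, k) else 1)

theorem prod_eq_one_iff_fin_two {β : Type*} (A : Finset β) (f : β → Fin 2) :
    ∏ i ∈ A, f i = 1 ↔ ∀ i ∈ A, f i = 1 := by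
  classical
  induction A using Finset.induction_on with
  | empty => simp
  | insert j A hj ih =>
    have h2 : ∀ a b : Fin 2, a * b = 1 ↔ a = 1 ∧ b = 1 := by decide
    rw [Finset.prod_insert hj, h2, ih, Finset.forall_mem_insert]

theorem codeInd_eq_one_iff (l : ℕ) (w : Word d L) : codeInd l w = 1 ↔ IsCode l w := by
  have h2 : ∀ a b : Fin 2, a * (1 + b) = 1 ↔ a = 1 ∧ ¬b = 1 := by decide
  have h3 : ∀ a : Fin 2, 1 + a = 1 ↔ a = 0 := by decide
  have h4 : ∀ a : Fin 2, a ≠ 1 ↔ a = 0 := by decide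
  rw [codeInd, prod_eq_one_iff_fin_two]
  simp only [Finset.mem_univ, true_implies, IsCode]
  refine forall_congr' fun j => ?_
  rw [h2, prod_eq_one_iff_fin_two, prod_eq_one_iff_fin_two]
  refine and_congr ?_ ?_
  · simp only [Finset.mem_univ, true_implies]
    refine forall_congr' fun k => ?_
    by_cases hk : L - l ≤ k ∧ (k : ℕ) < L
    · simp [hk]
    · rw [if_neg hk, h3]
      exact ⟨fun h _ => h, fun h => h hk⟩
  · simp only [Finset.mem_univ, true_implies, not_forall]
    refine exists_congr fun k => ?_
    by_cases hk : L - l ≤ k ∧ (k : ℕ) < L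
    · rw [if_pos hk, ← ne_eq, h4]
      exact ⟨fun h => ⟨hk, h⟩, fun h => h.2⟩
    · rw [if_neg hk]
      exact ⟨fun h => absurd rfl h, fun h => absurd h.1 hk⟩

variable {κ : Type} [Nonempty κ] {S : Set (BoolFun κ)} {w : (κ → Fin 2) → Word d L}

theorem Reach.mem {f : BoolFun κ} (h : f ∈ S) : Reach 0 S {f} :=
  Reach.of_subset (Set.singleton_subset_iff.2 h)

theorem Reach.codeInd (l : ℕ) (hw : ∀ p, (fun x => w x p) ∈ S) :
    Reach (d * (10 * (L + 1) + 11) + 3) S {fun x => BPX.codeInd l (w x)} := by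
  have h := Reach.prod (Finset.univ : Finset (Fin d))
    (fun j x => (∏ k : Fin (L + 1), if L - l ≤ k ∧ (k : ℕ) < L then 1 else 1 + w x (j, k)) *
      (1 + ∏ k : Fin (L + 1), if L - l ≤ k ∧ (k : ℕ) < L then w x (j, k) else 1))
    (n := 10 * (L + 1) + 9) (S := S) fun j _ => by
      have h1 := Reach.prod (Finset.univ : Finset (Fin (L + 1)))
        (fun k x => if L - l ≤ k ∧ (k : ℕ) < L then 1 else 1 + w x (j, k)) (n := 3) (S := S)
        fun k _ => by
          split_ifs
          · exact Reach.const 1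
          · exact (Reach.mem (hw _)).not.mono (by norm_num)
      have h2 := Reach.prod (Finset.univ : Finset (Fin (L + 1)))
        (fun k x => if L - l ≤ k ∧ (k : ℕ) < L then w x (j, k) else 1) (n := 3) (S := S)
        fun k _ => by
          split_ifs
          · exact (Reach.mem (hw _)).mono (by norm_num)
          · exact Reach.const 1
      rw [Finset.card_univ, Fintype.card_fin] at h1 h2
      exact (h1.mul h2.not).mono (by omega)
  rw [Finset.card_univ, Fintype.card_fin] at h
  exact h.mono (by lia)

theorem numBits_wval (hw : ∀ p, (fun x => w x p) ∈ S) :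
    numBits (d * (L + 1)) (fun x => wval (w x)) ⊆ S := by
  rintro f ⟨k, hk, rfl⟩
  convert hw (finProdFinEquiv.symm ⟨k, hk⟩) using 2 with x
  rw [← bit_wval (w x), Equiv.apply_symm_apply]

theorem Reach.encode {l : ℕ} (h1 : 1 ≤ l) (hl : l ≤ L) (a : ℕ) (hw : ∀ p, (fun x => w x p) ∈ S) :
    Reach (23 * (d * (L + 1) + 1) ^ 2) S
      {f | ∃ p, f = fun x => wbits d L (BPX.encode l a (w x)) p} := by
  have h := Reach.numWeightedSum (S := S) (d * (L + 1)) (d * l) a (weight l)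
    (fun e x => codeBit l (w x) e) fun e he => by
      have hdiv : e / l < d := (Nat.div_lt_iff_lt_mul h1).2 he
      have hmod := Nat.mod_lt e h1
      have hk : e % l + (L - l) < L + 1 := by omega
      simp only [codeBit, wget, dif_pos (And.intro hdiv hk)]
      exact hw _
  have hdl : d * l + 1 ≤ d * (L + 1) + 1 :=
    Nat.succ_le_succ (Nat.mul_le_mul_left d (by omega))
  refine (h.mono ?_).mono_right ?_
  · calc (d * l + 1) * (23 * (d * (L + 1)) + 3)
        ≤ (d * (L + 1) + 1) * (23 * (d * (L + 1)) + 3) := Nat.mul_le_mul_right _ hdl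
      _ ≤ (d * (L + 1) + 1) * (23 * (d * (L + 1) + 1)) := Nat.mul_le_mul_left _ (by omega)
      _ = _ := by ring
  · rintro f ⟨p, rfl⟩
    exact ⟨finProdFinEquiv p, Fin.isLt _, rfl⟩

theorem Reach.decode {l : ℕ} (hl : l ≤ L) (a : ℕ) (hw : ∀ p, (fun x => w x p) ∈ S) :
    Reach (70 * (d * (L + 1) + 1) ^ 2) S {f | ∃ p, f = fun x => BPX.decode l a (w x) p} := by
  have hdl : d * l ≤ d * (L + 1) := Nat.mul_le_mul_left d (by omega)
  have hc := Reach.numConst (S := S) (d * (L + 1)) (2 ^ (d * (L + 1)) - a)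
  have hadd := hc.seq (Reach.numAdd (n := d * (L + 1)) (u := fun x => wval (w x))
    (v := fun _ => 2 ^ (d * (L + 1)) - a) (fun f hf => Or.inl (numBits_wval hw hf))
    fun f hf => Or.inr hf)
  -- Reduction modulo a power of two is free: the retained low bits do not change.
  have hsub : numBits (d * (L + 1)) (fun x : κ → Fin 2 =>
      (wval (w x) + (2 ^ (d * (L + 1)) - a)) % 2 ^ (d * (L + 1))) ⊆
      S ∪ numBits (d * (L + 1)) fun x : κ → Fin 2 => wval (w x) + (2 ^ (d * (L + 1)) - a) := by
    rintro f ⟨k, hk, rfl⟩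
    exact Or.inr ⟨k, hk, funext fun x => bit_mod hk⟩
  have hg := hadd.seq (Reach.greedy (weight l) (d * l) (fun e he => weight_le hl he) hsub
    fun x => Nat.mod_lt _ (Nat.two_pow_pos _))
  refine ((hg.union (Reach.const 0)).mono ?_).mono_right ?_
  · have : d * l * (40 * (d * (L + 1) + 1)) ≤ d * (L + 1) * (40 * (d * (L + 1) + 1)) :=
      Nat.mul_le_mul_right _ hdl
    lia
  · rintro f ⟨p, rfl⟩
    by_cases hp : L - l ≤ p.2 ∧ (p.2 : ℕ) < L
    · refine Or.inl ⟨p.1 * l + (p.2 - (L - l)), ?_, ?_⟩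
      · calc p.1 * l + (p.2 - (L - l)) < p.1 * l + l := by omega
          _ = (p.1 + 1) * l := by ring
          _ ≤ d * l := Nat.mul_le_mul_right _ p.1.2
      · simp only [BPX.decode, if_pos hp]
    · refine Or.inr ?_
      simp only [BPX.decode, if_neg hp]
      rfl

end Word

/-! ## The register and its basis permutations -/

/-- The ancilla qubits: the labels of the levels (the last label is used for the output), the
adder register, a flag, and a qubit for a scalar factor. -/
abbrev Anc (L : ℕ) : Type := Fin (L + 1) ⊕ Fin L ⊕ Bool

/-- The ancilla qubits and the qubits of the system. -/
abbrev Reg (d L : ℕ) : Type := Anc L ⊕ (Fin d × Fin (L + 1))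

section Reg

variable {d L : ℕ}

/-- The label with number `q`. -/
abbrev Reg.lab (q : Fin (L + 1)) : Reg d L := Sum.inl (Sum.inl q)

/-- A bit of the adder register. -/
abbrev Reg.anc (k : Fin L) : Reg d L := Sum.inl (Sum.inr (Sum.inl k))

/-- The flag (`false`) and the qubit for the scalar factor (`true`). -/
abbrev Reg.aux (b : Bool) : Reg d L := Sum.inl (Sum.inr (Sum.inr b))

open Reg

theorem card_reg : Fintype.card (Reg d L) = 2 * L + 3 + d * (L + 1) := by
  simp
  ring

/-- Replaces a label and the system word. -/
def setReg (z : Reg d L → Fin 2) (p : Fin (L + 1)) (e : Fin 2) (w : Word d L) : Reg d L → Fin 2 :=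
  Sum.elim (update (z ∘ Sum.inl) (Sum.inl p) e) w

theorem setReg_lab (z : Reg d L → Fin 2) (p q : Fin (L + 1)) (e : Fin 2) (w : Word d L) :
    setReg z p e w (lab q) = if q = p then e else z (lab q) := by
  by_cases h : q = p
  · subst h
    simp [setReg]
  · simp [setReg, h]

theorem setReg_setReg (z : Reg d L → Fin 2) (p : Fin (L + 1)) (e e' : Fin 2) (w w' : Word d L) :
    setReg (setReg z p e w) p e' w' = setReg z p e' w' := by
  rw [setReg, setReg, Sum.elim_comp_inl, update_idem, setReg]

theorem setReg_self (z : Reg d L → Fin 2) (p : Fin (L + 1)) {e : Fin 2} {w : Word d L}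
    (he : z (lab p) = e) (hw : z ∘ Sum.inr = w) : setReg z p e w = z := by
  subst he hw
  have : update (z ∘ Sum.inl) (Sum.inl p) (z (lab p)) = z ∘ Sum.inl :=
    update_eq_self (Sum.inl p : Anc L) (z ∘ Sum.inl)
  rw [setReg, this]
  exact Sum.elim_comp_inl_inr z

open Classical in
/-- Exchanges the numbers of the grid points of level `l` and their encodings with label `p`. -/
def swapCode (p : Fin (L + 1)) (l a : ℕ) (z : Reg d L → Fin 2) : Reg d L → Fin 2 :=
  if (∀ q, z (lab q) = 0) ∧ IsCode l (decode l a (z ∘ Sum.inr)) ∧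
      wbits d L (encode l a (decode l a (z ∘ Sum.inr))) = z ∘ Sum.inr then
    setReg z p 1 (decode l a (z ∘ Sum.inr))
  else if (∀ q, z (lab q) = if q = p then 1 else 0) ∧ IsCode l (z ∘ Sum.inr) then
    setReg z p 0 (wbits d L (encode l a (z ∘ Sum.inr)))
  else z

variable {p : Fin (L + 1)} {l a : ℕ} {z : Reg d L → Fin 2}

theorem swapCode_index {w : Word d L} (hw : IsCode l w) (h1 : 1 ≤ l) (hl : l ≤ L)
    (ha : a + (2 ^ l - 1) ^ d ≤ 2 ^ (d * (L + 1))) (hz : ∀ q, z (lab q) = 0)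
    (hzw : z ∘ Sum.inr = wbits d L (encode l a w)) : swapCode p l a z = setReg z p 1 w := by
  have hd := decode_encode hw h1 hl ha
  rw [swapCode, hzw, hd, if_pos ⟨hz, hw, rfl⟩]

theorem swapCode_code (hw : IsCode l (z ∘ Sum.inr)) (hz : ∀ q, z (lab q) = if q = p then 1 else 0) :
    swapCode p l a z = setReg z p 0 (wbits d L (encode l a (z ∘ Sum.inr))) := by
  rw [swapCode, if_neg, if_pos ⟨hz, hw⟩]
  intro h
  have := h.1 p
  rw [hz, if_pos rfl] at this
  exact one_ne_zero this

/-- A foreign label excludes both branches, so what one level has decoded is left alone by the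
exchanges of the other levels. -/
theorem swapCode_of_lab {q : Fin (L + 1)} (hq : q ≠ p) (hz : z (lab q) = 1) :
    swapCode p l a z = z := by
  rw [swapCode, if_neg, if_neg]
  · intro h
    have := h.1 q
    rw [hz, if_neg hq] at this
    exact one_ne_zero this
  · intro h
    have := h.1 q
    rw [hz] at this
    exact one_ne_zero this

theorem swapCode_of_not_index (hz : ∀ q, z (lab q) = 0)
    (h : ∀ w : Word d L, IsCode l w → z ∘ Sum.inr ≠ wbits d L (encode l a w)) :
    swapCode p l a z = z := by
  rw [swapCode, if_neg, if_neg]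
  · intro h
    have := h.1 p
    rw [hz, if_pos rfl] at this
    exact zero_ne_one this
  · rintro ⟨-, h1, h2⟩
    exact h _ h1 h2.symm

/-- The label tells the two exchanged classes apart. A code returns to itself by `decode_encode`;
for a number the round trip is part of the membership test, so nothing is required of the decoder on
other words. -/
theorem swapCode_involutive (h1 : 1 ≤ l) (hl : l ≤ L)
    (ha : a + (2 ^ l - 1) ^ d ≤ 2 ^ (d * (L + 1))) :
    Involutive (swapCode p l a : (Reg d L → Fin 2) → Reg d L → Fin 2) := by
  intro z
  by_cases c1 : (∀ q, z (lab q) = 0) ∧ IsCode l (decode l a (z ∘ Sum.inr)) ∧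
      wbits d L (encode l a (decode l a (z ∘ Sum.inr))) = z ∘ Sum.inr
  · have e : swapCode p l a z = setReg z p 1 (decode l a (z ∘ Sum.inr)) := by
      rw [swapCode, if_pos c1]
    rw [e, swapCode_code c1.2.1, setReg_setReg]
    · exact setReg_self _ _ (c1.1 p) c1.2.2.symm
    · intro q
      rw [setReg_lab, c1.1]
  · by_cases c2 : (∀ q, z (lab q) = if q = p then 1 else 0) ∧ IsCode l (z ∘ Sum.inr)
    · rw [swapCode_code c2.2 c2.1, swapCode_index c2.2 h1 hl ha _ rfl, setReg_setReg]
      · exact setReg_self _ _ (by rw [c2.1, if_pos rfl]) rfl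
      · intro q
        rw [setReg_lab]
        split_ifs with h
        · rfl
        · rw [c2.1, if_neg h]
    · have e : swapCode p l a z = z := by rw [swapCode, if_neg c1, if_neg c2]
      rw [e, e]

theorem swapCode_apply_inl (z : Reg d L → Fin 2) {r : Anc L} (hr : r ≠ Sum.inl p) :
    swapCode p l a z (Sum.inl r) = z (Sum.inl r) := by
  rw [swapCode]
  split_ifs
  · simp [setReg, hr]
  · simp [setReg, hr]
  · rfl

/-! ### Costs -/

theorem Reach.inputs {κ : Type} [Fintype κ] {S : Set (BoolFun κ)} :
    Reach 0 S (Set.range fun (i : κ) (x : κ → Fin 2) => x i) := by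
  refine (Reach.biUnion (n := 0) Finset.univ (fun i : κ => {fun x : κ → Fin 2 => x i})
    fun i _ => Reach.input i).mono_right ?_
  rintro f ⟨i, rfl⟩
  exact ⟨i, Finset.mem_univ i, rfl⟩

theorem Reach.outputs {κ : Type} [Fintype κ] {n : ℕ} {S : Set (BoolFun κ)}
    {σ : (κ → Fin 2) → κ → Fin 2} (h : ∀ i, Reach n S {fun x => σ x i}) :
    Reach (Fintype.card κ * n) S {f | ∃ i, f = fun x => σ x i} := by
  refine (Reach.biUnion Finset.univ (fun i : κ => {fun x => σ x i})
    fun i _ => h i).mono_right ?_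
  rintro f ⟨i, rfl⟩
  exact ⟨i, Finset.mem_univ i, rfl⟩

theorem Reach.allZero {κ β : Type} [Nonempty κ] [Fintype β] {S : Set (BoolFun κ)} {n : ℕ}
    {f : β → BoolFun κ} (h : ∀ i, Reach n S {f i}) :
    Reach (Fintype.card β * (n + 3) + 3) S {fun x => ∏ i, (1 + f i x)} :=
  (Reach.prod Finset.univ (fun i x => 1 + f i x) (n := n + 1) fun i _ => (h i).not).mono (by
    rw [Finset.card_univ])

theorem allZero_eq_one_iff {β : Type} [Fintype β] (f : β → Fin 2) :
    ∏ i, (1 + f i) = 1 ↔ ∀ i, f i = 0 := by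
  have h3 : ∀ a : Fin 2, 1 + a = 1 ↔ a = 0 := by decide
  rw [prod_eq_one_iff_fin_two]
  simp only [Finset.mem_univ, true_implies, h3]

theorem ite_eq_of_fin_two {c : Fin 2} {P : Prop} [Decidable P] (h : c = 1 ↔ P) :
    c = if P then 1 else 0 := by
  split_ifs with hP
  · exact h.2 hP
  · exact (by decide : ∀ a : Fin 2, a ≠ 1 → a = 0) c fun hc => hP (h.1 hc)

theorem reach_swapCode (p : Fin (L + 1)) {l : ℕ} (h1 : 1 ≤ l) (hl : l ≤ L) (a : ℕ) :
    Reach (320 * ((d + 1) * (L + 2)) ^ 2) ∅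
      {f | ∃ i, f = fun x : Reg d L → Fin 2 => swapCode p l a x i} := by
  classical
  let I : Set (BoolFun (Reg d L)) := Set.range fun (i : Reg d L) (x : Reg d L → Fin 2) => x i
  let D : (Reg d L → Fin 2) → Word d L := fun x => decode l a (x ∘ Sum.inr)
  let E : (Reg d L → Fin 2) → Word d L := fun x => wbits d L (encode l a (D x))
  let E' : (Reg d L → Fin 2) → Word d L := fun x => wbits d L (encode l a (x ∘ Sum.inr))
  have hI : ∀ i, (fun x : Reg d L → Fin 2 => x i) ∈ I := fun i => ⟨i, rfl⟩
  let S : Set (BoolFun (Reg d L)) := I ∪ {f | ∃ q, f = fun x => D x q} ∪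
    {f | ∃ q, f = fun x => E x q} ∪ {f | ∃ q, f = fun x => E' x q}
  -- Here 116 = 70 + 23 + 23: one decoding, the encoding of its result for the membership test, and
  -- the encoding of the stored word for the converse exchange.
  have hS : Reach (116 * (d * (L + 1) + 1) ^ 2) ∅ S := by
    have hD : Reach (70 * (d * (L + 1) + 1) ^ 2) I {f | ∃ q, f = fun x => D x q} :=
      Reach.decode hl a fun q => hI (Sum.inr q)
    have hE : Reach (23 * (d * (L + 1) + 1) ^ 2) (I ∪ {f | ∃ q, f = fun x => D x q})
        {f | ∃ q, f = fun x => E x q} :=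
      Reach.encode h1 hl a fun q => Or.inr ⟨q, rfl⟩
    have hE' : Reach (23 * (d * (L + 1) + 1) ^ 2) I {f | ∃ q, f = fun x => E' x q} :=
      Reach.encode (w := fun x => x ∘ Sum.inr) h1 hl a fun q => hI (Sum.inr q)
    have h2 := ((hD.trans hE).union hE')
    refine ((Reach.inputs.trans (h2.mono_left (S' := ∅ ∪ I) (by simp))).mono (by omega)).mono_right
      ?_
    intro f hf
    simpa only [S, Set.union_assoc] using hf
  have mI : ∀ i, (fun x : Reg d L → Fin 2 => x i) ∈ S := fun i => Or.inl (Or.inl (Or.inl (hI i)))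
  have mD : ∀ q, (fun x => D x q) ∈ S := fun q => Or.inl (Or.inl (Or.inr ⟨q, rfl⟩))
  have mE : ∀ q, (fun x => E x q) ∈ S := fun q => Or.inl (Or.inr ⟨q, rfl⟩)
  have mE' : ∀ q, (fun x => E' x q) ∈ S := fun q => Or.inr ⟨q, rfl⟩
  let c1 : BoolFun (Reg d L) := fun x => if (∀ q, x (lab q) = 0) ∧ IsCode l (D x) ∧
    E x = x ∘ Sum.inr then 1 else 0
  let c2 : BoolFun (Reg d L) := fun x => if (∀ q, x (lab q) = if q = p then 1 else 0) ∧
    IsCode l (x ∘ Sum.inr) then 1 else 0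
  have r1 : Reach ((L + 1) * 3 + d * (10 * (L + 1) + 11) + (d * (L + 1)) * 7 + 13) S {c1} := by
    have g1 := Reach.allZero (S := S) (f := fun q x => x (lab q)) fun q => Reach.mem (mI (lab q))
    have g2 := Reach.codeInd l mD
    have g3 := Reach.allZero (S := S) (f := fun q x => E x q + x (Sum.inr q)) (n := 4) fun q =>
      (Reach.mem (mE q)).add (Reach.mem (mI (Sum.inr q)))
    refine ((g1.mul (g2.mul g3)).mono ?_).congr fun x => ite_eq_of_fin_two ?_
    · simp only [Fintype.card_fin, Fintype.card_prod]
      omega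
    · have h2 : ∀ a b : Fin 2, a * b = 1 ↔ a = 1 ∧ b = 1 := by decide
      have h3 : ∀ a b : Fin 2, a + b = 0 ↔ a = b := by decide
      simp only [h2, allZero_eq_one_iff, codeInd_eq_one_iff, h3, funext_iff, comp_apply]
  have r2 : Reach ((L + 1) * 6 + d * (10 * (L + 1) + 11) + 8) S {c2} := by
    have g1 := Reach.allZero (S := S) (f := fun q x => x (lab q) + if q = p then 1 else 0) (n := 3)
      fun q => by
        by_cases hqp : q = p
        · simp only [hqp, if_true]
          exact ((Reach.mem (mI (lab p))).not.mono (by norm_num)).congr fun x => add_comm _ _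
        · simp only [if_neg hqp, add_zero]
          exact (Reach.mem (mI (lab q))).mono (by norm_num)
    have g2 := Reach.codeInd (w := fun x => x ∘ Sum.inr) l fun q => mI (Sum.inr q)
    refine ((g1.mul g2).mono ?_).congr fun x => ite_eq_of_fin_two ?_
    · simp only [Fintype.card_fin]
      omega
    · have h2 : ∀ a b : Fin 2, a * b = 1 ↔ a = 1 ∧ b = 1 := by decide
      have h3 : ∀ a b : Fin 2, a + b = 0 ↔ a = b := by decide
      simp only [h2, allZero_eq_one_iff, codeInd_eq_one_iff, h3]
  -- Both branches become bitwise corrections, switched on by `c1` and `c2`, which are never 1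
  -- together.
  have key : ∀ x i, swapCode p l a x i = Sum.elim
      (fun r => if r = Sum.inl p then x (Sum.inl r) + (c1 x + c2 x) else x (Sum.inl r))
      (fun q => x (Sum.inr q) +
        (c1 x * (x (Sum.inr q) + D x q) + c2 x * (x (Sum.inr q) + E' x q))) i := by
    intro x i
    have h2 : ∀ a b : Fin 2, a + (a + b) = b := by decide
    by_cases k1 : (∀ q, x (lab q) = 0) ∧ IsCode l (D x) ∧ E x = x ∘ Sum.inr
    · have k2 : ¬((∀ q, x (lab q) = if q = p then 1 else 0) ∧ IsCode l (x ∘ Sum.inr)) := by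
        intro k2
        have := k2.1 p
        rw [k1.1, if_pos rfl] at this
        exact zero_ne_one this
      simp only [swapCode, c1, c2, if_neg k2]
      rw [if_pos k1, if_pos k1]
      rcases i with r | q
      · by_cases hr : r = Sum.inl p
        · subst hr
          simp [setReg, k1.1 p]
        · simp [setReg, hr]
      · simp [setReg, h2, D]
    · simp only [swapCode, c1, c2]
      rw [if_neg k1, if_neg k1]
      by_cases k2 : (∀ q, x (lab q) = if q = p then 1 else 0) ∧ IsCode l (x ∘ Sum.inr)
      · rw [if_pos k2, if_pos k2]
        rcases i with r | q
        · by_cases hr : r = Sum.inl p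
          · subst hr
            simp [setReg, k2.1 p]
          · simp [setReg, hr]
        · simp [setReg, h2, E']
      · rw [if_neg k2, if_neg k2]
        rcases i with r | q
        · simp
        · simp
  have hout : Reach (Fintype.card (Reg d L) * 20) (S ∪ ({c1} ∪ {c2}))
      {f | ∃ i, f = fun x : Reg d L → Fin 2 => swapCode p l a x i} := by
    have mI' : ∀ i, Reach 0 (S ∪ ({c1} ∪ {c2})) {fun x : Reg d L → Fin 2 => x i} := fun i =>
      Reach.mem (Or.inl (mI i))
    have m1 : Reach 0 (S ∪ ({c1} ∪ {c2})) {c1} := Reach.mem (Or.inr (Or.inl rfl))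
    have m2 : Reach 0 (S ∪ ({c1} ∪ {c2})) {c2} := Reach.mem (Or.inr (Or.inr rfl))
    refine Reach.outputs fun i => ?_
    rcases i with r | q
    · by_cases hr : r = Sum.inl p
      · refine (((mI' (Sum.inl r)).add (m1.add m2)).mono (by norm_num)).congr fun x => ?_
        rw [key, Sum.elim_inl, if_pos hr]
      · refine ((mI' (Sum.inl r)).mono (by norm_num)).congr fun x => ?_
        rw [key, Sum.elim_inl, if_neg hr]
    · refine (((mI' (Sum.inr q)).add ((m1.mul ((mI' (Sum.inr q)).add
        (Reach.mem (Or.inl (mD q))))).add (m2.mul ((mI' (Sum.inr q)).add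
        (Reach.mem (Or.inl (mE' q))))))).mono (by norm_num)).congr fun x => ?_
      rw [key, Sum.elim_inr]
  refine (hS.seq (((r1.union r2).seq hout).mono_left (by simp))).mono ?_
  rw [card_reg]
  ring_nf
  nlinarith [Nat.zero_le (d * L), Nat.zero_le (d ^ 2 * L), Nat.zero_le (d ^ 2 * L ^ 2)]

end Reg

/-! ## The interpolation in one coordinate -/

theorem bit_eq_ite_testBit (n k : ℕ) : bit n k = if n.testBit k then 1 else 0 := by
  apply Fin.ext
  rw [Nat.testBit_eq_decide_div_mod_eq]
  rcases Nat.mod_two_eq_zero_or_one (n / 2 ^ k) with h | h <;> simp [bit, h]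

theorem bit_compl {n m k : ℕ} (hm : m < 2 ^ n) (hk : k < n) :
    bit (2 ^ n - (m + 1)) k = 1 + bit m k := by
  rw [bit_eq_ite_testBit, bit_eq_ite_testBit, Nat.testBit_two_pow_sub_succ hm]
  cases m.testBit k <;> simp [hk]

theorem bit_injOn {n a b : ℕ} (ha : a < 2 ^ n) (hb : b < 2 ^ n) (h : ∀ k < n, bit a k = bit b k) :
    a = b := by
  rw [← finFunctionFinEquiv_bit ha, ← finFunctionFinEquiv_bit hb]
  congr 2
  funext k
  exact h k k.2

theorem bit_div (n t k : ℕ) : bit (n / 2 ^ t) k = bit n (k + t) := by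
  apply Fin.ext
  simp only [bit]
  rw [Nat.div_div_eq_div_mul, ← pow_add, add_comm]

theorem bit_mul_pow_of_lt {m t k : ℕ} (h : k < t) : bit (m * 2 ^ t) k = 0 := by
  rw [← bit_mod h, Nat.mul_mod_left]
  apply Fin.ext
  simp [bit]

/-- The number with given binary digits. -/
def fval {n : ℕ} (f : Fin n → Fin 2) : ℕ := finFunctionFinEquiv f

theorem fval_lt {n : ℕ} (f : Fin n → Fin 2) : fval f < 2 ^ n := Fin.isLt _

theorem bit_fval {n : ℕ} (f : Fin n → Fin 2) (k : Fin n) : bit (fval f) k = f k :=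
  bit_finFunctionFinEquiv f k

theorem fval_eq_iff {n a : ℕ} (ha : a < 2 ^ n) (f : Fin n → Fin 2) :
    fval f = a ↔ ∀ k, f k = bit a k := by
  constructor
  · rintro rfl k
    rw [bit_fval]
  · intro h
    rw [fval, show f = fun k : Fin n => bit a k from funext h, finFunctionFinEquiv_bit ha]

theorem fval_div_eq_iff {L l m : ℕ} (hl : l ≤ L) (hm : m < 2 ^ l) (f : Fin L → Fin 2) :
    fval f / 2 ^ (L - l) = m ↔ ∀ k : Fin L, L - l ≤ k → f k = bit (m * 2 ^ (L - l)) k := by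
  have hpos := Nat.two_pow_pos (L - l)
  have hlt : fval f / 2 ^ (L - l) < 2 ^ l := by
    rw [Nat.div_lt_iff_lt_mul hpos, ← pow_add, Nat.add_sub_cancel' hl]
    exact fval_lt f
  have hb : ∀ k, bit m k = bit (m * 2 ^ (L - l)) (k + (L - l)) := fun k => by
    rw [← bit_div, Nat.mul_div_cancel _ hpos]
  constructor
  · rintro h k hk
    rw [← bit_fval f k, ← Nat.sub_add_cancel hk, ← hb, ← h, bit_div]
  · intro h
    refine bit_injOn hlt hm fun k hk => ?_
    have := h ⟨k + (L - l), by omega⟩ (by simp)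
    rw [bit_div, hb, ← this, ← bit_fval f]

/-! ### Amplitudes of a layer of Hadamard gates -/

section Hadamard

/-- The factor `1 / √2`. -/
def invSqrtTwo : ℂ := ((1 / √2 : ℝ) : ℂ)

theorem invSqrtTwo_mul_self : invSqrtTwo * invSqrtTwo = 1 / 2 := by
  rw [invSqrtTwo, ← Complex.ofReal_mul, div_mul_div_comm, Real.mul_self_sqrt (by norm_num)]
  push_cast
  norm_num

/-- The Hadamard matrix. -/
def hadamard : Matrix (Fin 2) (Fin 2) ℂ := !![invSqrtTwo, invSqrtTwo; invSqrtTwo, -invSqrtTwo]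

theorem hadamard_mul_self : hadamard * hadamard = 1 := by
  have h := invSqrtTwo_mul_self
  ext i j
  fin_cases i <;> fin_cases j <;> simp [hadamard, Matrix.mul_apply, h] <;> norm_num

theorem hadamard_mem : hadamard ∈ Matrix.unitaryGroup (Fin 2) ℂ := by
  have hs : star hadamard = hadamard := by
    ext i j
    fin_cases i <;> fin_cases j <;>
      simp [hadamard, Matrix.star_apply, invSqrtTwo, -Complex.ofReal_div, Complex.conj_ofReal]
  rw [Matrix.mem_unitaryGroup_iff, hs, hadamard_mul_self]

theorem hadamard_symm (a b : Fin 2) : hadamard a b = hadamard b a := by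
  fin_cases a <;> fin_cases b <;> simp [hadamard]

theorem hadamard_apply_zero (a : Fin 2) : hadamard a 0 = invSqrtTwo := by
  fin_cases a <;> simp [hadamard]

/-- The L - l low bits of m 2^(L-l) vanish, so each Hadamard gate contributes 1/√2 without a sign.
The identity factors force the high bits of `f` to be those of m. The result is a uniform box of
length 2^(L-l). -/
theorem prod_hadamard {L l m : ℕ} (hl : l ≤ L) (hm : m < 2 ^ l) (f : Fin L → Fin 2) :
    ∏ k : Fin L, (if (k : ℕ) + l < L then hadamard else 1) (f k) (bit (m * 2 ^ (L - l)) k) =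
      if fval f / 2 ^ (L - l) = m then invSqrtTwo ^ (L - l) else 0 := by
  have hfac : ∀ k : Fin L,
      (if (k : ℕ) + l < L then hadamard else 1) (f k) (bit (m * 2 ^ (L - l)) k) =
      if (k : ℕ) < L - l then invSqrtTwo else if f k = bit (m * 2 ^ (L - l)) k then 1 else 0 := by
    intro k
    by_cases hk : (k : ℕ) < L - l
    · rw [if_pos (by omega), if_pos hk, bit_mul_pow_of_lt hk, hadamard_apply_zero]
    · rw [if_neg (by omega), if_neg hk, Matrix.one_apply]
  simp only [hfac]
  by_cases h : fval f / 2 ^ (L - l) = m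
  · rw [if_pos h]
    have h' := (fval_div_eq_iff hl hm f).1 h
    have : ∀ k : Fin L, (if (k : ℕ) < L - l then invSqrtTwo else
        if f k = bit (m * 2 ^ (L - l)) k then 1 else 0) =
        if (k : ℕ) < L - l then invSqrtTwo else 1 := fun k => by
      by_cases hk : (k : ℕ) < L - l
      · rw [if_pos hk, if_pos hk]
      · rw [if_neg hk, if_neg hk, if_pos (h' k (by omega))]
    simp only [this]
    rw [Fin.prod_univ_eq_prod_range (fun k => if k < L - l then invSqrtTwo else 1), Finset.prod_ite,
      Finset.prod_const, Finset.prod_const_one, mul_one]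
    congr 1
    rw [show (Finset.range L).filter (· < L - l) = Finset.range (L - l) by
      ext k; simp; omega, Finset.card_range]
  · rw [if_neg h]
    rw [fval_div_eq_iff hl hm] at h
    push Not at h
    obtain ⟨k, hk, hk'⟩ := h
    exact Finset.prod_eq_zero (Finset.mem_univ k) (by rw [if_neg (by omega), if_neg hk'])

end Hadamard

/-! ### Involutions for addition and for the flags -/

section Digit

variable {d L : ℕ}

open Reg

/-- The digit stored in block `i`. -/
def dig (i : Fin d) (z : Reg d L → Fin 2) : Fin L → Fin 2 := fun k => z (Sum.inr (i, k.castSucc))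

/-- The contents of the adder register. -/
def ancs (z : Reg d L → Fin 2) : Fin L → Fin 2 := fun k => z (anc k)

/-- Replaces a digit by the complement of its sum with the adder register. -/
def addNot (i : Fin d) (z : Reg d L → Fin 2) : Reg d L → Fin 2 :=
  Sum.elim (z ∘ Sum.inl) fun q => if q.1 = i ∧ (q.2 : ℕ) < L then
    1 + bit (fval (dig i z) + fval (ancs z)) q.2 else z (Sum.inr q)

/-- Complements a digit, and flips the last bit of its block unless the adder register is zero. -/
def finishDigit (i : Fin d) (z : Reg d L → Fin 2) : Reg d L → Fin 2 :=
  Sum.elim (z ∘ Sum.inl) fun q => if q.1 = i then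
    (if (q.2 : ℕ) < L then 1 + z (Sum.inr q) else z (Sum.inr q) + (1 + ∏ k, (1 + ancs z k)))
    else z (Sum.inr q)

/-- Flips the last label, and flips the flag if the parity of the other labels is even. -/
def raiseFlags (z : Reg d L → Fin 2) : Reg d L → Fin 2 :=
  update (update z (lab (Fin.last L)) (z (lab (Fin.last L)) + 1)) (aux false)
    (z (aux false) + (1 + ∑ q : Fin L, z (lab q.castSucc)))

/-- Complementing is v ↦ -1 - v modulo 2^L, so the map x ↦ -1 - (x + a) is its own inverse, which
plain addition is not. The superfluous complement is removed by `finishDigit`. -/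
theorem addNot_involutive (i : Fin d) :
    Involutive (addNot i : (Reg d L → Fin 2) → Reg d L → Fin 2) := by
  intro z
  have ha : ancs (addNot i z) = ancs z := rfl
  have hlt : (fval (dig i z) + fval (ancs z)) % 2 ^ L < 2 ^ L := Nat.mod_lt _ (Nat.two_pow_pos L)
  have hd : fval (dig i (addNot i z)) = 2 ^ L - ((fval (dig i z) + fval (ancs z)) % 2 ^ L + 1) := by
    rw [fval_eq_iff (by omega)]
    intro k
    rw [bit_compl hlt k.2, bit_mod k.2]
    simp [dig, addNot]
  funext r
  rcases r with r | ⟨j, k⟩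
  · rfl
  · rw [addNot, Sum.elim_inr]
    split_ifs with h
    · obtain ⟨rfl, hk⟩ := h
      dsimp only at hk ⊢
      have h1 := fval_lt (dig j z)
      have h2 := fval_lt (ancs z)
      have e : (fval (dig j (addNot j z)) + fval (ancs z)) % 2 ^ L
          = 2 ^ L - (fval (dig j z) + 1) := by
        rw [hd]
        by_cases h3 : fval (dig j z) + fval (ancs z) < 2 ^ L
        · rw [Nat.mod_eq_of_lt h3, Nat.mod_eq_of_lt (by omega)]
          omega
        · have : (fval (dig j z) + fval (ancs z)) % 2 ^ L =
              fval (dig j z) + fval (ancs z) - 2 ^ L := by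
            rw [Nat.mod_eq_sub_mod (by omega), Nat.mod_eq_of_lt (by omega)]
          rw [this, show 2 ^ L - (fval (dig j z) + fval (ancs z) - 2 ^ L + 1) + fval (ancs z)
            = 2 ^ L - (fval (dig j z) + 1) + 2 ^ L by omega, Nat.add_mod_right,
            Nat.mod_eq_of_lt (by omega)]
      have h4 : ∀ a : Fin 2, 1 + (1 + a) = a := by decide
      rw [ha, ← bit_mod hk, e, bit_compl h1 hk, h4]
      exact bit_fval (dig j z) ⟨k, hk⟩
    · simp only [addNot, Sum.elim_inr, if_neg h]

/-- Every bit is flipped by an amount that depends only on the unchanged adder register. The spare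
top bit of the block records whether that register failed to return to zero. -/
theorem finishDigit_involutive (i : Fin d) :
    Involutive (finishDigit i : (Reg d L → Fin 2) → Reg d L → Fin 2) := by
  intro z
  have ha : ancs (finishDigit i z) = ancs z := rfl
  have h4 : ∀ a : Fin 2, 1 + (1 + a) = a := by decide
  have h5 : ∀ a b : Fin 2, a + b + b = a := by decide
  funext r
  rcases r with r | q
  · rfl
  · rw [finishDigit, Sum.elim_inr, ha]
    simp only [finishDigit, Sum.elim_inr]
    split_ifs
    · rw [h4]
    · rw [h5]
    · rfl

/-- Both increments are functions of bits that stay fixed. The last label serves to detect invalid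
rows, the flag to detect columns that belong to no level. -/
theorem raiseFlags_involutive :
    Involutive (raiseFlags : (Reg d L → Fin 2) → Reg d L → Fin 2) := by
  intro z
  have h5 : ∀ a b : Fin 2, a + b + b = a := by decide
  have h6 : ∀ a : Fin 2, a + 1 + 1 = a := by decide
  have e : ∀ q : Fin L, raiseFlags z (lab q.castSucc) = z (lab q.castSucc) := fun q => by
    have : q.castSucc ≠ Fin.last L := (Fin.castSucc_lt_last q).ne
    simp [raiseFlags, this]
  have e1 : raiseFlags z (lab (Fin.last L)) = z (lab (Fin.last L)) + 1 := by
    simp [raiseFlags]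
  have e2 : raiseFlags z (aux false) = z (aux false) + (1 + ∑ q : Fin L, z (lab q.castSucc)) := by
    simp [raiseFlags]
  funext r
  rw [raiseFlags]
  simp only [e, e1, e2, h5]
  by_cases h1 : r = aux false
  · subst h1
    simp
  · by_cases h2 : r = lab (Fin.last L)
    · subst h2
      simp
    · rw [update_of_ne h1, update_of_ne h2, raiseFlags, update_of_ne h1, update_of_ne h2]

/-! ### Costs -/

theorem cost_le {n : ℕ} (h : n ≤ 300 * ((d + 1) * (L + 2)) ^ 2) :
    n ≤ 320 * ((d + 1) * (L + 2)) ^ 2 := by omega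

theorem reach_addNot (i : Fin d) :
    Reach (320 * ((d + 1) * (L + 2)) ^ 2) ∅
      {f | ∃ r, f = fun x : Reg d L → Fin 2 => addNot i x r} := by
  let I : Set (BoolFun (Reg d L)) := Set.range fun (i : Reg d L) (x : Reg d L → Fin 2) => x i
  have h1 : Reach (20 * L + 3) (∅ ∪ I)
      (numBits L fun x : Reg d L → Fin 2 => fval (dig i x) + fval (ancs x)) := by
    refine Reach.numAdd ?_ ?_
    · rintro f ⟨k, hk, rfl⟩
      exact Or.inr ⟨Sum.inr (i, (⟨k, hk⟩ : Fin L).castSucc),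
        funext fun x => (bit_fval (dig i x) ⟨k, hk⟩).symm⟩
    · rintro f ⟨k, hk, rfl⟩
      exact Or.inr ⟨anc ⟨k, hk⟩, funext fun x => (bit_fval (ancs x) ⟨k, hk⟩).symm⟩
  refine (Reach.inputs.seq (h1.seq (Reach.outputs (n := 1) fun r => ?_))).mono ?_
  · have hin : ∀ r, Reach 0 (∅ ∪ I ∪
        numBits L fun x : Reg d L → Fin 2 => fval (dig i x) + fval (ancs x))
        {fun x : Reg d L → Fin 2 => x r} := fun r => Reach.mem (Or.inl (Or.inr ⟨r, rfl⟩))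
    rcases r with r | q
    · exact (hin (Sum.inl r)).mono (by norm_num)
    · by_cases hq : q.1 = i ∧ (q.2 : ℕ) < L
      · simp only [addNot, Sum.elim_inr, if_pos hq]
        refine (Reach.not (n := 0) (f := fun x : Reg d L → Fin 2 =>
          bit (fval (dig i x) + fval (ancs x)) q.2) (Reach.mem (Or.inr ⟨q.2, hq.2, rfl⟩)))
      · simp only [addNot, Sum.elim_inr, if_neg hq]
        exact (hin (Sum.inr q)).mono (by norm_num)
  · refine cost_le ?_
    rw [card_reg]
    ring_nf
    nlinarith [Nat.zero_le (d * L), Nat.zero_le (d ^ 2 * L), Nat.zero_le (d ^ 2 * L ^ 2)]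

theorem reach_finishDigit (i : Fin d) :
    Reach (320 * ((d + 1) * (L + 2)) ^ 2) ∅
      {f | ∃ r, f = fun x : Reg d L → Fin 2 => finishDigit i x r} := by
  refine (Reach.outputs (n := 3 * L + 8) fun r => ?_).mono ?_
  · rcases r with r | q
    · exact (Reach.input (Sum.inl r)).mono (by omega)
    · by_cases h1 : q.1 = i
      · by_cases h2 : (q.2 : ℕ) < L
        · simp only [finishDigit, Sum.elim_inr, if_pos h1, if_pos h2]
          exact (Reach.input (Sum.inr q)).not.mono (by omega)
        · simp only [finishDigit, Sum.elim_inr, if_pos h1, if_neg h2]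
          have h := Reach.allZero (S := ∅) (f := fun k (x : Reg d L → Fin 2) => ancs x k) (n := 0)
            fun k => Reach.input (anc k)
          refine ((Reach.input (Sum.inr q)).add h.not).mono ?_
          rw [Fintype.card_fin]
          omega
      · simp only [finishDigit, Sum.elim_inr, if_neg h1]
        exact (Reach.input (Sum.inr q)).mono (by omega)
  · refine cost_le ?_
    rw [card_reg]
    ring_nf
    nlinarith [Nat.zero_le (d * L), Nat.zero_le (d ^ 2 * L), Nat.zero_le (d ^ 2 * L ^ 2)]

theorem reach_raiseFlags :
    Reach (320 * ((d + 1) * (L + 2)) ^ 2) ∅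
      {f | ∃ r, f = fun x : Reg d L → Fin 2 => raiseFlags x r} := by
  refine (Reach.outputs (n := 4 * L + 8) fun r => ?_).mono ?_
  · by_cases h1 : r = aux false
    · subst h1
      simp only [raiseFlags, update_self]
      have h := Reach.sum (S := ∅) Finset.univ
        (fun (q : Fin L) (x : Reg d L → Fin 2) => x (lab q.castSucc)) (n := 0)
        fun q _ => Reach.input _
      refine ((Reach.input (aux false)).add h.not).mono ?_
      rw [Finset.card_univ, Fintype.card_fin]
      omega
    · simp only [raiseFlags, update_of_ne h1]
      by_cases h2 : r = lab (Fin.last L)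
      · subst h2
        simp only [update_self]
        exact ((Reach.input (lab (Fin.last L))).not.mono (by omega)).congr fun x => add_comm _ _
      · simp only [update_of_ne h2]
        exact (Reach.input r).mono (by omega)
  · refine cost_le ?_
    rw [card_reg]
    ring_nf
    nlinarith [Nat.zero_le (d * L), Nat.zero_le (d ^ 2 * L), Nat.zero_le (d ^ 2 * L ^ 2)]

end Digit

/-! ### Hat functions as convolutions of two boxes -/

section DigitOp

variable {d L : ℕ}

open Reg

/-- The labels of the levels on which the bit `k` is put into superposition. -/
def ctlSet (d L k : ℕ) : Finset (Reg d L) :=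
  (Finset.univ.filter fun q : Fin L => (q : ℕ) + 1 + k < L).image fun q => lab q.castSucc

/-- The weight of a bit of the adder register or of a digit. -/
def bitIdx : Reg d L → ℕ := Sum.elim (Sum.elim (fun _ => 0) (Sum.elim (fun k => k) fun _ => 0))
  fun q => q.2

/-- The Hadamard matrix or the identity, depending on the level. -/
def hadM (r : Reg d L) (z : Reg d L → Fin 2) : Matrix (Fin 2) (Fin 2) ℂ :=
  if ∑ c ∈ ctlSet d L (bitIdx r), z c = 1 then hadamard else 1

/-- The adder register. -/
def ancSet (d L : ℕ) : Finset (Reg d L) := Finset.univ.image anc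

/-- The bits of the digit in block `i`. -/
def digSet (i : Fin d) : Finset (Reg d L) :=
  Finset.univ.image fun k : Fin L => Sum.inr (i, k.castSucc)

/-- Interpolation of the coordinate `i`. -/
def digitOp (i : Fin d) : QubitOp (Reg d L) :=
  permOp (finishDigit i) * ((muxAll (ancSet d L) hadM * permOp (addNot i)) *
    muxAll (ancSet d L ∪ digSet i) hadM)

theorem hadM_update {T : Finset (Reg d L)} (hT : ∀ k ∈ T, ∀ q, k ≠ lab q) (k j : Reg d L)
    (hj : j ∈ T) (x : Reg d L → Fin 2) (e : Fin 2) : hadM k (update x j e) = hadM k x := by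
  rw [hadM, hadM]
  congr 2
  refine Finset.sum_congr rfl fun c hc => ?_
  obtain ⟨q, -, rfl⟩ := Finset.mem_image.1 hc
  rw [update_of_ne (hT j hj _).symm]

theorem card_ctlSet_le (k : ℕ) : (ctlSet d L k).card ≤ L := by
  refine Finset.card_image_le.trans ((Finset.card_filter_le _ _).trans ?_)
  rw [Finset.card_univ, Fintype.card_fin]

theorem Impl.muxAll_hadM {Ω : Type} [Fintype Ω] [DecidableEq Ω] {T : Finset (Reg d L)}
    (hT : ∀ k ∈ T, ∀ q, k ≠ lab q) : Impl Ω (T.card * L) (BPX.muxAll T hadM) := by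
  refine Impl.muxAll T hadM (fun k hk => ?_) fun k hk j hj x e => hadM_update hT k j hj x e
  refine (Impl.mux_sum k (ctlSet d L (bitIdx k)) ?_ hadamard_mem hadamard_mul_self).mono
    (card_ctlSet_le _)
  intro hc
  obtain ⟨q, -, hq⟩ := Finset.mem_image.1 hc
  exact hT k hk _ hq.symm

theorem mem_ancSet {r : Reg d L} : r ∈ ancSet d L ↔ ∃ k, r = anc k := by
  simp [ancSet, eq_comm]

theorem mem_digSet {i : Fin d} {r : Reg d L} :
    r ∈ digSet i ↔ ∃ k : Fin L, r = Sum.inr (i, k.castSucc) := by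
  simp [digSet, eq_comm]

theorem ancSet_ne_lab : ∀ k ∈ ancSet d L, ∀ q, k ≠ lab q := by
  intro k hk q
  obtain ⟨j, rfl⟩ := mem_ancSet.1 hk
  simp

theorem union_ne_lab (i : Fin d) : ∀ k ∈ ancSet d L ∪ digSet i, ∀ q, k ≠ lab q := by
  intro k hk q
  rcases Finset.mem_union.1 hk with hk | hk
  · exact ancSet_ne_lab k hk q
  · obtain ⟨j, rfl⟩ := mem_digSet.1 hk
    simp

theorem Impl.digitOp {w : ℕ} (hw : 320 * ((d + 1) * (L + 2)) ^ 2 ≤ w) (i : Fin d) :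
    Impl (Fin w ⊕ Reg d L) (20000 * ((d + 1) * (L + 2)) ^ 2) (BPX.digitOp (L := L) i) := by
  have h1 := Impl.permOp_of_reach (addNot_involutive i) (reach_addNot (L := L) i) hw
  have h2 := Impl.permOp_of_reach (finishDigit_involutive i) (reach_finishDigit (L := L) i) hw
  have h3 := Impl.muxAll_hadM (Ω := Fin w ⊕ Reg d L) (ancSet_ne_lab (d := d) (L := L))
  have h4 := Impl.muxAll_hadM (Ω := Fin w ⊕ Reg d L) (union_ne_lab (L := L) i)
  refine (h2.mul ((h3.mul h1).mul h4)).mono ?_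
  have c1 : (ancSet d L).card ≤ L := Finset.card_image_le.trans (by simp)
  have c2 : (digSet i : Finset (Reg d L)).card ≤ L := Finset.card_image_le.trans (by simp)
  have c3 := (Finset.card_union_le (ancSet d L) (digSet i)).trans (Nat.add_le_add c1 c2)
  have c4 := Nat.mul_le_mul_right L c1
  have c5 := Nat.mul_le_mul_right L c3
  rw [card_reg]
  have c6 : 2 * L + 3 + d * (L + 1) ≤ 2 * ((d + 1) * (L + 2)) ^ 2 := by
    ring_nf
    nlinarith [Nat.zero_le (d * L), Nat.zero_le (d ^ 2 * L), Nat.zero_le (d ^ 2 * L ^ 2)]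
  have c7 : L * L ≤ ((d + 1) * (L + 2)) ^ 2 := by
    rw [← sq]
    exact Nat.pow_le_pow_left (by nlinarith) 2
  rw [add_mul] at c5
  omega

/-- The operator does not change the qubit `r`. -/
def Fixes {κ : Type} (r : κ) (A : QubitOp κ) : Prop := ∀ x y, x r ≠ y r → A x y = 0

theorem Fixes.mul {κ : Type} [Fintype κ] [DecidableEq κ] {r : κ} {A B : QubitOp κ}
    (hA : Fixes r A) (hB : Fixes r B) : Fixes r (A * B) := by
  intro x y hxy
  rw [Matrix.mul_apply]
  refine Finset.sum_eq_zero fun z _ => ?_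
  by_cases hz : x r = z r
  · rw [hB z y (hz ▸ hxy), mul_zero]
  · rw [hA x z hz, zero_mul]

theorem Fixes.permOp {κ : Type} [Fintype κ] [DecidableEq κ] {r : κ}
    {σ : (κ → Fin 2) → κ → Fin 2} (h : ∀ z, σ z r = z r) : Fixes r (permOp σ) := by
  intro x y hxy
  rw [BPX.permOp, if_neg]
  rintro rfl
  exact hxy (h y)

theorem Fixes.muxAll {κ : Type} [Fintype κ] [DecidableEq κ] {r : κ} {T : Finset κ} (hr : r ∉ T)
    (M : κ → (κ → Fin 2) → Matrix (Fin 2) (Fin 2) ℂ) : Fixes r (muxAll T M) := by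
  intro x y hxy
  rw [BPX.muxAll, if_neg fun h => hxy (h r hr)]

theorem fixes_digitOp_sys {i j : Fin d} (hij : j ≠ i) (k : Fin (L + 1)) :
    Fixes (Sum.inr (j, k) : Reg d L) (digitOp i) := by
  refine (Fixes.permOp fun z => ?_).mul (((Fixes.muxAll ?_ _).mul (Fixes.permOp fun z => ?_)).mul
    (Fixes.muxAll ?_ _))
  · simp [finishDigit, hij]
  · simp [mem_ancSet]
  · simp [addNot, hij]
  · simp [mem_ancSet, mem_digSet, hij]

theorem fixes_digitOp_anc {i : Fin d} {r : Anc L} (hr : ∀ k, r ≠ Sum.inr (Sum.inl k)) :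
    Fixes (Sum.inl r : Reg d L) (digitOp i) := by
  refine (Fixes.permOp fun z => ?_).mul (((Fixes.muxAll ?_ _).mul (Fixes.permOp fun z => ?_)).mul
    (Fixes.muxAll ?_ _))
  · rfl
  · simp [mem_ancSet, hr]
  · rfl
  · simp [mem_ancSet, mem_digSet, hr]

/-- The basis state with given contents of the adder register and of the digit in block `i`. -/
def writeDigit (i : Fin d) (y : Reg d L → Fin 2) (f g : Fin L → Fin 2) : Reg d L → Fin 2 :=
  Sum.elim (Sum.elim (fun q => y (lab q)) (Sum.elim f fun b => y (aux b)))
    fun q => if h : q.1 = i ∧ (q.2 : ℕ) < L then g ⟨q.2, h.2⟩ else y (Sum.inr q)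

theorem dig_writeDigit (i : Fin d) (y : Reg d L → Fin 2) (f g : Fin L → Fin 2) :
    dig i (writeDigit i y f g) = g := by
  funext k
  simp [dig, writeDigit]

theorem ancs_writeDigit (i : Fin d) (y : Reg d L → Fin 2) (f g : Fin L → Fin 2) :
    ancs (writeDigit i y f g) = f := rfl

theorem writeDigit_of_notMem (i : Fin d) (y : Reg d L → Fin 2) (f g : Fin L → Fin 2) {r : Reg d L}
    (h1 : r ∉ ancSet d L) (h2 : r ∉ digSet i) : writeDigit i y f g r = y r := by
  rcases r with (q | k | b) | ⟨j, k⟩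
  · rfl
  · exact absurd (mem_ancSet.2 ⟨k, rfl⟩) h1
  · rfl
  · simp only [writeDigit, Sum.elim_inr]
    rw [dif_neg]
    rintro ⟨rfl, hk⟩
    exact h2 (mem_digSet.2 ⟨⟨k, hk⟩, rfl⟩)

theorem eq_writeDigit {i : Fin d} {u y : Reg d L → Fin 2}
    (h : ∀ r, r ∉ ancSet d L ∪ digSet i → u r = y r) :
    writeDigit i y (ancs u) (dig i u) = u := by
  funext r
  by_cases h1 : r ∈ ancSet d L
  · obtain ⟨k, rfl⟩ := mem_ancSet.1 h1
    rfl
  · by_cases h2 : r ∈ digSet i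
    · obtain ⟨k, rfl⟩ := mem_digSet.1 h2
      exact congrFun (dig_writeDigit i y (ancs u) (dig i u)) k
    · rw [writeDigit_of_notMem i y _ _ h1 h2, h r (by simp [h1, h2])]

theorem sum_fval {M : Type*} [AddCommMonoid M] (n : ℕ) (F : ℕ → M) :
    ∑ f : Fin n → Fin 2, F (fval f) = ∑ a ∈ Finset.range (2 ^ n), F a := by
  rw [← Fin.sum_univ_eq_sum_range, ← finFunctionFinEquiv.sum_comp]
  rfl

/-- The number of ways to write `N` as `m K + j + k` with `j, k < K`. -/
def hatCount (K m N : ℕ) : ℕ := ((Finset.range K).filter fun j => j ≤ N ∧ (N - j) / K = m).card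

/-- There is no wrap-around: b < (m + 1)K and a < K give b + a < (m + 2)K ≤ 2^L. Hence for each a
only b = N - a can contribute. -/
theorem sum_eq_hatCount {L l m N : ℕ} (hl : l ≤ L) (hm : m + 2 ≤ 2 ^ l) (hN : N < 2 ^ L) (c : ℂ) :
    ∑ a ∈ Finset.range (2 ^ L), ∑ b ∈ Finset.range (2 ^ L),
      (if a < 2 ^ (L - l) then if b / 2 ^ (L - l) = m then if N = (b + a) % 2 ^ L then c else 0
        else 0 else 0) = c * hatCount (2 ^ (L - l)) m N := by
  have hK := Nat.two_pow_pos (L - l)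
  have hKl : 2 ^ l * 2 ^ (L - l) = 2 ^ L := by rw [← pow_add, Nat.add_sub_cancel' hl]
  have hmul := Nat.mul_le_mul_right (2 ^ (L - l)) hm
  rw [hKl, add_mul] at hmul
  have hKL : 2 ^ (L - l) ≤ 2 ^ L := Nat.pow_le_pow_right two_pos (Nat.sub_le _ _)
  have inner : ∀ a ∈ Finset.range (2 ^ L), ∑ b ∈ Finset.range (2 ^ L),
      (if a < 2 ^ (L - l) then if b / 2 ^ (L - l) = m then if N = (b + a) % 2 ^ L then c else 0
        else 0 else 0) =
      if a < 2 ^ (L - l) ∧ a ≤ N ∧ (N - a) / 2 ^ (L - l) = m then c else 0 := by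
    intro a _
    have hb : ∀ b, b / 2 ^ (L - l) = m → a < 2 ^ (L - l) → (b + a) % 2 ^ L = b + a := by
      intro b hb ha
      refine Nat.mod_eq_of_lt ?_
      have := (Nat.div_lt_iff_lt_mul hK).1 (hb.trans_lt (Nat.lt_succ_self m))
      rw [Nat.succ_mul] at this
      omega
    by_cases h : a < 2 ^ (L - l) ∧ a ≤ N ∧ (N - a) / 2 ^ (L - l) = m
    · rw [if_pos h, Finset.sum_eq_single (N - a)]
      · rw [if_pos h.1, if_pos h.2.2, if_pos]
        rw [hb _ h.2.2 h.1]
        omega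
      · intro b _ hne
        rw [if_pos h.1]
        split_ifs with h1 h2
        · rw [hb _ h1 h.1] at h2
          omega
        · rfl
        · rfl
      · intro h'
        exact absurd (Finset.mem_range.2 (by omega)) h'
    · rw [if_neg h]
      refine Finset.sum_eq_zero fun b _ => ?_
      split_ifs with h1 h2 h3
      · rw [hb _ h2 h1] at h3
        refine absurd ⟨h1, by omega, ?_⟩ h
        rwa [h3, Nat.add_sub_cancel]
      all_goals rfl
  rw [Finset.sum_congr rfl inner, ← Finset.sum_filter, Finset.sum_const, nsmul_eq_mul, mul_comm]
  congr 2
  rw [hatCount]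
  congr 1
  ext a
  simp only [Finset.mem_filter, Finset.mem_range]
  omega

/-- The label register of `y` is such that the level is `l`. -/
def LevelIs (l : ℕ) (y : Reg d L → Fin 2) : Prop :=
  ∀ k < L, ∑ c ∈ ctlSet d L k, y c = if k + l < L then 1 else 0

theorem hadM_eq {l : ℕ} {y : Reg d L → Fin 2} (h : LevelIs l y) {r : Reg d L}
    (hr : bitIdx r < L) : hadM r y = if bitIdx r + l < L then hadamard else 1 := by
  rw [hadM, h _ hr]
  split_ifs <;> simp_all

theorem LevelIs.congr {l : ℕ} {y z : Reg d L → Fin 2} (h : LevelIs l y)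
    (hz : ∀ q, z (lab q) = y (lab q)) : LevelIs l z := by
  intro k hk
  rw [← h k hk]
  refine Finset.sum_congr rfl fun c hc => ?_
  obtain ⟨q, -, rfl⟩ := Finset.mem_image.1 hc
  exact hz _

/-- Hadamard gates act on the adder twice and on the digit once, always starting or ending in zero
bits, so every admissible pair of summands has the same positive amplitude 2^(-3(L-l)/2). It remains
to count the pairs with sum `fval (dig i x)`. -/
theorem digitOp_apply (i : Fin d) {l m : ℕ} (hl : l ≤ L) (hm : m + 2 ≤ 2 ^ l)
    {x y : Reg d L → Fin 2} (hlev : LevelIs l y) (hanc : ∀ k, y (anc k) = 0)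
    (hy : y (Sum.inr (i, Fin.last L)) = 0) (hx : x (Sum.inr (i, Fin.last L)) = 0)
    (hdig : ∀ k : Fin L, y (Sum.inr (i, k.castSucc)) = bit (m * 2 ^ (L - l)) k) :
    digitOp i x y = if ∀ r, r ∉ digSet i → x r = y r then
      invSqrtTwo ^ (3 * (L - l)) * hatCount (2 ^ (L - l)) m (fval (dig i x)) else 0 := by
  have hm' : m < 2 ^ l := by omega
  have hK := Nat.two_pow_pos (L - l)
  rw [digitOp, permOp_mul_apply (finishDigit_involutive i), Matrix.mul_apply]
  -- The first layer changes only the adder and the digit, so the intermediate states are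
  -- parametrised by the contents `f`, `g` of these two.
  have hred : ∑ u : Reg d L → Fin 2,
      (muxAll (ancSet d L) hadM * permOp (addNot i) : QubitOp (Reg d L)) (finishDigit i x) u *
      muxAll (ancSet d L ∪ digSet i) hadM u y =
      ∑ p : (Fin L → Fin 2) × (Fin L → Fin 2),
        muxAll (ancSet d L) hadM (finishDigit i x) (addNot i (writeDigit i y p.1 p.2)) *
        muxAll (ancSet d L ∪ digSet i) hadM (writeDigit i y p.1 p.2) y := by
    symm
    refine Fintype.sum_of_injective (fun p => writeDigit i y p.1 p.2) ?_ _ _ ?_ ?_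
    · rintro ⟨f, g⟩ ⟨f', g'⟩ h
      have h1 := congrArg ancs h
      have h2 := congrArg (dig i) h
      simp only [ancs_writeDigit, dig_writeDigit] at h1 h2
      rw [h1, h2]
    · intro u hu
      rw [muxAll.eq_def (ancSet d L ∪ digSet i), if_neg, mul_zero]
      intro h
      exact hu ⟨(ancs u, dig i u), eq_writeDigit h⟩
    · intro p
      rw [mul_permOp_apply]
  rw [hred, Fintype.sum_prod_type]
  -- the first superposition
  have hfirst : ∀ f g, muxAll (ancSet d L ∪ digSet i) hadM (writeDigit i y f g) y =
      (if fval f < 2 ^ (L - l) then invSqrtTwo ^ (L - l) else 0) *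
      (if fval g / 2 ^ (L - l) = m then invSqrtTwo ^ (L - l) else 0) := by
    intro f g
    have hlw : LevelIs l (writeDigit i y f g) := hlev.congr fun q => rfl
    rw [muxAll, if_pos, Finset.prod_union, ancSet, digSet, Finset.prod_image, Finset.prod_image]
    · congr 1
      · have h0 := prod_hadamard hl (Nat.two_pow_pos l) f
        simp only [Nat.div_eq_zero_iff, hK.ne', false_or, zero_mul] at h0
        rw [← h0]
        refine Finset.prod_congr rfl fun k _ => ?_
        rw [hadM_eq hlw (r := anc k) k.2, hanc, bit_of_lt (Nat.two_pow_pos _)]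
        rfl
      · rw [← prod_hadamard hl hm' g]
        refine Finset.prod_congr rfl fun k _ => ?_
        rw [hadM_eq hlw (r := Sum.inr (i, k.castSucc)) k.2, hdig,
          show writeDigit i y f g (Sum.inr (i, k.castSucc)) = g k from
            congrFun (dig_writeDigit i y f g) k]
        rfl
    · intro a _ b _ hab
      simpa using hab
    · intro a _ b _ hab
      simpa using hab
    · rw [Finset.disjoint_left]
      intro r h1 h2
      obtain ⟨k, rfl⟩ := mem_ancSet.1 h1
      obtain ⟨k', h⟩ := mem_digSet.1 h2
      simp at h
    · intro r hr
      rw [Finset.mem_union, not_or] at hr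
      exact writeDigit_of_notMem i y f g hr.1 hr.2
  -- the second superposition
  have hsecond : ∀ f g, muxAll (ancSet d L) hadM (finishDigit i x)
      (addNot i (writeDigit i y f g)) =
      if (∀ r, r ∉ digSet i → x r = y r) ∧ fval (dig i x) = (fval g + fval f) % 2 ^ L then
        (if fval f < 2 ^ (L - l) then invSqrtTwo ^ (L - l) else 0) else 0 := by
    intro f g
    -- The complements in `addNot` and `finishDigit` cancel, so agreement on the digit says that the
    -- digit of `x` is the sum of `g` and `f` modulo 2^L.
    have hcond : (∀ r, r ∉ ancSet d L → finishDigit i x r = addNot i (writeDigit i y f g) r) ∧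
        (∀ k, x (anc k) = 0) ↔
        (∀ r, r ∉ digSet i → x r = y r) ∧ fval (dig i x) = (fval g + fval f) % 2 ^ L := by
      rw [fval_eq_iff (Nat.mod_lt _ (Nat.two_pow_pos L))]
      have hdg : ∀ k : Fin L, finishDigit i x (Sum.inr (i, k.castSucc)) =
          addNot i (writeDigit i y f g) (Sum.inr (i, k.castSucc)) ↔
          dig i x k = bit ((fval g + fval f) % 2 ^ L) k := by
        intro k
        have h1 : ∀ a b : Fin 2, 1 + a = 1 + b ↔ a = b := by decide
        simp only [finishDigit, addNot, Sum.elim_inr, dig_writeDigit, ancs_writeDigit, if_true,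
          Fin.val_castSucc, k.2, and_self, h1, bit_mod k.2, dig]
      constructor
      · rintro ⟨h1, h2⟩
        refine ⟨fun r hr => ?_, fun k => (hdg k).1 (h1 _ (by simp [mem_ancSet]))⟩
        by_cases ha : r ∈ ancSet d L
        · obtain ⟨k, rfl⟩ := mem_ancSet.1 ha
          rw [h2, hanc]
        · have h3 := h1 r ha
          rcases r with r | ⟨j, k⟩
          · exact h3.trans (writeDigit_of_notMem i y f g ha hr)
          · by_cases hj : j = i
            · subst hj
              by_cases hk : (k : ℕ) < L
              · exact absurd (mem_digSet.2 ⟨⟨k, hk⟩, rfl⟩) hr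
              · have hkl : k = Fin.last L := Fin.ext (by rw [Fin.val_last]; omega)
                rw [hkl, hx, hy]
            · have h4 := writeDigit_of_notMem i y f g ha hr
              simpa [finishDigit, addNot, hj, h4] using h3
      · rintro ⟨h1, h2⟩
        have h0 : ∀ k, x (anc k) = 0 := fun k => by
          rw [h1 _ (by simp [mem_digSet]), hanc]
        refine ⟨fun r ha => ?_, h0⟩
        by_cases hr : r ∈ digSet i
        · obtain ⟨k, rfl⟩ := mem_digSet.1 hr
          exact (hdg k).2 (h2 k)
        · have h4 := writeDigit_of_notMem i y f g ha hr
          have h5 := h1 r hr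
          rcases r with r | ⟨j, k⟩
          · exact h5.trans h4.symm
          · by_cases hj : j = i
            · subst hj
              by_cases hk : (k : ℕ) < L
              · exact absurd (mem_digSet.2 ⟨⟨k, hk⟩, rfl⟩) hr
              · have h6 : (1 : Fin 2) + 1 = 0 := rfl
                simp [finishDigit, addNot, hk, h4, h5, ancs, h0, h6]
            · simp [finishDigit, addNot, hj, h4, h5]
    have hxlev : (∀ r, r ∉ ancSet d L → finishDigit i x r = addNot i (writeDigit i y f g) r) →
        LevelIs l (finishDigit i x) := fun h => hlev.congr fun q =>
      h (lab q) (by simp [mem_ancSet])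
    rw [muxAll]
    by_cases h1 : ∀ r, r ∉ ancSet d L → finishDigit i x r = addNot i (writeDigit i y f g) r
    · rw [if_pos h1]
      by_cases h2 : ∀ k, x (anc k) = 0
      · rw [if_pos (hcond.1 ⟨h1, h2⟩), ancSet, Finset.prod_image]
        · have h0 := prod_hadamard hl (Nat.two_pow_pos l) f
          simp only [Nat.div_eq_zero_iff, hK.ne', false_or, zero_mul] at h0
          rw [← h0]
          refine Finset.prod_congr rfl fun k _ => ?_
          rw [hadM_eq (hxlev h1) (r := anc k) k.2]
          have e1 : finishDigit i x (anc k) = bit 0 k := by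
            rw [show finishDigit i x (anc k) = x (anc k) from rfl, h2]
            rw [bit_of_lt (Nat.two_pow_pos _)]
          rw [e1, show addNot i (writeDigit i y f g) (anc k) = f k from rfl]
          have hsymm : ∀ (P : Prop) [Decidable P] (a b : Fin 2),
              (if P then hadamard else 1) a b = (if P then hadamard else 1) b a := by
            intro P _ a b
            split_ifs
            · exact hadamard_symm a b
            · rw [Matrix.one_apply, Matrix.one_apply]
              exact if_congr eq_comm rfl rfl
          exact hsymm _ _ _
        · intro a _ b _ hab
          simpa using hab
      -- With a nonzero adder register `finishDigit` would set the spare bit of `x`, whereas the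
      -- state after the addition has it zero.
      · exfalso
        have h3 := h1 (Sum.inr (i, Fin.last L)) (by simp [mem_ancSet])
        have h4 := writeDigit_of_notMem i y f g (r := Sum.inr (i, Fin.last L))
          (by simp [mem_ancSet]) (by simp [mem_digSet, Fin.ext_iff, fun k : Fin L => k.2.ne'])
        simp only [finishDigit, addNot, Sum.elim_inr, if_true, Fin.val_last, lt_self_iff_false,
          if_false, and_false, h4, hx, hy, zero_add] at h3
        have h5 : ∀ a : Fin 2, 1 + a = 0 → a = 1 := by decide
        exact h2 ((allZero_eq_one_iff (ancs x)).1 (h5 _ h3))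
    · rw [if_neg h1, if_neg fun h => h1 (hcond.2 h).1]
  simp only [hfirst, hsecond]
  by_cases h : ∀ r, r ∉ digSet i → x r = y r
  · rw [if_pos h]
    have := sum_eq_hatCount hl hm (fval_lt (dig i x)) (invSqrtTwo ^ (3 * (L - l)))
    rw [← this, ← sum_fval L]
    refine Finset.sum_congr rfl fun f _ => ?_
    rw [← sum_fval L]
    refine Finset.sum_congr rfl fun g _ => ?_
    simp only [and_iff_right h]
    split_ifs <;> ring
  · rw [if_neg h]
    refine Finset.sum_eq_zero fun f _ => Finset.sum_eq_zero fun g _ => ?_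
    rw [if_neg fun h' => h h'.1, zero_mul]

end DigitOp

section Total

variable {d L : ℕ}

open Reg

/-! ## Interpolation in all coordinates -/

/-- The leftmost operator acts on block i and the adder only, and the adder is zero before and after
it. So a single intermediate state survives, namely `x` with digit i as in `y`, and the amplitudes
multiply. -/
theorem digitOps_apply (is : List (Fin d)) (his : is.Nodup) {l : ℕ} (m : Fin d → ℕ) (hl : l ≤ L)
    (hm : ∀ i, m i + 2 ≤ 2 ^ l) {x y : Reg d L → Fin 2} (hlev : LevelIs l y)
    (hanc : ∀ k, y (anc k) = 0) (hy : ∀ i, y (Sum.inr (i, Fin.last L)) = 0)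
    (hx : ∀ i ∈ is, x (Sum.inr (i, Fin.last L)) = 0)
    (hdig : ∀ (i : Fin d) (k : Fin L),
      y (Sum.inr (i, k.castSucc)) = bit (m i * 2 ^ (L - l)) k) :
    (is.map digitOp).prod x y = if ∀ r, (∀ i ∈ is, r ∉ digSet i) → x r = y r then
      (is.map fun i => invSqrtTwo ^ (3 * (L - l)) *
        (hatCount (2 ^ (L - l)) (m i) (fval (dig i x)) : ℂ)).prod else 0 := by
  classical
  induction is generalizing x with
  | nil =>
    simp only [List.map_nil, List.prod_nil, Matrix.one_apply]
    refine if_congr ⟨fun h r _ => h ▸ rfl, fun h => funext fun r => h r (by simp)⟩ rfl rfl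
  | cons i is ih =>
    rw [List.nodup_cons] at his
    rw [List.map_cons, List.prod_cons, Matrix.mul_apply]
    let u₀ : Reg d L → Fin 2 := fun r => if r ∈ digSet i then y r else x r
    have hdisj : ∀ {j : Fin d}, j ≠ i → ∀ {r}, r ∈ digSet j → (r : Reg d L) ∉ digSet i := by
      intro j hj r hr hr'
      obtain ⟨k, rfl⟩ := mem_digSet.1 hr
      obtain ⟨k', h⟩ := mem_digSet.1 hr'
      simp only [Sum.inr.injEq, Prod.mk.injEq] at h
      exact hj h.1
    have hne : ∀ j ∈ is, j ≠ i := fun j hj e => his.1 (e ▸ hj)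
    have step : ∀ u : Reg d L → Fin 2, (∀ r, (∀ j ∈ is, r ∉ digSet j) → u r = y r) →
        digitOp i x u = if ∀ r, r ∉ digSet i → x r = u r then
          invSqrtTwo ^ (3 * (L - l)) * hatCount (2 ^ (L - l)) (m i) (fval (dig i x)) else 0 := by
      intro u hu
      refine digitOp_apply i hl (hm i) (hlev.congr fun q => hu _ fun j _ => by simp [mem_digSet])
        (fun k => ?_) ?_ (hx i (by simp)) fun k => ?_
      · rw [hu _ fun j _ => by simp [mem_digSet], hanc]
      · rw [hu _ fun j _ => by simp [mem_digSet, Fin.ext_iff, fun k : Fin L => k.2.ne'], hy]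
      · rw [hu _ fun j hj => fun h => hdisj (hne j hj) h (mem_digSet.2 ⟨k, rfl⟩), hdig]
    -- The operator for coordinate i preserves the other blocks, so their spare bits vanish in `u`
    -- as well and the induction hypothesis applies to `u`.
    have key : ∀ u, digitOp i x u * (is.map digitOp).prod u y ≠ 0 →
        (∀ r, (∀ j ∈ i :: is, r ∉ digSet j) → x r = y r) ∧ u = u₀ := by
      intro u hu
      have h1 := left_ne_zero_of_mul hu
      have h2 := right_ne_zero_of_mul hu
      have hsys : ∀ j, j ≠ i → ∀ k, u (Sum.inr (j, k)) = x (Sum.inr (j, k)) := fun j hj k => by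
        by_contra h
        exact h1 (fixes_digitOp_sys hj k x u (Ne.symm h))
      rw [ih his.2 fun j hj => by rw [hsys j (hne j hj), hx j (by simp [hj])]] at h2
      have h3 : ∀ r, (∀ j ∈ is, r ∉ digSet j) → u r = y r := by
        by_contra h
        rw [if_neg h] at h2
        exact h2 rfl
      rw [step u h3] at h1
      have h4 : ∀ r, r ∉ digSet i → x r = u r := by
        by_contra h
        rw [if_neg h] at h1
        exact h1 rfl
      refine ⟨fun r hr => ?_, funext fun r => ?_⟩
      · rw [List.forall_mem_cons] at hr
        rw [h4 r hr.1, h3 r hr.2]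
      · by_cases hr : r ∈ digSet i
        · simp only [u₀, if_pos hr]
          exact h3 r fun j hj h => hdisj (hne j hj) h hr
        · simp only [u₀, if_neg hr, h4 r hr]
    by_cases hc : ∀ r, (∀ j ∈ i :: is, r ∉ digSet j) → x r = y r
    · rw [if_pos hc, Finset.sum_eq_single u₀]
      · have h3 : ∀ r, (∀ j ∈ is, r ∉ digSet j) → u₀ r = y r := by
          intro r hr
          by_cases hri : r ∈ digSet i
          · simp only [u₀, if_pos hri]
          · simp only [u₀, if_neg hri]
            exact hc r (List.forall_mem_cons.2 ⟨hri, hr⟩)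
        have hoff : ∀ j ∈ is, ∀ k, u₀ (Sum.inr (j, k)) = x (Sum.inr (j, k)) := by
          intro j hj k
          have : (Sum.inr (j, k) : Reg d L) ∉ digSet i := by
            simp [mem_digSet, hne j hj]
          simp only [u₀, if_neg this]
        rw [step u₀ h3, if_pos, ih his.2 fun j hj => by rw [hoff j hj, hx j (by simp [hj])],
          if_pos h3, List.map_cons, List.prod_cons]
        · congr 2
          refine List.map_congr_left fun j hj => ?_
          congr 3
          exact congrArg fval (funext fun k => hoff j hj _)
        · intro r hr
          simp only [u₀, if_neg hr]
      · intro u _ hu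
        by_contra h
        exact hu (key u h).2
      · simp
    · rw [if_neg hc]
      refine Finset.sum_eq_zero fun u _ => ?_
      by_contra h
      exact hc (key u h).1

/-- Interpolation in all coordinates. -/
def interpOp (d L : ℕ) : QubitOp (Reg d L) := ((List.finRange d).map digitOp).prod

theorem interpOp_apply {l : ℕ} (m : Fin d → ℕ) (hl : l ≤ L)
    (hm : ∀ i, m i + 2 ≤ 2 ^ l) {x y : Reg d L → Fin 2} (hlev : LevelIs l y)
    (hanc : ∀ k, y (anc k) = 0) (hy : ∀ i, y (Sum.inr (i, Fin.last L)) = 0)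
    (hx : ∀ i, x (Sum.inr (i, Fin.last L)) = 0)
    (hdig : ∀ (i : Fin d) (k : Fin L),
      y (Sum.inr (i, k.castSucc)) = bit (m i * 2 ^ (L - l)) k)
    (hxy : ∀ r, x (Sum.inl r) = y (Sum.inl r)) :
    interpOp d L x y = ∏ i, invSqrtTwo ^ (3 * (L - l)) *
      (hatCount (2 ^ (L - l)) (m i) (fval (dig i x)) : ℂ) := by
  rw [interpOp, digitOps_apply _ (List.nodup_finRange d) m hl hm hlev hanc hy (fun i _ => hx i)
    hdig, if_pos, ← Fin.prod_univ_def]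
  rintro (r | ⟨i, k⟩) hr
  · exact hxy r
  · by_cases hk : (k : ℕ) < L
    · exact absurd (mem_digSet.2 ⟨⟨k, hk⟩, rfl⟩) (hr i (List.mem_finRange i))
    · have hkl : k = Fin.last L := Fin.ext (by rw [Fin.val_last]; omega)
      rw [hkl, hx, hy]

theorem Fixes.list_prod {κ : Type} [Fintype κ] [DecidableEq κ] {r : κ} (l : List (QubitOp κ))
    (h : ∀ A ∈ l, Fixes r A) : Fixes r l.prod := by
  induction l with
  | nil =>
    intro x y hxy
    rw [List.prod_nil, Matrix.one_apply, if_neg]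
    rintro rfl
    exact hxy rfl
  | cons A l ih =>
    rw [List.prod_cons]
    exact (h A (by simp)).mul (ih fun B hB => h B (by simp [hB]))

theorem fixes_interpOp {r : Anc L} (hr : ∀ k, r ≠ Sum.inr (Sum.inl k)) :
    Fixes (Sum.inl r : Reg d L) (interpOp d L) := by
  refine Fixes.list_prod _ fun A hA => ?_
  obtain ⟨i, -, rfl⟩ := List.mem_map.1 hA
  exact fixes_digitOp_anc hr

theorem Impl.interpOp {w : ℕ} (hw : 320 * ((d + 1) * (L + 2)) ^ 2 ≤ w) :
    Impl (Fin w ⊕ Reg d L) (d * (20000 * ((d + 1) * (L + 2)) ^ 2)) (BPX.interpOp d L) := by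
  have := Impl.list_prod (Ω := Fin w ⊕ Reg d L) ((List.finRange d).map BPX.digitOp)
    (n := 20000 * ((d + 1) * (L + 2)) ^ 2) fun U hU => by
      obtain ⟨i, -, rfl⟩ := List.mem_map.1 hU
      exact Impl.digitOp hw i
  rw [BPX.interpOp]
  simpa using this

/-! ## Combination of the levels -/

/-- A real reflection of the plane. -/
def reflection (a b : ℝ) : Matrix (Fin 2) (Fin 2) ℂ := !![(a : ℂ), (b : ℂ); (b : ℂ), -(a : ℂ)]

theorem reflection_mem {a b : ℝ} (h : a ^ 2 + b ^ 2 = 1) :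
    reflection a b ∈ Matrix.unitaryGroup (Fin 2) ℂ := by
  have h' : (a : ℂ) * a + (b : ℂ) * b = 1 := by
    rw [← sq, ← sq]
    exact_mod_cast h
  have h'' : (b : ℂ) * b + (a : ℂ) * a = 1 := by rw [add_comm, h']
  rw [Matrix.mem_unitaryGroup_iff]
  ext i j
  fin_cases i <;> fin_cases j <;>
    simp [reflection, Matrix.mul_apply, Matrix.star_apply, h', h'', mul_comm]

/-- The amplitude with which an unset label of number `q` is kept. -/
def keepAmp (q : ℕ) : ℝ := 1 / √(1 + ((1 / 2 : ℝ) ^ q) ^ 2)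

/-- The amplitude that remains to be applied. -/
def scalAmp (L : ℕ) : ℝ := 1 / (2 * L * ∏ q ∈ Finset.range L, keepAmp q)

theorem keepAmp_pos (q : ℕ) : 0 < keepAmp q := by
  unfold keepAmp
  positivity

theorem keepAmp_sq (q : ℕ) : keepAmp q ^ 2 = 1 / (1 + (1 / 4 : ℝ) ^ q) := by
  rw [keepAmp, div_pow, one_pow, Real.sq_sqrt (by positivity), ← pow_mul, mul_comm, pow_mul]
  norm_num

/-- `keepAmp q` normalises the vector (1, 2^(-q)): clearing a set label is 2^(-q) times as probable
in amplitude as keeping an unset one, and this ratio is the relative weight of the level. -/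
theorem keepAmp_reflection (q : ℕ) : keepAmp q ^ 2 + ((1 / 2 : ℝ) ^ q * keepAmp q) ^ 2 = 1 := by
  have : (0 : ℝ) < 1 + ((1 / 2 : ℝ) ^ q) ^ 2 := by positivity
  rw [mul_pow, keepAmp, div_pow, one_pow, Real.sq_sqrt this.le]
  field_simp

/-- The correction term 4^(-n)/3 lets the induction close; the bare bound 3 would not reproduce
itself. -/
theorem prod_le_three (n : ℕ) :
    ∏ q ∈ Finset.range (n + 1), (1 + (1 / 4 : ℝ) ^ q) ≤ 3 * (1 - 1 / 3 * (1 / 4) ^ n) := by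
  induction n with
  | zero => norm_num
  | succ n ih =>
    rw [Finset.prod_range_succ]
    have h : (0 : ℝ) < (1 / 4) ^ n := by positivity
    calc _ ≤ 3 * (1 - 1 / 3 * (1 / 4 : ℝ) ^ n) * (1 + (1 / 4) ^ (n + 1)) := by gcongr
      _ ≤ _ := by
        rw [pow_succ]
        nlinarith

/-- After squaring, the claim is that the product of the 1 + 4^(-q) is at most 4. This makes
`scalAmp` at most 1, hence a legitimate amplitude. -/
theorem half_le_prod_keepAmp (L : ℕ) : 1 / 2 ≤ ∏ q ∈ Finset.range L, keepAmp q := by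
  refine le_of_sq_le_sq ?_ (Finset.prod_nonneg fun q _ => (keepAmp_pos q).le)
  rw [← Finset.prod_pow]
  simp only [keepAmp_sq, one_div]
  rw [Finset.prod_inv_distrib]
  rcases L with _ | n
  · norm_num
  · have h1 := prod_le_three n
    have h2 : (0 : ℝ) < (1 / 4) ^ n := by positivity
    have h3 : (0 : ℝ) < ∏ q ∈ Finset.range (n + 1), (1 + (1 / 4 : ℝ) ^ q) :=
      Finset.prod_pos fun q _ => by positivity
    simp only [one_div] at h1 h2 h3
    rw [inv_pow]
    refine inv_anti₀ h3 ?_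
    nlinarith

theorem scalAmp_sq_le (hL : 1 ≤ L) : scalAmp L ^ 2 ≤ 1 := by
  have h := half_le_prod_keepAmp L
  have hL' : (1 : ℝ) ≤ L := by exact_mod_cast hL
  have h1 : (1 : ℝ) ≤ 2 * L * ∏ q ∈ Finset.range L, keepAmp q := by nlinarith
  have h0 : 0 ≤ scalAmp L := by
    unfold scalAmp
    positivity
  have h2 : scalAmp L ≤ 1 := by
    unfold scalAmp
    rw [div_le_one (by linarith)]
    exact h1
  nlinarith

/-- The reflections that combine the levels. -/
def combineM (r : Reg d L) : Matrix (Fin 2) (Fin 2) ℂ :=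
  Sum.elim (Sum.elim (fun q : Fin (L + 1) => reflection (keepAmp q) ((1 / 2 : ℝ) ^ (q : ℕ) * keepAmp q))
    fun _ => reflection (scalAmp L) √(1 - scalAmp L ^ 2)) (fun _ => 1) r

/-- The labels of the levels. -/
def labSet (d L : ℕ) : Finset (Reg d L) := Finset.univ.image fun q : Fin L => lab q.castSucc

/-- Combination of the levels. -/
def combineOp (d L : ℕ) : QubitOp (Reg d L) :=
  muxAll (labSet d L ∪ {aux true}) fun r _ => combineM r

theorem combineM_mem (hL : 1 ≤ L) (r : Reg d L) :
    combineM r ∈ Matrix.unitaryGroup (Fin 2) ℂ := by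
  rcases r with (q | r) | r
  · exact reflection_mem (keepAmp_reflection q)
  · refine reflection_mem ?_
    rw [Real.sq_sqrt (by linarith [scalAmp_sq_le hL])]
    ring
  · exact one_mem _

theorem Impl.combineOp {Ω : Type} [Fintype Ω] [DecidableEq Ω] (hL : 1 ≤ L) :
    Impl Ω (L + 1) (BPX.combineOp d L) := by
  refine (Impl.muxAll (n := 1) _ _ (fun r _ => Impl.mux_const r (combineM_mem hL r))
    fun _ _ _ _ _ _ => rfl).mono ?_
  rw [mul_one]
  refine (Finset.card_union_le _ _).trans ?_
  rw [Finset.card_singleton]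
  exact Nat.succ_le_succ (Finset.card_image_le.trans (by simp))

theorem fixes_combineOp {r : Reg d L} (h1 : ∀ q : Fin L, r ≠ lab q.castSucc)
    (h2 : r ≠ aux true) : Fixes r (combineOp d L) := by
  refine Fixes.muxAll ?_ _
  simp [labSet, h2, fun q => (h1 q).symm]

/-- Every label contributes its `keepAmp`, the set label an additional 2^(-q). The scalar qubit
cancels the common product and supplies 1/(2L). -/
theorem combineOp_apply (hL : 1 ≤ L) (q : Fin L) {x y : Reg d L → Fin 2}
    (hx : ∀ k : Fin L, x (lab k.castSucc) = 0) (hx' : x (aux true) = 0)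
    (hy : ∀ k : Fin L, y (lab k.castSucc) = if k = q then 1 else 0) (hy' : y (aux true) = 0)
    (hxy : ∀ r, (∀ q : Fin L, r ≠ lab q.castSucc) → r ≠ aux true → x r = y r) :
    combineOp d L x y = (((1 / 2 : ℝ) ^ ((q : ℕ) + 1) / L : ℝ) : ℂ) := by
  have hinj : Injective fun q : Fin L => (lab q.castSucc : Reg d L) := by
    intro a b hab
    simpa using hab
  rw [combineOp, muxAll, if_pos, Finset.prod_union, Finset.prod_singleton, labSet,
    Finset.prod_image fun a _ b _ h => hinj h]
  · have h1 : ∀ k : Fin L, combineM (lab k.castSucc : Reg d L) (x (lab k.castSucc))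
        (y (lab k.castSucc)) = (keepAmp k : ℂ) * if k = q then (((1 / 2 : ℝ) ^ (q : ℕ) : ℝ) : ℂ)
          else 1 := by
      intro k
      rw [hx, hy]
      by_cases hk : k = q
      · subst hk
        simp [combineM, reflection, mul_comm]
      · simp [combineM, reflection, hk]
    have h2 : combineM (aux true : Reg d L) (x (aux true)) (y (aux true)) = (scalAmp L : ℂ) := by
      rw [hx', hy']
      simp [combineM, reflection]
    simp only [h1]
    rw [h2, Finset.prod_mul_distrib, Finset.prod_ite_eq', if_pos (Finset.mem_univ q),
      ← Complex.ofReal_prod, Fin.prod_univ_eq_prod_range (fun k => keepAmp k),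
      ← Complex.ofReal_mul, ← Complex.ofReal_mul, scalAmp]
    congr 1
    have h3 : (∏ q ∈ Finset.range L, keepAmp q) ≠ 0 :=
      (Finset.prod_pos fun q _ => keepAmp_pos q).ne'
    have h4 : (L : ℝ) ≠ 0 := by
      have : L ≠ 0 := by omega
      exact_mod_cast this
    rw [pow_succ]
    field_simp
  · rw [Finset.disjoint_singleton_right, labSet]
    simp
  · intro r hr
    rw [Finset.mem_union, not_or, Finset.mem_singleton] at hr
    exact hxy r (fun q h => hr.1 (Finset.mem_image.2 ⟨q, Finset.mem_univ q, h.symm⟩)) hr.2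

end Total

/-! ## The numbering of the grid points -/

/-- The number of grid points of the first `q` levels. -/
def off (d q : ℕ) : ℕ := ∑ i ∈ Finset.range q, (2 ^ (i + 1) - 1) ^ d

theorem off_succ (d q : ℕ) : off d (q + 1) = off d q + (2 ^ (q + 1) - 1) ^ d :=
  Finset.sum_range_succ _ _

theorem off_mono (d : ℕ) : Monotone (off d) :=
  monotone_nat_of_le_succ fun q => by rw [off_succ]; exact Nat.le_add_right _ _

theorem off_eq_numGridPoints (d L : ℕ) : off d L = numGridPoints d L :=
  (Fin.sum_univ_eq_sum_range (fun l => (2 ^ (l + 1) - 1) ^ d) L).symm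

theorem off_le {d L q : ℕ} (hd : 1 ≤ d) (hq : q ≤ L) : off d q ≤ 2 ^ (d * (L + 1)) :=
  (off_mono d hq).trans ((off_eq_numGridPoints d L).trans_le (numGridPoints_le d L hd))

theorem foldr_eq_self {Q α : Type*} {σ : Q → α → α} {z : α} {l : List Q} (h : ∀ q ∈ l, σ q z = z) :
    l.foldr σ z = z := by
  induction l with
  | nil => rfl
  | cons q l ih => rw [List.foldr_cons, ih fun q hq => h q (by simp [hq]), h q (by simp)]

/-- Only `q` moves `z`, and no other map moves the result, so the order of the list is irrelevant.
-/
theorem foldr_eq_of_mem {Q α : Type*} {σ : Q → α → α} {z z' : α} {q : Q} {l : List Q}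
    (hl : l.Nodup) (hq : q ∈ l) (h : σ q z = z') (h1 : ∀ p, p ≠ q → σ p z = z)
    (h2 : ∀ p, p ≠ q → σ p z' = z') : l.foldr σ z = z' := by
  induction l with
  | nil => simp at hq
  | cons p l ih =>
    rw [List.nodup_cons] at hl
    rw [List.foldr_cons]
    by_cases hpq : p = q
    · subst hpq
      rw [foldr_eq_self fun r hr => h1 r fun e => hl.1 (e ▸ hr), h]
    · rw [ih hl.2 ((List.mem_cons.1 hq).resolve_left (Ne.symm hpq)), h2 p hpq]

theorem mul_permOps_apply {Q α β : Type*} [Fintype α] [DecidableEq α] (σ : Q → α → α)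
    (l : List Q) (A : Matrix β α ℂ) (x : β) (y : α) :
    (A * (l.map fun q => permOp (σ q)).prod) x y = A x (l.foldr σ y) := by
  induction l generalizing A with
  | nil => simp
  | cons q l ih =>
    rw [List.map_cons, List.prod_cons, ← Matrix.mul_assoc, ih, mul_permOp_apply, List.foldr_cons]

section Total

variable {d L : ℕ}

open Reg

/-- Exchanges the numbers and the encodings of the grid points of the level `q + 1`. -/
def swapLevel (q : Fin L) : (Reg d L → Fin 2) → Reg d L → Fin 2 :=
  swapCode q.castSucc (q + 1) (off d q)

/-- The register with a given system word, whose ancilla qubits are zero. -/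
def start (w : Word d L) : Reg d L → Fin 2 := Sum.elim 0 w

/-- The word is the number of a grid point of the level `q + 1`. -/
def IsIndex (q : ℕ) (w : Word d L) : Prop :=
  ∃ c : Word d L, IsCode (q + 1) c ∧ w = wbits d L (encode (q + 1) (off d q) c)

theorem IsIndex.wval_lt (hd : 1 ≤ d) {q : ℕ} (hq : q < L) {w : Word d L} (h : IsIndex q w) :
    off d q ≤ wval w ∧ wval w < off d (q + 1) := by
  obtain ⟨c, hc, rfl⟩ := h
  have h1 := hc.encode_lt hq (off d q)
  rw [← off_succ] at h1
  rw [wval_wbits (h1.trans_le (off_le hd hq))]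
  exact ⟨Nat.le_add_right _ _, h1⟩

/-- The numbers of the level q + 1 lie between `off d q` and `off d (q + 1)`, and these intervals
are disjoint for different levels. -/
theorem IsIndex.eq (hd : 1 ≤ d) {q q' : ℕ} (hq : q < L) (hq' : q' < L) {w : Word d L}
    (h : IsIndex q w) (h' : IsIndex q' w) : q = q' := by
  have h1 := h.wval_lt hd hq
  have h2 := h'.wval_lt hd hq'
  by_contra hne
  rcases Nat.lt_or_gt_of_ne hne with hlt | hlt
  · have := off_mono d (Nat.succ_le_of_lt hlt)
    simp only [Nat.succ_eq_add_one] at this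
    omega
  · have := off_mono d (Nat.succ_le_of_lt hlt)
    simp only [Nat.succ_eq_add_one] at this
    omega

theorem swapLevel_start_of_not (q : Fin L) {w : Word d L} (h : ¬IsIndex q w) :
    swapLevel q (start w) = start w :=
  swapCode_of_not_index (fun _ => rfl) fun c hc e => h ⟨c, hc, e⟩

/-- Replaces the number of a grid point of any level by its encoding. -/
def decodeAll (z : Reg d L → Fin 2) : Reg d L → Fin 2 := (List.finRange L).foldr swapLevel z

theorem decodeAll_start (hd : 1 ≤ d) (q : Fin L) {c : Word d L} (hc : IsCode (q + 1) c) :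
    decodeAll (start (wbits d L (encode (q + 1) (off d q) c))) =
      setReg (start (wbits d L (encode (q + 1) (off d q) c))) q.castSucc 1 c := by
  have hq : q.1 < L := q.2
  refine foldr_eq_of_mem (List.nodup_finRange L) (List.mem_finRange q) ?_ ?_ ?_
  · exact swapCode_index hc (by omega) hq ((off_succ d q).ge.trans (off_le hd hq)) (fun _ => rfl) rfl
  · intro p hp
    exact swapLevel_start_of_not p fun h => hp (Fin.ext (h.eq hd p.2 hq ⟨c, hc, rfl⟩))
  · intro p hp
    refine swapCode_of_lab (q := q.castSucc) (fun h => hp (Fin.castSucc_injective _ h).symm) ?_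
    rw [setReg_lab, if_pos rfl]

theorem decodeAll_start_of_not {w : Word d L} (h : ∀ q < L, ¬IsIndex q w) :
    decodeAll (start w) = start w :=
  foldr_eq_self fun q _ => swapLevel_start_of_not q (h q q.2)

theorem decodeAll_last (z : Reg d L → Fin 2) :
    decodeAll z (lab (Fin.last L)) = z (lab (Fin.last L)) := by
  rw [decodeAll]
  induction List.finRange L with
  | nil => rfl
  | cons q l ih =>
    rw [List.foldr_cons, swapLevel, swapCode_apply_inl, ih]
    simp [(Fin.castSucc_lt_last q).ne']

/-! ## The block encoding -/

/-- Exchanges the numbers of the grid points of the finest level and their encodings. -/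
def swapLast (d L : ℕ) : (Reg d L → Fin 2) → Reg d L → Fin 2 :=
  swapCode (Fin.last L) L (off d (L - 1))

/-- The block encoding of the preconditioner. -/
def totalOp (d L : ℕ) : QubitOp (Reg d L) :=
  permOp (swapLast d L) * ((combineOp d L * permOp raiseFlags) *
    (interpOp d L * ((List.finRange L).map fun q => permOp (swapLevel q)).prod))

theorem off_last_le (hd : 1 ≤ d) (hL : 1 ≤ L) :
    off d (L - 1) + (2 ^ L - 1) ^ d ≤ 2 ^ (d * (L + 1)) := by
  have h := off_succ d (L - 1)
  rw [Nat.sub_add_cancel hL] at h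
  exact h.ge.trans (off_le hd le_rfl)

theorem swapLast_involutive (hd : 1 ≤ d) (hL : 1 ≤ L) : Involutive (swapLast d L) :=
  swapCode_involutive hL le_rfl (off_last_le hd hL)

theorem swapLevel_involutive (hd : 1 ≤ d) (q : Fin L) :
    Involutive (swapLevel q : (Reg d L → Fin 2) → Reg d L → Fin 2) :=
  swapCode_involutive (by omega) q.2 ((off_succ d q).ge.trans (off_le hd q.2))

theorem totalOp_eq_sum (hd : 1 ≤ d) (hL : 1 ≤ L) (x y : Reg d L → Fin 2) :
    totalOp d L x y = ∑ v, combineOp d L (swapLast d L x) (raiseFlags v) *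
      interpOp d L v (decodeAll y) := by
  rw [totalOp, permOp_mul_apply (swapLast_involutive hd hL),
    Matrix.mul_apply]
  simp only [mul_permOps_apply, mul_permOp_apply]
  rfl

theorem raiseFlags_last (z : Reg d L → Fin 2) :
    raiseFlags z (lab (Fin.last L)) = z (lab (Fin.last L)) + 1 := by
  simp [raiseFlags]

theorem raiseFlags_aux (z : Reg d L → Fin 2) :
    raiseFlags z (aux false) = z (aux false) + (1 + ∑ q : Fin L, z (lab q.castSucc)) := by
  simp [raiseFlags]

theorem raiseFlags_of_ne (z : Reg d L → Fin 2) {r : Reg d L} (h1 : r ≠ lab (Fin.last L))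
    (h2 : r ≠ aux false) : raiseFlags z r = z r := by
  rw [raiseFlags, update_of_ne h2, update_of_ne h1]

theorem lab_castSucc_ne_last (q : Fin L) : (lab q.castSucc : Reg d L) ≠ lab (Fin.last L) := by
  simp [(Fin.castSucc_lt_last q).ne]

theorem swapLast_index (hd : 1 ≤ d) (hL : 1 ≤ L) {c : Word d L} (hc : IsCode L c) :
    swapLast d L (start (wbits d L (encode L (off d (L - 1)) c))) =
      setReg (start (wbits d L (encode L (off d (L - 1)) c))) (Fin.last L) 1 c :=
  swapCode_index hc hL le_rfl (off_last_le hd hL) (fun _ => rfl) rfl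

theorem swapLast_of_not (hL : 1 ≤ L) {w : Word d L} (h : ¬IsIndex (L - 1) w) :
    swapLast d L (start w) = start w := by
  refine swapCode_of_not_index (fun _ => rfl) fun c hc e => h ⟨c, ?_, ?_⟩
  · rwa [Nat.sub_add_cancel hL]
  · rw [Nat.sub_add_cancel hL]
    exact e

/-- `raiseFlags` sets the last label, which interpolation and combination preserve. Only a number of
the finest level acquires this label under `swapLast`, so any other row has overlap zero. -/
theorem totalOp_eq_zero_of_row (hd : 1 ≤ d) (hL : 1 ≤ L) {wx : Word d L} (y : Word d L)
    (h : ¬IsIndex (L - 1) wx) : totalOp d L (start wx) (start y) = 0 := by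
  rw [totalOp_eq_sum hd hL, swapLast_of_not hL h]
  refine Finset.sum_eq_zero fun v _ => ?_
  by_cases hv : v (lab (Fin.last L)) = 0
  · rw [fixes_combineOp (r := lab (Fin.last L)) (fun q => (lab_castSucc_ne_last q).symm) (by simp),
      zero_mul]
    rw [raiseFlags_last, hv]
    exact zero_ne_one
  · rw [fixes_interpOp (r := Sum.inl (Fin.last L)) (by simp), mul_zero]
    rw [decodeAll_last]
    exact hv

theorem swapLast_aux (z : Reg d L → Fin 2) (b : Bool) : swapLast d L z (aux b) = z (aux b) :=
  swapCode_apply_inl z (by simp)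

/-- A number that no level accepts gets no label, so `raiseFlags` raises the flag and no later
operator lowers it. -/
theorem totalOp_eq_zero_of_column (hd : 1 ≤ d) (hL : 1 ≤ L) (wx : Word d L) {wy : Word d L}
    (h : ∀ q < L, ¬IsIndex q wy) : totalOp d L (start wx) (start wy) = 0 := by
  rw [totalOp_eq_sum hd hL, decodeAll_start_of_not h]
  refine Finset.sum_eq_zero fun v _ => ?_
  by_contra hne
  have hi : ∀ r : Anc L, (∀ k, r ≠ Sum.inr (Sum.inl k)) → v (Sum.inl r) = 0 := fun r hr => by
    by_contra hv
    exact right_ne_zero_of_mul hne (fixes_interpOp hr v _ hv)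
  refine left_ne_zero_of_mul hne (fixes_combineOp (r := aux false) (by simp) (by simp) _ _ ?_)
  rw [swapLast_aux, raiseFlags_aux, hi _ (by simp),
    Finset.sum_eq_zero fun q _ => hi (Sum.inl q.castSucc) (by simp)]
  exact zero_ne_one

/-- The label `q` controls bit k exactly when q + 1 + k < L. Since one label is set, the parity in
`hadM` is the test whether k lies below L - l. -/
theorem levelIs_setReg (q : Fin L) (w c : Word d L) :
    LevelIs (q + 1) (setReg (start w) q.castSucc 1 c) := by
  intro k hk
  rw [ctlSet, Finset.sum_image fun a _ b _ h => by simpa using h]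
  simp only [setReg_lab, (Fin.castSucc_injective L).eq_iff]
  refine (Finset.sum_ite_eq' _ q fun _ => (1 : Fin 2)).trans (if_congr ?_ rfl rfl)
  rw [Finset.mem_filter, add_comm k]
  simp

theorem totalOp_apply (hd : 1 ≤ d) (hL : 1 ≤ L) (q : Fin L) {c c' : Word d L}
    (hc : IsCode (q + 1) c) (hc' : IsCode L c') (m : Fin d → ℕ)
    (hm : ∀ i, m i + 2 ≤ 2 ^ ((q : ℕ) + 1))
    (hdig : ∀ (i : Fin d) (k : Fin L), c (i, k.castSucc) = bit (m i * 2 ^ (L - (q + 1))) k) :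
    totalOp d L (start (wbits d L (encode L (off d (L - 1)) c')))
      (start (wbits d L (encode (q + 1) (off d q) c))) =
      (((1 / 2 : ℝ) ^ ((q : ℕ) + 1) / L : ℝ) : ℂ) * ∏ i, invSqrtTwo ^ (3 * (L - (q + 1))) *
        (hatCount (2 ^ (L - (q + 1))) (m i) (fval fun k : Fin L => c' (i, k.castSucc)) : ℂ) := by
  rw [totalOp_eq_sum hd hL, decodeAll_start hd q hc, swapLast_index hd hL hc']
  generalize wbits d L (encode L (off d (L - 1)) c') = wx
  generalize wbits d L (encode (q + 1) (off d q) c) = wy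
  have hlast : ∀ {l : ℕ} {w : Word d L}, IsCode l w → ∀ i, w (i, Fin.last L) = 0 :=
    fun h i => (h i).1 _ (by simp)
  -- Interpolation preserves labels and flags; combination preserves the adder and the system. One
  -- intermediate state is compatible with both sides.
  rw [Finset.sum_eq_single (setReg (start wy) q.castSucc 1 c')]
  · congr 1
    · refine combineOp_apply hL q (fun k => ?_) rfl (fun k => ?_) ?_ ?_
      · rw [setReg_lab, if_neg (Fin.castSucc_lt_last k).ne]
        rfl
      · rw [raiseFlags_of_ne _ (lab_castSucc_ne_last k) (by simp), setReg_lab]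
        simp only [(Fin.castSucc_injective L).eq_iff]
        rfl
      · rw [raiseFlags_of_ne _ (by simp) (by simp)]
        rfl
      · rintro ((p | k | b) | p) h1 h2
        · induction p using Fin.lastCases with
          | last =>
            rw [raiseFlags_last, setReg_lab, setReg_lab, if_pos rfl,
              if_neg (Fin.castSucc_lt_last q).ne']
            rfl
          | cast p => exact absurd rfl (h1 p)
        · rw [raiseFlags_of_ne _ (by simp) (by simp)]
          rfl
        · cases b
          · rw [raiseFlags_aux]
            simp only [setReg_lab, (Fin.castSucc_injective L).eq_iff]
            have : ∑ p : Fin L, (if p = q then 1 else start wy (lab p.castSucc)) = 1 :=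
              (Finset.sum_ite_eq' Finset.univ q fun _ => (1 : Fin 2)).trans (by simp)
            rw [this]
            rfl
          · exact absurd rfl h2
        · rw [raiseFlags_of_ne _ (by simp) (by simp)]
          rfl
    · exact interpOp_apply m q.2 hm (levelIs_setReg q wy c) (fun _ => rfl) (hlast hc) (hlast hc')
        hdig fun _ => rfl
  · intro v _ hv
    by_contra hne
    have hC : ∀ r : Reg d L, (∀ q : Fin (L + 1), r ≠ lab q) → (∀ b, r ≠ aux b) →
        setReg (start wx) (Fin.last L) 1 c' r = v r := fun r h1 h2 => by
      by_contra h
      refine left_ne_zero_of_mul hne (fixes_combineOp (r := r) (fun q => h1 _) (h2 _) _ _ ?_)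
      rwa [raiseFlags_of_ne _ (h1 _) (h2 _)]
    have hI : ∀ r : Anc L, (∀ k, r ≠ Sum.inr (Sum.inl k)) →
        v (Sum.inl r) = setReg (start wy) q.castSucc 1 c (Sum.inl r) := fun r hr => by
      by_contra h
      exact right_ne_zero_of_mul hne (fixes_interpOp hr v _ h)
    refine hv (funext ?_)
    rintro ((p | k | b) | p)
    · exact hI _ (by simp)
    · exact (hC (anc k) (by simp) (by simp)).symm
    · exact hI _ (by simp)
    · exact (hC (Sum.inr p) (by simp) (by simp)).symm
  · simp

theorem Impl.permOp_reg {σ : (Reg d L → Fin 2) → Reg d L → Fin 2} (hσ : Involutive σ)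
    (h : Reach (320 * ((d + 1) * (L + 2)) ^ 2) ∅ {f | ∃ r, f = fun x => σ x r}) {w : ℕ}
    (hw : 320 * ((d + 1) * (L + 2)) ^ 2 ≤ w) :
    Impl (Fin w ⊕ Reg d L) (7690 * ((d + 1) * (L + 2)) ^ 2) (permOp σ) := by
  refine (Impl.permOp_of_reach hσ h hw).mono ?_
  rw [card_reg]
  have h1 : 2 * L + 3 + d * (L + 1) ≤ 2 * ((d + 1) * (L + 2)) := by nlinarith
  have h2 : (d + 1) * (L + 2) ≤ ((d + 1) * (L + 2)) ^ 2 := Nat.le_self_pow two_ne_zero _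
  omega

theorem Impl.totalOp (hd : 1 ≤ d) (hL : 1 ≤ L) {w : ℕ} (hw : 320 * ((d + 1) * (L + 2)) ^ 2 ≤ w) :
    Impl (Fin w ⊕ Reg d L) (40000 * ((d + 1) * (L + 2)) ^ 3) (BPX.totalOp d L) := by
  have h1 := Impl.permOp_reg (swapLast_involutive hd hL)
    (reach_swapCode (Fin.last L) hL le_rfl (off d (L - 1))) hw
  have h2 := Impl.list_prod ((List.finRange L).map fun q => permOp (swapLevel (d := d) q))
    (Ω := Fin w ⊕ Reg d L) (n := 7690 * ((d + 1) * (L + 2)) ^ 2) fun U hU => by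
      obtain ⟨q, -, rfl⟩ := List.mem_map.1 hU
      exact Impl.permOp_reg (swapLevel_involutive hd q)
        (reach_swapCode q.castSucc (by omega) q.2 (off d q)) hw
  have h3 := Impl.permOp_reg (raiseFlags_involutive (d := d) (L := L)) reach_raiseFlags hw
  refine (h1.mul (((Impl.combineOp hL).mul h3).mul ((Impl.interpOp hw).mul h2))).mono ?_
  rw [List.length_map, List.length_finRange, pow_succ]
  have h4 : d + (L + 2) ≤ (d + 1) * (L + 2) := by nlinarith
  have h5 : 1 ≤ ((d + 1) * (L + 2)) ^ 2 := Nat.one_le_pow _ _ (by positivity)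
  have h6 : d ≤ (d + 1) * (L + 2) := by omega
  generalize ((d + 1) * (L + 2)) = N at *
  nlinarith [Nat.mul_le_mul_left (N ^ 2) h4]

end Total

/-! ## The numbers of the grid points -/

section CodeWord

variable {d L : ℕ}

/-- The encoding of a grid point. -/
def codeWord (L : ℕ) {l : ℕ} (m : Node d l) : Word d L :=
  fun p => bit ((m (Fin.rev p.1) : ℕ) * 2 ^ (L - l)) p.2

theorem bit_mul_pow_add (m t k : ℕ) : bit (m * 2 ^ t) (k + t) = bit m k := by
  rw [← bit_div, Nat.mul_div_cancel _ (Nat.two_pow_pos t)]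

/-- A number with l bits all equal to one is 2^l - 1, which the bound excludes. -/
theorem exists_bit_eq_zero {l m : ℕ} (h : m + 2 ≤ 2 ^ l) : ∃ k < l, bit m k = 0 := by
  by_contra! hne
  have h1 : ∀ k < l, bit m k = bit (2 ^ l - (0 + 1)) k := fun k hk => by
    rw [bit_compl (Nat.two_pow_pos l) hk, bit_of_lt (Nat.two_pow_pos k)]
    exact (by decide : ∀ a : Fin 2, a ≠ 0 → a = 1 + 0) _ (hne k hk)
  have := bit_injOn (by omega) (by omega) h1
  omega

theorem node_add_two_le {l : ℕ} (m : Node d l) (i : Fin d) : (m i : ℕ) + 2 ≤ 2 ^ l := by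
  have := (m i).2
  omega

theorem isCode_codeWord {l : ℕ} (hl : l ≤ L) (m : Node d l) : IsCode l (codeWord L m) := by
  intro j
  have hm := node_add_two_le m (Fin.rev j)
  constructor
  · intro k hk
    by_cases h : (k : ℕ) < L - l
    · exact bit_mul_pow_of_lt h
    · refine bit_of_lt (lt_of_lt_of_le ?_ (Nat.pow_le_pow_right two_pos (by omega : L ≤ k)))
      calc (m (Fin.rev j) : ℕ) * 2 ^ (L - l) < 2 ^ l * 2 ^ (L - l) :=
            Nat.mul_lt_mul_of_pos_right (by omega) (Nat.two_pow_pos _)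
        _ = 2 ^ L := by rw [← pow_add, Nat.add_sub_cancel' hl]
  · obtain ⟨k, hk, h0⟩ := exists_bit_eq_zero hm
    refine ⟨⟨k + (L - l), by omega⟩, by simp; omega, ?_⟩
    rw [codeWord, bit_mul_pow_add, h0]

/-- Block j has weight (2^l - 1)^j while the first coordinate is the most significant one, so block
j stores the coordinate `Fin.rev j`. -/
theorem encode_codeWord {l : ℕ} (hl : l ≤ L) (a : ℕ) (m : Node d l) :
    encode l a (codeWord L m) = a + (finFunctionFinEquiv fun j => m (Fin.rev j) : Fin _) := by
  rw [encode, sum_blocks, ← Fin.sum_univ_eq_sum_range (fun j => (∑ k ∈ Finset.range l,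
    (codeBit l (codeWord L m) (j * l + k) : ℕ) * 2 ^ k) * (2 ^ l - 1) ^ j),
    finFunctionFinEquiv_apply]
  congr 1
  refine Finset.sum_congr rfl fun j _ => ?_
  congr 1
  have hm := node_add_two_le m (Fin.rev j)
  refine (Finset.sum_congr rfl fun k hk => ?_).trans
    ((sum_bit (m (Fin.rev j)) l).trans (Nat.mod_eq_of_lt (by omega)))
  have hk := Finset.mem_range.1 hk
  rw [codeBit_eq hk, wget, dif_pos ⟨j.2, by omega⟩, codeWord, bit_mul_pow_add]

theorem encode_eq_gridIndex (g : GridPoint d L) :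
    encode (g.1 + 1) (off d g.1) (codeWord L g.2) = gridIndex d L g := by
  rw [encode_codeWord g.1.2, gridIndex, Equiv.trans_apply, Equiv.sigmaCongrRight_apply,
    finSigmaFinEquiv_apply]
  exact congrArg (· + _) (Fin.sum_univ_eq_sum_range (fun n => (2 ^ (n + 1) - 1) ^ d) g.1).symm

theorem isIndex_gridIndex (g : GridPoint d L) :
    IsIndex g.1 (wbits d L (gridIndex d L g)) :=
  ⟨codeWord L g.2, isCode_codeWord g.1.2 g.2, by rw [encode_eq_gridIndex]⟩

theorem fval_codeWord {l : ℕ} (hl : L = l) (m : Node d l) (i : Fin d) :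
    fval (fun k : Fin L => codeWord L m (i, k.castSucc)) = m (Fin.rev i) := by
  subst hl
  have hm := node_add_two_le m (Fin.rev i)
  rw [fval_eq_iff (by omega)]
  intro k
  simp [codeWord]

end CodeWord

/-! ## The entries of the preconditioner -/

/-- Evaluating the defining identity for a unit vector at the fine node `p` isolates one entry,
because every other fine basis function vanishes there. -/
theorem interp_apply {d l l' : ℕ} (h : l ≤ l') (p : Node d l') (m : Node d l) :
    interp d l l' h p m = ∏ i, max 0 (1 - |((p i : ℝ) + 1) / 2 ^ (l' - l) - ((m i : ℝ) + 1)|) := by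
  have hI := (existsUnique_interpolation d l l' h).choose_spec.1 (Pi.single m 1)
    (fun i => ⟨((p i : ℕ) + 1 : ℝ) / 2 ^ l', by positivity, by
      rw [div_le_one (by positivity)]
      have h := (p i).2
      exact_mod_cast (by omega : (p i : ℕ) + 1 ≤ 2 ^ l')⟩)
  simp only [nodal_node] at hI
  have hI' : interp d l l' h p m = ∏ i, hat l ((m i : ℕ) + 1) (((p i : ℕ) + 1 : ℝ) / 2 ^ l') := by
    rw [interp]
    simpa [Pi.single_apply, nodal] using hI
  rw [hI']
  refine Finset.prod_congr rfl fun i _ => ?_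
  rw [hat_eq]
  obtain ⟨t, rfl⟩ := Nat.exists_eq_add_of_le h
  rw [Nat.add_sub_cancel_left, pow_add (2 : ℝ)]
  push_cast
  congr 4
  field_simp

theorem hatCount_eq {K m N : ℕ} (hK : 1 ≤ K) :
    hatCount K m N = min K (N + 1 - m * K) - (N + 1 - (m + 1) * K) := by
  rw [hatCount, ← Nat.card_Ico]
  congr 1
  ext j
  rw [Finset.mem_filter, Finset.mem_range, Finset.mem_Ico, Nat.div_eq_iff (by omega), add_mul]
  rw [mul_comm m K]
  omega

/-- The convolution of two boxes of length K is a hat of height K, with its peak at N + 1 = (m +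
1)K; the shifts by one come from numbering nodes from zero. The identity is checked over the
integers. -/
theorem cast_hatCount {K m N : ℕ} (hK : 1 ≤ K) :
    (hatCount K m N : ℝ) = K * max 0 (1 - |((N : ℝ) + 1) / K - ((m : ℝ) + 1)|) := by
  have hK' : (0 : ℝ) < K := by exact_mod_cast hK
  have e : (K : ℝ) * max 0 (1 - |((N : ℝ) + 1) / K - ((m : ℝ) + 1)|) =
      max 0 (K - |(N : ℝ) + 1 - ((m : ℝ) + 1) * K|) := by
    rw [mul_max_of_nonneg _ _ hK'.le, mul_zero, mul_sub, mul_one]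
    congr 2
    nth_rewrite 1 [← abs_of_pos hK']
    rw [← abs_mul, mul_sub, mul_div_cancel₀ _ hK'.ne']
    ring_nf
  rw [e]
  have e2 : ((hatCount K m N : ℕ) : ℤ) = max 0 ((K : ℤ) - |(N : ℤ) + 1 - ((m : ℤ) + 1) * K|) := by
    rw [hatCount_eq hK]
    have : ((m : ℤ) + 1) * K = ((m * K : ℕ) : ℤ) + K := by push_cast; ring
    rw [this, add_mul, one_mul]
    generalize m * K = M
    rcases abs_cases ((N : ℤ) + 1 - ((M : ℤ) + K)) with h | h <;> omega
  exact_mod_cast e2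

theorem precond_gridIndex {d L : ℕ} (p g : GridPoint d L) :
    precond d L (gridIndex d L p) (gridIndex d L g) = if (p.1 : ℕ) + 1 = L then
      (2 : ℝ) ^ (-(((g.1 : ℕ) : ℝ) + 1) * (2 - (d : ℝ)) / 2) *
        ∏ i, max 0 (1 - |((p.2 i : ℝ) + 1) / 2 ^ (L - (g.1 + 1)) - ((g.2 i : ℝ) + 1)|) else 0 := by
  rw [precond, Matrix.reindex_apply, Matrix.submatrix_apply, Equiv.symm_apply_apply,
    Equiv.symm_apply_apply, Matrix.sum_apply]
  simp only [Matrix.smul_apply, smul_eq_mul, interpHat]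
  split_ifs with h
  · rw [Finset.sum_eq_single g.1, dif_pos ⟨rfl, h⟩, interp_apply]
    · simp only [h]
    · intro l _ hl
      rw [dif_neg, mul_zero]
      exact fun h' => hl (Fin.ext (by omega))
    · simp
  · refine Finset.sum_eq_zero fun l _ => ?_
    rw [dif_neg, mul_zero]
    exact fun h' => h h'.2

/-- With t = L - l each coordinate carries 2^(-3t/2) 2^t = 2^(-t/2). The total exponent is dL/2 - l
- dt/2 = -l(2 - d)/2. -/
theorem amplitude_eq {d L l : ℕ} (hL : 1 ≤ L) (hl : l ≤ L) (H : Fin d → ℝ) :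
    ((L : ℝ) * (2 : ℝ) ^ ((d : ℝ) * (L : ℝ) / 2)) * ((1 / 2 : ℝ) ^ l / L *
      ∏ i, ((1 / √2) ^ (3 * (L - l)) * (((2 ^ (L - l) : ℕ) : ℝ) * H i))) =
      (2 : ℝ) ^ (-(l : ℝ) * (2 - (d : ℝ)) / 2) * ∏ i, H i := by
  obtain ⟨t, rfl⟩ := Nat.exists_eq_add_of_le hl
  rw [Nat.add_sub_cancel_left]
  have h2 : (0 : ℝ) < 2 := two_pos
  have hL' : ((l + t : ℕ) : ℝ) ≠ 0 := by
    have : l + t ≠ 0 := by omega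
    exact_mod_cast this
  have e1 : (1 / √2 : ℝ) ^ (3 * t) * ((2 ^ t : ℕ) : ℝ) = (2 : ℝ) ^ (-(t : ℝ) / 2) := by
    rw [Real.sqrt_eq_rpow, one_div, ← Real.rpow_neg h2.le, ← Real.rpow_natCast,
      ← Real.rpow_mul h2.le, Nat.cast_pow, Nat.cast_ofNat, ← Real.rpow_natCast 2 t,
      ← Real.rpow_add h2]
    congr 1
    push_cast
    ring
  have e2 : (1 / 2 : ℝ) ^ l = (2 : ℝ) ^ (-(l : ℝ)) := by
    rw [one_div, inv_pow, Real.rpow_neg h2.le, Real.rpow_natCast]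
  simp only [← mul_assoc, e1]
  rw [Finset.prod_mul_distrib, Finset.prod_const, Finset.card_univ, Fintype.card_fin,
    ← Real.rpow_natCast _ d, ← Real.rpow_mul h2.le, e2]
  have e3 : (2 : ℝ) ^ (-(l : ℝ) * (2 - (d : ℝ)) / 2) = (2 : ℝ) ^ ((d : ℝ) * ((l + t : ℕ) : ℝ) / 2) *
      2 ^ (-(l : ℝ)) * 2 ^ (-(t : ℝ) / 2 * d) := by
    rw [← Real.rpow_add h2, ← Real.rpow_add h2]
    congr 1
    push_cast
    ring
  rw [e3]
  field_simp

theorem totalOp_gridIndex {d L : ℕ} (hd : 1 ≤ d) (hL : 1 ≤ L) (p g : GridPoint d L) :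
    (((L : ℝ) * (2 : ℝ) ^ ((d : ℝ) * (L : ℝ) / 2) : ℝ) : ℂ) *
      totalOp d L (start (wbits d L (gridIndex d L p))) (start (wbits d L (gridIndex d L g))) =
      (precond d L (gridIndex d L p) (gridIndex d L g) : ℂ) := by
  rw [precond_gridIndex]
  split_ifs with h
  · have hc' : IsCode ((p.1 : ℕ) + 1) (codeWord L p.2) := isCode_codeWord p.1.2 p.2
    have hp := encode_eq_gridIndex p
    have hp1 : (p.1 : ℕ) = L - 1 := by omega
    have hv := fval_codeWord h.symm p.2
    generalize codeWord L p.2 = P at hc' hp hv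
    rw [h] at hc'
    rw [h, hp1] at hp
    rw [← hp, ← encode_eq_gridIndex g, totalOp_apply hd hL g.1 (isCode_codeWord g.1.2 g.2) hc'
      (fun i => (g.2 (Fin.rev i) : ℕ)) (fun i => node_add_two_le g.2 _) fun i k => rfl,
      ← Equiv.prod_comp Fin.revPerm]
    have := amplitude_eq (d := d) hL g.1.2 fun i =>
      max 0 (1 - |((p.2 i : ℝ) + 1) / 2 ^ (L - (g.1 + 1)) - ((g.2 i : ℝ) + 1)|)
    push_cast at this
    rw [← this]
    push_cast
    congr 2
    refine Finset.prod_congr rfl fun i _ => ?_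
    rw [hv, ← Complex.ofReal_natCast, cast_hatCount Nat.one_le_two_pow]
    simp [invSqrtTwo]
  · rw [totalOp_eq_zero_of_row hd hL, mul_zero, Complex.ofReal_zero]
    intro h'
    have := (isIndex_gridIndex p).eq hd p.1.2 (by omega) h'
    omega

theorem totalOp_eq_zeroPad {d L : ℕ} (hd : 1 ≤ d) (hL : 1 ≤ L) (x y : Word d L) :
    (((L : ℝ) * (2 : ℝ) ^ ((d : ℝ) * (L : ℝ) / 2) : ℝ) : ℂ) *
      totalOp d L (start x) (start y) =
      zeroPad (2 ^ (d * (L + 1))) (precond d L) ⟨wval x, wval_lt x⟩ ⟨wval y, wval_lt y⟩ := by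
  have hind : ∀ (z : Word d L) (q : ℕ), q < L → IsIndex q z → wval z < numGridPoints d L :=
    fun z q hq hz => (hz.wval_lt hd hq).2.trans_le
      ((off_mono d hq).trans (off_eq_numGridPoints d L).le)
  rw [zeroPad]
  split_ifs with h
  · obtain ⟨p, hp⟩ := (gridIndex d L).surjective ⟨wval x, h.1⟩
    obtain ⟨g, hg⟩ := (gridIndex d L).surjective ⟨wval y, h.2⟩
    have := totalOp_gridIndex hd hL p g
    rwa [hp, hg, wbits_wval, wbits_wval] at this
  · by_cases hx : wval x < numGridPoints d L
    · rw [totalOp_eq_zero_of_column hd hL, mul_zero]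
      exact fun q hq hy => h ⟨hx, hind y q hq hy⟩
    · rw [totalOp_eq_zero_of_row hd hL, mul_zero]
      exact fun hx' => hx (hind x _ (by omega) hx')

/-! ## Relabelling the qubits -/

section Relabel

variable {ι ι' : Type} [Fintype ι] [DecidableEq ι] [Fintype ι'] [DecidableEq ι']

/-- Relabels the qubits of a gate. -/
def Gate.relabel (e : ι ≃ ι') : Gate ι → Gate ι'
  | .one i u => .one (e i) u
  | .two i j h u => .two (e i) (e j) (e.injective.ne h) u

theorem Gate.toOp_relabel (e : ι ≃ ι') (g : Gate ι) (x y : ι' → Fin 2) :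
    (g.relabel e).toOp x y = g.toOp (x ∘ e) (y ∘ e) := by
  cases g with
  | one i u => simp only [relabel, toOp, ← e.forall_congr_right, comp_apply, ne_eq, e.apply_eq_iff_eq]
  | two i j h u =>
    simp only [relabel, toOp, ← e.forall_congr_right, comp_apply, ne_eq, e.apply_eq_iff_eq]

theorem Circuit.toOp_map_relabel (e : ι ≃ ι') (c : Circuit ι) (x y : ι' → Fin 2) :
    Circuit.toOp (c.map (Gate.relabel e)) x y = Circuit.toOp c (x ∘ e) (y ∘ e) := by
  induction c generalizing x y with
  | nil =>
    rw [List.map_nil, Circuit.toOp, Circuit.toOp, Matrix.one_apply, Matrix.one_apply]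
    exact if_congr e.surjective.injective_comp_right.eq_iff.symm rfl rfl
  | cons g c ih =>
    rw [List.map_cons, Circuit.toOp, Circuit.toOp, Matrix.mul_apply, Matrix.mul_apply,
      ← (e.symm.arrowCongr (Equiv.refl (Fin 2))).sum_comp]
    exact Finset.sum_congr rfl fun v _ => congrArg₂ (· * ·) (ih x v) (Gate.toOp_relabel e g v y)

/-- Relabels the qubits of an operator. -/
def relabelOp (e : ι ≃ ι') (U : QubitOp ι) : QubitOp ι' :=
  U.submatrix (e.symm.arrowCongr (Equiv.refl (Fin 2))) (e.symm.arrowCongr (Equiv.refl (Fin 2)))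

theorem relabelOp_apply (e : ι ≃ ι') (U : QubitOp ι) (x y : ι' → Fin 2) :
    relabelOp e U x y = U (x ∘ e) (y ∘ e) := rfl

theorem Impl.exists_implements {Ω κ κ' : Type} [Fintype Ω] [DecidableEq Ω] [Fintype κ]
    [DecidableEq κ] [Fintype κ'] [DecidableEq κ'] {n w : ℕ} {U : QubitOp κ} (h : Impl Ω n U)
    (eΩ : Ω ≃ Fin w) (e : κ ≃ κ') :
    relabelOp e U ∈ Matrix.unitaryGroup (κ' → Fin 2) ℂ ∧
      ∃ c : Circuit (Fin w ⊕ κ'), c.length ≤ n ∧ c.Implements (relabelOp e U) := by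
  obtain ⟨hU, c, hc, h⟩ := h
  constructor
  · rw [Matrix.mem_unitaryGroup_iff] at hU ⊢
    rw [relabelOp, Matrix.star_eq_conjTranspose, Matrix.conjTranspose_submatrix, Matrix.submatrix_mul_equiv,
      ← Matrix.star_eq_conjTranspose, hU, Matrix.submatrix_one_equiv]
  · refine ⟨c.map (Gate.relabel (Equiv.sumCongr eΩ e)), by rwa [List.length_map], fun a x y => ?_⟩
    have h1 : ∀ (a : Fin w → Fin 2) (x : κ' → Fin 2),
        Sum.elim a x ∘ Equiv.sumCongr eΩ e = Sum.elim (a ∘ eΩ) (x ∘ e) := fun a x => by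
      funext r
      rcases r with r | r <;> rfl
    rw [Circuit.toOp_map_relabel, h1, h1]
    refine (h _ _ _).trans (if_congr ?_ rfl rfl)
    exact (eΩ.surjective.injective_comp_right.eq_iff (a := a) (b := 0))

end Relabel

end BPX

end

theorem mainTheorem5 :
    ∃ p P : Polynomial ℕ, ∀ d L : ℕ, 1 ≤ d → 1 ≤ L →
      ∃ (q w : ℕ) (U : BPX.QubitOp (Fin q ⊕ Fin (d * (L + 1))))
        (c : BPX.Circuit (Fin w ⊕ (Fin q ⊕ Fin (d * (L + 1))))),
        BPX.IsBlockEncoding ((L : ℝ) * (2 : ℝ) ^ ((d : ℝ) * (L : ℝ) / 2)) q 0 U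
          (BPX.toQubits (BPX.zeroPad (2 ^ (d * (L + 1))) (BPX.precond d L))) ∧
        q ≤ p.eval L ∧
        BPX.Circuit.Implements c U ∧
        q + w ≤ P.eval (d * L) ∧
        c.length ≤ P.eval (d * L) := by
  -- There are 2L + 3 ancillas: L + 1 labels, L adder bits, the flag and the scalar qubit. The
  -- constant is 40000 · 216, from the gate count in `Impl.totalOp` and (d + 1)(L + 2) ≤ 6dL.
  refine ⟨2 * Polynomial.X + 3, 8640000 * Polynomial.X ^ 3, fun d L hd hL => ?_⟩
  have hN : (d + 1) * (L + 2) ≤ 6 * (d * L) := by nlinarith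
  have hn : 1 ≤ d * L := Nat.mul_pos hd hL
  have hN3 : ((d + 1) * (L + 2)) ^ 3 ≤ 216 * (d * L) ^ 3 :=
    (Nat.pow_le_pow_left hN 3).trans_eq (by ring)
  have hN2 : ((d + 1) * (L + 2)) ^ 2 ≤ ((d + 1) * (L + 2)) ^ 3 :=
    Nat.pow_le_pow_right (by positivity) (by norm_num)
  have hN1 : (d + 1) * (L + 2) ≤ ((d + 1) * (L + 2)) ^ 3 := Nat.le_self_pow (by norm_num) _
  have hq : Fintype.card (BPX.Anc L) = 2 * L + 3 := by
    simp
    ring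
  let e : BPX.Reg d L ≃ Fin (Fintype.card (BPX.Anc L)) ⊕ Fin (d * (L + 1)) :=
    Equiv.sumCongr (Fintype.equivFin (BPX.Anc L)) finProdFinEquiv
  obtain ⟨hU, c, hc, himpl⟩ := (BPX.Impl.totalOp hd hL le_rfl).exists_implements
    (Fintype.equivFin (Fin (320 * ((d + 1) * (L + 2)) ^ 2) ⊕ BPX.Reg d L)) e
  refine ⟨_, _, _, c, ⟨hU, ?_⟩, ?_, himpl, ?_, hc.trans ?_⟩
  · have h : ∀ x : Fin (d * (L + 1)) → Fin 2, (Sum.elim 0 x ∘ e : BPX.Reg d L → Fin 2) =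
        BPX.start (x ∘ finProdFinEquiv) := fun x => by
      funext r
      rcases r with r | r <;> rfl
    have hval : ∀ x : Fin (d * (L + 1)) → Fin 2,
        (⟨BPX.wval (x ∘ finProdFinEquiv : BPX.Word d L), BPX.wval_lt _⟩ : Fin (2 ^ (d * (L + 1)))) =
          finFunctionFinEquiv x := fun x => by
      refine Fin.ext (congrArg (fun f => (finFunctionFinEquiv f : ℕ)) (?_ : _ = x))
      exact funext fun k => congrArg x (finProdFinEquiv.apply_symm_apply k)
    have hA : BPX.toQubits (BPX.zeroPad (2 ^ (d * (L + 1))) (BPX.precond d L)) =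
        (((L : ℝ) * (2 : ℝ) ^ ((d : ℝ) * (L : ℝ) / 2) : ℝ) : ℂ) •
          BPX.zeroBlock (BPX.relabelOp e (BPX.totalOp d L)) := by
      ext x y
      rw [Matrix.smul_apply, BPX.zeroBlock, BPX.relabelOp_apply, h, h, smul_eq_mul,
        BPX.totalOp_eq_zeroPad hd hL, hval, hval]
      rfl
    rw [← hA, sub_self, map_zero, norm_zero]
  · rw [hq]
    simp
  · rw [hq, Fintype.card_sum, Fintype.card_fin, BPX.card_reg]
    have h1 : 2 * L + 3 + (2 * L + 3 + d * (L + 1)) ≤ 4 * ((d + 1) * (L + 2)) := by nlinarith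
    simp only [Polynomial.eval_mul, Polynomial.eval_pow, Polynomial.eval_X, Polynomial.eval_ofNat]
    omega
  · simp only [Polynomial.eval_mul, Polynomial.eval_pow, Polynomial.eval_X, Polynomial.eval_ofNat]
    omega
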